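/- **Theorem.** For a pair of graphs $G_1=(V,E_1)$, $G_2=(V,E_2)$ on $V=[n]$, let $\widehat G$ be the graph with vertex set $\widehat V=E_1\cup E_2$ in which two distinct edges $e,f$ are adjacent iff they share an endpoint and both lie in $E_1$ or both lie in $E_2$; put $m=|E_1\cup E_2|$. Given lists $L(e)\subset\mathbb N$ ($e\in\widehat V$) with $|L(e)|=k$, an $L$-coloring is a map $\sigma:\widehat V\to\mathbb N$ with $\sigma(e)\in L(e)$ for all $e$; it is proper (a simultaneous edge list coloring) if adjacent vertices of $\widehat G$ get different colors. For an $L$-coloring $\sigma$, $v\in\widehat V$ and a color $c$, the cluster $S_\sigma(v,c)$ is the set of vertices reachable from $v$ by a path in $\widehat G$ whose colors alternate between $\sigma(v)$ and $c$, with $S_\sigma(v,\sigma(v))=\{v\}$; it is flippable if $\{\sigma(v),c\}\subseteq L(w)$ for all $w\in S_\sigma(v,c)$. The flip dynamics with flip probabilities $(P_i)_{i\ge1}$, $P_1=1$, $0\le P_i\le1$, is the Markov chain on the set of all $L$-colorings (proper or not) which, from $\sigma$, chooses $(v,i)\in\widehat V\times[k]$ uniformly at random, lets $c$ be the $i$-th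 smallest element of $L(v)$ and $s=|S_\sigma(v,c)|$, and, if $S_\sigma(v,c)$ is flippable, interchanges the colors $\sigma(v)$ and $c$ on $S_\sigma(v,c)$ with probability $P_s/s$; otherwise it stays at $\sigma$. It is 6-local if $P_i=0$ for all $i>6$. Take the 6-local setting $$P_1=1,\quad P_2=\tfrac{137}{650},\quad P_3=\tfrac{77}{650},\quad P_4=\tfrac{47}{650},\quad P_5=\tfrac{27}{650},\quad P_6=\tfrac{12}{650},\quad P_i=0\ (i\ge7).$$ There is an absolute constant $C$ such that for all $n,\Delta,k$ with $k\ge 5.948\,\Delta$, all $G_1,G_2$ on $[n]$ of maximum degree at most $\Delta$ with $E_1\cup E_2\neq\emptyset$, and all lists $L$ with $|L(e)|=k$ for every $e$, the uniform distribution $\pi$ on the proper $L$-colorings is a (well-defined) stationary distribution of the flip dynamics, and $$T_{\mathrm{mix}}=\max_{X_0}\min\{t: d_{\mathrm{TV}}(P^t(X_0,\cdot),\pi)\le 1/4\}\le C\,m\log n,$$ where $P$ is the transition matrix and the maximum is over all $L$-colorings $X_0$. (From a proper $L$-coloring the chain visits only proper $L$-colorings, so the same bound holds for the chain on proper $L$-colorings.)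 -/

import Mathlib

/-! ### Simultaneous edge colourings as vertex colourings of the union of the line graphs -/

/-- The edges of `E₁ ∪ E₂`, i.e. the vertices of the union of the two line graphs. -/
abbrev SimEdge {V : Type*} (G₁ G₂ : SimpleGraph V) : Type _ :=
  {e : Sym2 V // e ∈ G₁.edgeSet ∨ e ∈ G₂.edgeSet}

/-- The union of the line graphs of `G₁` and `G₂`, with common edges identified: two distinct
edges are adjacent iff they share an endpoint and lie together in `E₁` or together in `E₂`. -/
def simLineGraph {V : Type*} (G₁ G₂ : SimpleGraph V) : SimpleGraph (SimEdge G₁ G₂) where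
  Adj e f := e ≠ f ∧
    ((e.1 ∈ G₁.edgeSet ∧ f.1 ∈ G₁.edgeSet) ∨ (e.1 ∈ G₂.edgeSet ∧ f.1 ∈ G₂.edgeSet)) ∧
    ∃ v, v ∈ e.1 ∧ v ∈ f.1
  symm := ⟨fun _ _ h =>
    ⟨h.1.symm, h.2.1.imp And.symm And.symm, h.2.2.imp fun _ hv => hv.symm⟩⟩
  loopless := ⟨fun _ h => h.1 rfl⟩

/-! ### List colourings, clusters and the flip dynamics on a finite graph -/

/-- All `L`-colourings, proper or not. -/
abbrev ListColoring {W : Type*} (L : W → Finset ℕ) : Type _ := ∀ w, {c : ℕ // c ∈ L w}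

/-- An `L`-colouring is proper if adjacent vertices get different colours. -/
def IsProperListColoring {W : Type*} (G : SimpleGraph W) {L : W → Finset ℕ}
    (σ : ListColoring L) : Prop :=
  ∀ u w, G.Adj u w → (σ u : ℕ) ≠ σ w

/-- The edges of `G` whose endpoints carry the two different colours `a` and `c`. Paths in this
graph are exactly the `(a, c)`-alternating paths. -/
def alternatingGraph {W : Type*} (G : SimpleGraph W) (σ : W → ℕ) (a c : ℕ) : SimpleGraph W where
  Adj u w := G.Adj u w ∧ a ≠ c ∧ ((σ u = a ∧ σ w = c) ∨ (σ u = c ∧ σ w = a))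
  symm := ⟨fun _ _ h => ⟨h.1.symm, h.2.1, h.2.2.symm.imp And.symm And.symm⟩⟩
  loopless := ⟨fun _ h => G.loopless.irrefl _ h.1⟩

/-- The cluster `S_σ(v, c)`: the vertices reachable from `v` by a `(σ v, c)`-alternating path.
It is `{v}` if `c = σ v`. -/
def cluster {W : Type*} (G : SimpleGraph W) (σ : W → ℕ) (v : W) (c : ℕ) : Set W :=
  {w | (alternatingGraph G σ (σ v) c).Reachable v w}

/-- The cluster `S_σ(v, c)` is flippable if both of its colours are in the list of each of its
vertices. -/
def IsFlippable {W : Type*} (G : SimpleGraph W) (L : W → Finset ℕ) (σ : W → ℕ) (v : W)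
    (c : ℕ) : Prop :=
  ∀ w ∈ cluster G σ v c, σ v ∈ L w ∧ c ∈ L w

open Classical in
/-- Interchange the colours `σ v` and `c` on the cluster `S_σ(v, c)`. -/
noncomputable def flipCluster {W : Type*} (G : SimpleGraph W) (σ : W → ℕ) (v : W) (c : ℕ) :
    W → ℕ :=
  fun w => if w ∈ cluster G σ v c then Equiv.swap (σ v) c (σ w) else σ w

open Classical in
/-- The probability of moving from `σ` to `τ` once the vertex `v` and the colour `c` are chosen:
if `S_σ(v, c)` is flippable and has size `s`, it is flipped with probability `P s / s`; otherwise
nothing happens. -/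
noncomputable def flipMove {W : Type*} (G : SimpleGraph W) (L : W → Finset ℕ) (P : ℕ → ℝ)
    (σ : ListColoring L) (v : W) (c : ℕ) (τ : ListColoring L) : ℝ :=
  let σ' : W → ℕ := fun w => σ w
  let s : ℕ := (cluster G σ' v c).ncard
  if IsFlippable G L σ' v c then
    P s / s * (if (fun w => (τ w : ℕ)) = flipCluster G σ' v c then 1 else 0)
      + (1 - P s / s) * (if τ = σ then 1 else 0)
  else if τ = σ then 1 else 0

/-- The transition matrix of the flip dynamics on all `L`-colourings with flip probabilities `P`:
choose a vertex `v` uniformly at random, then a colour `c ∈ L v` uniformly at random, and perform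
the move for `(v, c)`. When all lists have size `k`, this is a uniformly random pair in
`W × [k]`, an index `i` standing for the `i`-th smallest colour of the list. -/
noncomputable def flipDynamics {W : Type*} [Fintype W] (G : SimpleGraph W) (L : W → Finset ℕ)
    (P : ℕ → ℝ) : Matrix (ListColoring L) (ListColoring L) ℝ :=
  Matrix.of fun σ τ =>
    (Fintype.card W : ℝ)⁻¹ * ∑ v, ((L v).card : ℝ)⁻¹ * ∑ c ∈ L v, flipMove G L P σ v c τ

open Classical in
/-- The uniform distribution on the proper `L`-colourings, as a vector on all `L`-colourings. -/
noncomputable def uniformProper {W : Type*} (G : SimpleGraph W) (L : W → Finset ℕ) :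
    ListColoring L → ℝ :=
  fun σ => if IsProperListColoring G σ then
    (Nat.card {τ : ListColoring L // IsProperListColoring G τ} : ℝ)⁻¹ else 0

/-! ### Flip probabilities -/

/-- An admissible setting of the flip probabilities: `P₁ = 1` and `0 ≤ Pᵢ ≤ 1` for `i ≥ 1`. -/
def IsFlipSetting (P : ℕ → ℝ) : Prop :=
  P 1 = 1 ∧ ∀ i, 1 ≤ i → 0 ≤ P i ∧ P i ≤ 1

/-- The setting is `ℓ`-local if clusters with more than `ℓ` vertices are never flipped. -/
def IsLocalSetting (l : ℕ) (P : ℕ → ℝ) : Prop :=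
  ∀ i, l < i → P i = 0

/-- The flip probabilities used here. (The value at `0` plays no role: clusters are nonempty.) -/
noncomputable def flipProb : ℕ → ℝ
  | 1 => 1
  | 2 => 137 / 650
  | 3 => 77 / 650
  | 4 => 47 / 650
  | 5 => 27 / 650
  | 6 => 12 / 650
  | _ => 0

/-! ### Finite Markov chains -/

/-- Total variation distance on a finite set. -/
noncomputable def tvDist {S : Type*} [Fintype S] (μ ν : S → ℝ) : ℝ :=
  1 / 2 * ∑ x, |μ x - ν x|

/-- `π` is a probability distribution that is stationary for the transition matrix `P`. -/
def IsStationaryDist {S : Type*} [Fintype S] (P : Matrix S S ℝ) (π : S → ℝ) : Prop :=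
  (∀ x, 0 ≤ π x) ∧ ∑ x, π x = 1 ∧ Matrix.vecMul π P = π

/-- The mixing time `max_x min {t : d_TV(P ^ t (x, ·), π) ≤ ε}`; it is `⊤` if from some initial
state the distance never drops to `ε`. -/
noncomputable def mixingTime {S : Type*} [Fintype S] [DecidableEq S] (P : Matrix S S ℝ)
    (π : S → ℝ) (ε : ℝ) : ℕ∞ :=
  ⨆ x : S, ⨅ t : {t : ℕ // tvDist ((P ^ t) x) π ≤ ε}, ((t : ℕ) : ℕ∞)

/-!
The proof is path coupling in its dual form: instead of constructing couplings, one shows that a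
step of the chain contracts the Lipschitz constant of every function on colourings.

*The metric.* The vertices of `simLineGraph G₁ G₂` are weighted by the number (`1` or `2`) of graphs
that contain the edge (`edgeWeight`), and colourings are compared by the weighted Hamming distance
(`weightedDist`). For adjacent `u` and `v`, the smaller of the two weights is at most the number of
graphs containing both, so its sum over the neighbours `u` of `v` is at most `2 Δ` times the weight
of `v` (`sum_min_edgeWeight_le`).

*Reduction to one vertex.* Let `σ` and `τ` differ at the vertex `v` only, let `W` be the weight
of `v`, and let `f` be `1`-Lipschitz. If the changes of `f` along the moves of `σ` are measured
from `f τ + W` instead of `f σ` (`leftCost`), then `m k` times the difference of the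
expectations of `f` is at most `m k W` plus the total cost of all moves, since the rates of the
moves add up to at most `m k` (`NeighborPair.mulVec_sub_le`). The moves are listed by pairs of
colours and components of the alternating graph (`sum_slots_eq`). A component of both `σ` and
`τ` is flipped alike in both and costs nothing. For a colour `c` other than `σ v` and `τ v`, the
cluster of `v` in `σ` is `v` joined to components that are flipped on their own in `τ`, and vice
versa (`components_eq_insert`).

*One colour.* Bounding the costs of pairs of moves by Lipschitz estimates leads, for every colour
`c`, to the bound `κ ∑ min (W, w u) - W` with `κ = 1933 / 650`, the sum being over the neighbours
`u` of `v` of colour `c`, with the term `-W` only if `c` is in the list of `v`. This is a finite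
optimization problem for the sizes of the components (`ColorData.total_le`): with a single
neighbour both clusters of `v` are paired with its two components; with two neighbours each
cluster is paired with the largest component it contains; with more neighbours cruder bounds are
enough. The two colours of `v` itself, which appear next to `v` only in improper colourings, are
treated separately (`NeighborPair.pairTotal_own_add_le`). Summing over all colours, the cost is at
most `(2 κ Δ - k) W`, which is at most `-ε k W` for an absolute `ε > 0`, because
`2 κ = 5.9476… < 5.948`.

*Conclusion.* Hence a step is a contraction by the factor `1 - ε / m`
(`flipDynamics_contraction`). The chain is symmetric on proper colourings, which it cannot leave, so
the uniform distribution on them is stationary (`isStationaryDist_uniformProper`), and the distance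
to it after `t` steps is at most `(1 - ε / m) ^ t * 2 m`.
-/

/-! ### The numerical inequality for one colour -/

/-- The flip probabilities in units of `1 / 650`. -/
def flipNum : ℕ → ℕ
  | 1 => 650
  | 2 => 137
  | 3 => 77
  | 4 => 47
  | 5 => 27
  | 6 => 12
  | _ => 0

lemma flipProb_eq (s : ℕ) : flipProb s = flipNum s / 650 := by
  rcases s with _ | _ | _ | _ | _ | _ | _ | s
  case succ.succ.succ.succ.succ.succ.succ =>
    exact (zero_div (650 : ℝ)).symm.trans (by simp [flipNum])
  all_goals norm_num [flipProb, flipNum]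

lemma flipNum_eq_zero {s : ℕ} (h : 7 ≤ s) : flipNum s = 0 := by
  obtain ⟨t, rfl⟩ := Nat.exists_eq_add_of_le' h
  rfl

lemma flipNum_le (s : ℕ) : flipNum s ≤ 650 := by
  rcases s with _ | _ | _ | _ | _ | _ | _ | s <;> simp [flipNum]

lemma one_le_of_flipNum_pos {s : ℕ} (h : 0 < flipNum s) : 1 ≤ s := by
  rcases s with _ | s
  · simp [flipNum] at h
  · omega

lemma le_six_of_flipNum_pos {s : ℕ} (h : 0 < flipNum s) : s ≤ 6 := by
  by_contra hs
  rw [flipNum_eq_zero (by omega)] at h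
  exact lt_irrefl _ h

lemma flipNum_anti {s t : ℕ} (hs : 1 ≤ s) (h : s ≤ t) : flipNum t ≤ flipNum s := by
  by_cases ht : 7 ≤ t
  · simp [flipNum_eq_zero ht]
  · have : s ≤ 6 := by omega
    have : t ≤ 6 := by omega
    interval_cases s <;> interval_cases t <;> simp_all [flipNum]

/-- The largest possible weight of a set of `s` vertices of weights at most `2` that contains a
vertex of weight `w`; it is `0` for `s = 0`. -/
def maxWeight (s w : ℕ) : ℕ := 2 * s - (2 - w)

/-- The cost of two moves with rates `α` and `β` and costs `A` and `B` when they are performed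
together as often as possible, which saves `w` each time. -/
def pairCost (α β A B w : ℕ) : ℕ := α * A + β * B - min α β * w

lemma le_pairCost {α β A B w : ℕ} {F H : ℝ} (hF : 0 < α → F ≤ A) (hH : 0 < β → H ≤ B)
    (hFH : 0 < α → 0 < β → F + H + w ≤ A + B) : α * F + β * H ≤ (pairCost α β A B w : ℝ) := by
  have key : α * F + β * H ≤ (α : ℝ) * A + β * B - (min α β : ℕ) * w := by
    rcases Nat.eq_zero_or_pos α with rfl | ha
    · rcases Nat.eq_zero_or_pos β with rfl | hb
      · simp
      · have := mul_le_mul_of_nonneg_left (hH hb) (Nat.cast_nonneg (α := ℝ) β)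
        simpa using this
    · rcases Nat.eq_zero_or_pos β with rfl | hb
      · have := mul_le_mul_of_nonneg_left (hF ha) (Nat.cast_nonneg (α := ℝ) α)
        simpa using this
      · have h1 := hF ha
        have h2 := hH hb
        have h3 := hFH ha hb
        rcases le_total α β with h | h
        · have h' : (α : ℝ) ≤ β := by exact_mod_cast h
          rw [min_eq_left h]
          nlinarith [mul_le_mul_of_nonneg_left h3 (Nat.cast_nonneg (α := ℝ) α),
            mul_le_mul_of_nonneg_left h2 (sub_nonneg.2 h')]
        · have h' : (β : ℝ) ≤ α := by exact_mod_cast h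
          rw [min_eq_right h]
          nlinarith [mul_le_mul_of_nonneg_left h3 (Nat.cast_nonneg (α := ℝ) β),
            mul_le_mul_of_nonneg_left h1 (sub_nonneg.2 h')]
  refine key.trans ?_
  have : α * A + β * B ≤ pairCost α β A B w + min α β * w := by
    unfold pairCost; omega
  have : ((α * A + β * B : ℕ) : ℝ) ≤ ((pairCost α β A B w + min α β * w : ℕ) : ℝ) := by
    exact_mod_cast this
  push_cast at this ⊢
  linarith

lemma min_seven_eq {V : Type*} {N : Finset V} {a : V → ℕ} (h : ∑ u ∈ N, min (a u) 7 ≤ 5) :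
    ∀ u ∈ N, min (a u) 7 = a u := by
  intro u hu
  have := (Finset.single_le_sum (f := fun u => min (a u) 7) (fun _ _ => Nat.zero_le _) hu).trans h
  omega

lemma flipNum_mul_le : ∀ s < 6, 2 ≤ s → flipNum (1 + s) * (2 * s) ≤ 308 := by decide

lemma flipNum_mul_le_of_three : ∀ s < 6, 3 ≤ s → flipNum (1 + s) * (2 * s) ≤ 282 := by decide

lemma flipNum_mul_le_of_four : ∀ s < 6, 4 ≤ s → flipNum (1 + s) * (2 * s) ≤ 216 := by decide

/-- In the crude bound, the extra term for a cluster with `s` further vertices. -/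
lemma flipNum_mul_sum_le {V : Type*} {N : Finset V} {a : V → ℕ} {B r : ℕ} {w : V → ℕ}
    (hB : ∀ s < 6, r ≤ s → flipNum (1 + s) * (2 * s) ≤ B)
    (hr : ∑ u ∈ N, a u ≤ 5 → r ≤ ∑ u ∈ N, a u) :
    (flipNum (1 + ∑ u ∈ N, a u) * ∑ u ∈ N, (maxWeight (a u) (w u) : ℝ)) ≤ B := by
  have h1 : ∑ u ∈ N, maxWeight (a u) (w u) ≤ 2 * ∑ u ∈ N, a u := by
    rw [Finset.mul_sum]
    exact Finset.sum_le_sum fun u _ => by unfold maxWeight; omega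
  have h2 : flipNum (1 + ∑ u ∈ N, a u) * ∑ u ∈ N, maxWeight (a u) (w u) ≤ B := by
    rcases le_or_gt (∑ u ∈ N, a u) 5 with hs | hs
    · exact (Nat.mul_le_mul_left _ h1).trans (hB _ (by omega) (hr hs))
    · rw [flipNum_eq_zero (by omega)]; simp
  exact_mod_cast h2

/-- The constraints on the moves of one colour. The two colourings differ at a vertex, `N` is the
set of its neighbours of the given colour, and `w` the weight of a vertex. The components next to
the vertex have sizes `a u` in the first and `b u` in the second colouring, listed by
representatives `u ∈ N` (the size is `0` if `u` does not represent a component). The numbers `F u`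
and `FX` are the costs of the flips of the components and of the cluster of the vertex in the first
colouring, and `H u` and `HY` those in the second one. -/
structure ColorData {V : Type*} [DecidableEq V] (N : Finset V) (w a b : V → ℕ) (F H : V → ℝ)
    (FX HY : ℝ) : Prop where
  a_sum : ∑ u ∈ N, a u ≤ 5 → N.card ≤ ∑ u ∈ N, a u
  b_sum : ∑ u ∈ N, b u ≤ 5 → N.card ≤ ∑ u ∈ N, b u
  F_le : ∀ u ∈ N, 1 ≤ a u → a u ≤ 6 → F u ≤ maxWeight (a u) (w u)
  H_le : ∀ u ∈ N, 1 ≤ b u → b u ≤ 6 → H u ≤ maxWeight (b u) (w u)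
  FH_le : ∀ u ∈ N, 1 ≤ a u → a u ≤ 6 → 1 ≤ b u → b u ≤ 6 →
    F u + H u + w u ≤ maxWeight (a u) (w u) + maxWeight (b u) (w u)
  FX_le : ∑ u ∈ N, b u ≤ 5 → FX ≤ ∑ u ∈ N, (maxWeight (b u) (w u) : ℝ)
  FXH_le : ∑ u ∈ N, b u ≤ 5 → ∀ j ∈ N, 1 ≤ b j →
    FX + H j ≤ ∑ u ∈ N.erase j, (maxWeight (b u) (w u) : ℝ)
  HYF_le : ∑ u ∈ N, a u ≤ 5 → ∀ i ∈ N, 1 ≤ a i →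
    HY + F i ≤ ∑ u ∈ N.erase i, (maxWeight (a u) (w u) : ℝ)

namespace ColorData

variable {V : Type*} [DecidableEq V] {N : Finset V} {w a b : V → ℕ} {F H : V → ℝ} {FX HY : ℝ}

/-- All sizes above `6` may be replaced by `7`, since such components are never flipped. -/
lemma cap (h : ColorData N w a b F H FX HY) :
    ColorData N w (fun u => min (a u) 7) (fun u => min (b u) 7) F H FX HY := by
  constructor
  · intro hs
    have e := Finset.sum_congr rfl (min_seven_eq hs)
    rw [e] at hs ⊢; exact h.a_sum hs
  · intro hs
    have e := Finset.sum_congr rfl (min_seven_eq hs)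
    rw [e] at hs ⊢; exact h.b_sum hs
  · intro u hu h1 h2
    have : min (a u) 7 = a u := by omega
    simp only [this] at h1 h2 ⊢
    exact h.F_le u hu h1 h2
  · intro u hu h1 h2
    have : min (b u) 7 = b u := by omega
    simp only [this] at h1 h2 ⊢
    exact h.H_le u hu h1 h2
  · intro u hu h1 h2 h3 h4
    have e1 : min (a u) 7 = a u := by omega
    have e2 : min (b u) 7 = b u := by omega
    simp only [e1, e2] at h1 h2 h3 h4 ⊢
    exact h.FH_le u hu h1 h2 h3 h4
  · intro hs
    have e := min_seven_eq hs
    rw [Finset.sum_congr rfl e] at hs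
    refine (h.FX_le hs).trans_eq (Finset.sum_congr rfl fun u hu => ?_)
    simp only [e u hu]
  · intro hs j hj h1
    have e := min_seven_eq hs
    rw [Finset.sum_congr rfl e] at hs
    refine (h.FXH_le hs j hj (by omega)).trans_eq (Finset.sum_congr rfl fun u hu => ?_)
    simp only [e u (Finset.mem_of_mem_erase hu)]
  · intro hs j hj h1
    have e := min_seven_eq hs
    rw [Finset.sum_congr rfl e] at hs
    refine (h.HYF_le hs j hj (by omega)).trans_eq (Finset.sum_congr rfl fun u hu => ?_)
    simp only [e u (Finset.mem_of_mem_erase hu)]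

lemma maxWeight_le_two (s w : ℕ) : maxWeight s w ≤ maxWeight s 2 := by
  unfold maxWeight; omega

/-- All weights of neighbours may be replaced by `2`. -/
lemma weight_two (h : ColorData N w a b F H FX HY) (hw : ∀ u, w u = 1 ∨ w u = 2) :
    ColorData N (fun _ => 2) a b F H FX HY := by
  have hm : ∀ s u, (maxWeight s (w u) : ℝ) ≤ maxWeight s 2 := fun s u => by
    exact_mod_cast maxWeight_le_two s (w u)
  refine ⟨h.a_sum, h.b_sum, fun u hu h1 h2 => (h.F_le u hu h1 h2).trans (hm _ _),
    fun u hu h1 h2 => (h.H_le u hu h1 h2).trans (hm _ _), fun u hu h1 h2 h3 h4 => ?_,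
    fun hs => (h.FX_le hs).trans (Finset.sum_le_sum fun _ _ => hm _ _),
    fun hs j hj h1 => (h.FXH_le hs j hj h1).trans (Finset.sum_le_sum fun _ _ => hm _ _),
    fun hs j hj h1 => (h.HYF_le hs j hj h1).trans (Finset.sum_le_sum fun _ _ => hm _ _)⟩
  have := h.FH_le u hu h1 h2 h3 h4
  have e : maxWeight (a u) (w u) + maxWeight (b u) (w u) + 2
      ≤ maxWeight (a u) 2 + maxWeight (b u) 2 + w u := by
    unfold maxWeight
    rcases hw u with e | e <;> omega
  have e' : ((maxWeight (a u) (w u) + maxWeight (b u) (w u) + 2 : ℕ) : ℝ)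
      ≤ ((maxWeight (a u) 2 + maxWeight (b u) 2 + w u : ℕ) : ℝ) := by exact_mod_cast e
  push_cast at e' ⊢
  linarith

/-- The total cost, in units of `1 / 650`, of the moves of the components. -/
def compCost (N : Finset V) (a b : V → ℕ) (F H : V → ℝ) : ℝ :=
  ∑ u ∈ N, ((flipNum (a u) : ℝ) * F u + flipNum (b u) * H u)

lemma term_le_of_le (h : ColorData N w a b F H FX HY) {u : V} (hu : u ∈ N) {α β : ℕ}
    (hα : α ≤ flipNum (a u)) (hβ : β ≤ flipNum (b u)) :
    (α : ℝ) * F u + β * H u ≤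
      (pairCost α β (maxWeight (a u) (w u)) (maxWeight (b u) (w u)) (w u) : ℝ) := by
  refine le_pairCost (fun h0 => ?_) (fun h0 => ?_) (fun h0 h0' => ?_)
  · exact h.F_le u hu (one_le_of_flipNum_pos (h0.trans_le hα))
      (le_six_of_flipNum_pos (h0.trans_le hα))
  · exact h.H_le u hu (one_le_of_flipNum_pos (h0.trans_le hβ))
      (le_six_of_flipNum_pos (h0.trans_le hβ))
  · exact h.FH_le u hu (one_le_of_flipNum_pos (h0.trans_le hα))
      (le_six_of_flipNum_pos (h0.trans_le hα)) (one_le_of_flipNum_pos (h0'.trans_le hβ))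
      (le_six_of_flipNum_pos (h0'.trans_le hβ))

/-- The cost of the two components of a neighbour of weight `w` when they are flipped together
as often as possible. -/
def ownCost (a b w : ℕ) : ℕ :=
  pairCost (flipNum a) (flipNum b) (maxWeight a w) (maxWeight b w) w

lemma ownCost_one_le : ∀ a < 8, ∀ b < 8, ownCost a b 1 ≤ 958 := by decide +kernel

lemma ownCost_two_le : ∀ a < 8, ∀ b < 8, ownCost a b 2 ≤ 1608 := by decide +kernel

lemma compCost_le (h : ColorData N w a b F H FX HY) :
    compCost N a b F H ≤ ∑ u ∈ N, (ownCost (a u) (b u) (w u) : ℝ) :=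
  Finset.sum_le_sum fun _ hu => h.term_le_of_le hu le_rfl le_rfl

lemma pairCost_sub_le {α β A B w y : ℕ} (hy : y ≤ α) (hA : w ≤ A) :
    pairCost (α - y) β A B w ≤ pairCost α β A B w := by
  obtain ⟨x, rfl⟩ := Nat.exists_eq_add_of_le' hy
  unfold pairCost
  simp only [Nat.add_sub_cancel]
  have h1 : min (x + y) β ≤ min x β + y := by omega
  have h2 : min (x + y) β * w ≤ min x β * w + y * w := by nlinarith
  have h3 : y * w ≤ y * A := Nat.mul_le_mul_left _ hA
  have h4 : (x + y) * A = x * A + y * A := by ring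
  omega

lemma le_maxWeight {s w : ℕ} (hs : 1 ≤ s) (hw : w ≤ 2) : w ≤ maxWeight s w := by
  unfold maxWeight; omega

/-- A bound that is good enough unless there are few neighbours: the moves of the two clusters of
the vertex cost at most their weights. The move of the second cluster has to be paired with the
move of some component. -/
lemma total_le_crude (h : ColorData N w a b F H FX HY) (hN : N.Nonempty)
    (hw : ∀ u, w u = 1 ∨ w u = 2) :
    compCost N a b F H + flipNum (1 + ∑ u ∈ N, b u) * FX + flipNum (1 + ∑ u ∈ N, a u) * HY ≤
      ∑ u ∈ N, (ownCost (a u) (b u) (w u) : ℝ)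
      + flipNum (1 + ∑ u ∈ N, b u) * ∑ u ∈ N, (maxWeight (b u) (w u) : ℝ)
      + flipNum (1 + ∑ u ∈ N, a u) * ∑ u ∈ N, (maxWeight (a u) (w u) : ℝ) := by
  have hX : flipNum (1 + ∑ u ∈ N, b u) * FX
      ≤ flipNum (1 + ∑ u ∈ N, b u) * ∑ u ∈ N, (maxWeight (b u) (w u) : ℝ) := by
    rcases le_or_gt (∑ u ∈ N, b u) 5 with hs | hs
    · exact mul_le_mul_of_nonneg_left (h.FX_le hs) (Nat.cast_nonneg _)
    · rw [flipNum_eq_zero (by omega)]; simp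
  have hY : compCost N a b F H + flipNum (1 + ∑ u ∈ N, a u) * HY ≤
      ∑ u ∈ N, (ownCost (a u) (b u) (w u) : ℝ)
      + flipNum (1 + ∑ u ∈ N, a u) * ∑ u ∈ N, (maxWeight (a u) (w u) : ℝ) := by
    rcases le_or_gt (∑ u ∈ N, a u) 5 with hs | hs
    · obtain ⟨i, hi, hai⟩ : ∃ i ∈ N, 1 ≤ a i := by
        by_contra! hcon
        have h0 := h.a_sum hs
        rw [Finset.sum_eq_zero (fun u hu => by have := hcon u hu; omega)] at h0
        exact hN.card_pos.ne' (by omega)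
      have hle : flipNum (1 + ∑ u ∈ N, a u) ≤ flipNum (a i) :=
        flipNum_anti hai ((Finset.single_le_sum (fun _ _ => Nat.zero_le _) hi).trans (by omega))
      set y := flipNum (1 + ∑ u ∈ N, a u)
      have h1 := mul_le_mul_of_nonneg_left (h.HYF_le hs i hi hai) (Nat.cast_nonneg (α := ℝ) y)
      have h2 := h.term_le_of_le hi (Nat.sub_le (flipNum (a i)) y) le_rfl
      have h3 : (pairCost (flipNum (a i) - y) (flipNum (b i)) (maxWeight (a i) (w i))
          (maxWeight (b i) (w i)) (w i) : ℝ) ≤ ownCost (a i) (b i) (w i) := by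
        exact_mod_cast pairCost_sub_le hle
          (le_maxWeight hai (by rcases hw i with e | e <;> omega))
      rw [Nat.cast_sub hle] at h2
      have h4 : ∑ u ∈ N.erase i, ((flipNum (a u) : ℝ) * F u + flipNum (b u) * H u)
          ≤ ∑ u ∈ N.erase i, (ownCost (a u) (b u) (w u) : ℝ) :=
        Finset.sum_le_sum fun u hu =>
          h.term_le_of_le (Finset.mem_of_mem_erase hu) le_rfl le_rfl
      have h5 : (0 : ℝ) ≤ y * maxWeight (a i) (w i) := by positivity
      unfold compCost
      rw [← Finset.add_sum_erase N _ hi,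
        ← Finset.add_sum_erase N (fun u => (ownCost (a u) (b u) (w u) : ℝ)) hi,
        ← Finset.add_sum_erase N (fun u => (maxWeight (a u) (w u) : ℝ)) hi]
      nlinarith
    · rw [flipNum_eq_zero (by omega)]
      simpa using h.compCost_le
  linarith

/-- The sharper bound: the move of the second cluster of the vertex is paired with the move of the
component of `i`, and that of the first cluster with the move of the component of `j`. -/
lemma total_le_paired (h : ColorData N w a b F H FX HY) {i j : V} (hi : i ∈ N) (hj : j ∈ N)
    (hai : ∑ u ∈ N, a u ≤ 5 → 1 ≤ a i) (hbj : ∑ u ∈ N, b u ≤ 5 → 1 ≤ b j) :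
    compCost N a b F H + flipNum (1 + ∑ u ∈ N, b u) * FX + flipNum (1 + ∑ u ∈ N, a u) * HY ≤
      ∑ u ∈ N, (pairCost (flipNum (a u) - if u = i then flipNum (1 + ∑ u ∈ N, a u) else 0)
        (flipNum (b u) - if u = j then flipNum (1 + ∑ u ∈ N, b u) else 0)
        (maxWeight (a u) (w u)) (maxWeight (b u) (w u)) (w u) : ℝ)
      + flipNum (1 + ∑ u ∈ N, b u) * ∑ u ∈ N.erase j, (maxWeight (b u) (w u) : ℝ)
      + flipNum (1 + ∑ u ∈ N, a u) * ∑ u ∈ N.erase i, (maxWeight (a u) (w u) : ℝ) := by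
  have hX : flipNum (1 + ∑ u ∈ N, b u) * (FX + H j)
      ≤ flipNum (1 + ∑ u ∈ N, b u) * ∑ u ∈ N.erase j, (maxWeight (b u) (w u) : ℝ) := by
    rcases le_or_gt (∑ u ∈ N, b u) 5 with hs | hs
    · exact mul_le_mul_of_nonneg_left (h.FXH_le hs j hj (hbj hs)) (Nat.cast_nonneg _)
    · rw [flipNum_eq_zero (by omega)]; simp
  have hY : flipNum (1 + ∑ u ∈ N, a u) * (HY + F i)
      ≤ flipNum (1 + ∑ u ∈ N, a u) * ∑ u ∈ N.erase i, (maxWeight (a u) (w u) : ℝ) := by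
    rcases le_or_gt (∑ u ∈ N, a u) 5 with hs | hs
    · exact mul_le_mul_of_nonneg_left (h.HYF_le hs i hi (hai hs)) (Nat.cast_nonneg _)
    · rw [flipNum_eq_zero (by omega)]; simp
  have hy : flipNum (1 + ∑ u ∈ N, a u) ≤ flipNum (a i) := by
    rcases le_or_gt (∑ u ∈ N, a u) 5 with hs | hs
    · exact flipNum_anti (hai hs)
        ((Finset.single_le_sum (fun _ _ => Nat.zero_le _) hi).trans (by omega))
    · rw [flipNum_eq_zero (by omega)]; simp
  have hx : flipNum (1 + ∑ u ∈ N, b u) ≤ flipNum (b j) := by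
    rcases le_or_gt (∑ u ∈ N, b u) 5 with hs | hs
    · exact flipNum_anti (hbj hs)
        ((Finset.single_le_sum (fun _ _ => Nat.zero_le _) hj).trans (by omega))
    · rw [flipNum_eq_zero (by omega)]; simp
  set x := flipNum (1 + ∑ u ∈ N, b u)
  set y := flipNum (1 + ∑ u ∈ N, a u)
  have h1 : ∑ u ∈ N, (((flipNum (a u) - if u = i then y else 0 : ℕ) : ℝ) * F u
      + ((flipNum (b u) - if u = j then x else 0 : ℕ) : ℝ) * H u) ≤ _ :=
    Finset.sum_le_sum fun u hu => h.term_le_of_le hu (Nat.sub_le _ _) (Nat.sub_le _ _)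
  have h2 : ∑ u ∈ N, (((flipNum (a u) - if u = i then y else 0 : ℕ) : ℝ) * F u
      + ((flipNum (b u) - if u = j then x else 0 : ℕ) : ℝ) * H u)
      = compCost N a b F H - y * F i - x * H j := by
    have e : ∀ u ∈ N, (((flipNum (a u) - if u = i then y else 0 : ℕ) : ℝ) * F u
        + ((flipNum (b u) - if u = j then x else 0 : ℕ) : ℝ) * H u)
        = (((flipNum (a u) : ℝ) * F u + flipNum (b u) * H u) - (if u = i then y * F u else 0))
          - (if u = j then x * H u else 0) := by
      intro u _
      have e1 : ((flipNum (a u) - if u = i then y else 0 : ℕ) : ℝ)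
          = flipNum (a u) - if u = i then (y : ℝ) else 0 := by
        split_ifs with hu
        · subst hu; exact Nat.cast_sub hy
        · simp
      have e2 : ((flipNum (b u) - if u = j then x else 0 : ℕ) : ℝ)
          = flipNum (b u) - if u = j then (x : ℝ) else 0 := by
        split_ifs with hu
        · subst hu; exact Nat.cast_sub hx
        · simp
      rw [e1, e2]
      split_ifs <;> ring
    rw [Finset.sum_congr rfl e, Finset.sum_sub_distrib, Finset.sum_sub_distrib,
      Finset.sum_ite_eq' N i, Finset.sum_ite_eq' N j, if_pos hi, if_pos hj]
    rfl
  rw [h2] at h1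
  linarith

/-- The cost for a single neighbour of weight `w` with components of sizes `a` and `b`. -/
def singleCost (a b w : ℕ) : ℕ :=
  pairCost (flipNum a - flipNum (1 + a)) (flipNum b - flipNum (1 + b)) (maxWeight a w)
    (maxWeight b w) w

lemma singleCost_one_le : ∀ a < 8, ∀ b < 8, singleCost a b 1 ≤ 633 := by decide +kernel

lemma singleCost_two_le : ∀ a < 8, ∀ b < 8, singleCost a b 2 ≤ 1146 := by decide +kernel

/-- The cost for two neighbours of weight `2` with components of sizes `a₀, b₀` and `a₁, b₁` when
the clusters of the vertex are paired with the components of sizes `a₀` and `b₀`. -/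
def doubleCost (a₀ a₁ b₀ b₁ : ℕ) : ℕ :=
  pairCost (flipNum a₀ - flipNum (1 + (a₀ + a₁))) (flipNum b₀ - flipNum (1 + (b₀ + b₁)))
    (maxWeight a₀ 2) (maxWeight b₀ 2) 2
  + pairCost (flipNum a₁) (flipNum b₁) (maxWeight a₁ 2) (maxWeight b₁ 2) 2
  + flipNum (1 + (b₀ + b₁)) * maxWeight b₁ 2 + flipNum (1 + (a₀ + a₁)) * maxWeight a₁ 2

/-- The bound `3216 = 2 * 1933 - 650` is attained for sizes `1, 1` and `3, 3`. -/
lemma doubleCost_le : ∀ a₀ < 8, ∀ a₁ < a₀ + 1, ∀ b₀ < 8, ∀ b₁ < b₀ + 1,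
    doubleCost a₀ a₁ b₀ b₁ ≤ 3216 := by decide +kernel

/-- The cost for two neighbours of weight `2` with components of sizes `a₀, b₀` and `a₁, b₁` when
the clusters of the vertex are paired with the components of sizes `a₀` and `b₁`. -/
def crossCost (a₀ a₁ b₀ b₁ : ℕ) : ℕ :=
  pairCost (flipNum a₀ - flipNum (1 + (a₀ + a₁))) (flipNum b₀) (maxWeight a₀ 2)
    (maxWeight b₀ 2) 2
  + pairCost (flipNum a₁) (flipNum b₁ - flipNum (1 + (b₀ + b₁))) (maxWeight a₁ 2)
    (maxWeight b₁ 2) 2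
  + flipNum (1 + (b₀ + b₁)) * maxWeight b₀ 2 + flipNum (1 + (a₀ + a₁)) * maxWeight a₁ 2

lemma crossCost_le : ∀ a₀ < 8, ∀ a₁ < a₀ + 1, ∀ b₁ < 8, ∀ b₀ < b₁ + 1,
    crossCost a₀ a₁ b₀ b₁ ≤ 3216 := by decide +kernel

set_option synthInstance.maxSize 2000 in
set_option synthInstance.maxHeartbeats 200000 in
/-- Three neighbours of weight `2`, all clusters being small. -/
lemma triple_le : ∀ a₀ < 6, ∀ a₁ < 6 - a₀, ∀ a₂ < 6 - a₀ - a₁, 3 ≤ a₀ + a₁ + a₂ →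
    ∀ b₀ < 6, ∀ b₁ < 6 - b₀, ∀ b₂ < 6 - b₀ - b₁, 3 ≤ b₀ + b₁ + b₂ →
    ownCost a₀ b₀ 2 + ownCost a₁ b₁ 2 + ownCost a₂ b₂ 2
      + flipNum (1 + (a₀ + a₁ + a₂)) * (2 * (a₀ + a₁ + a₂))
      + flipNum (1 + (b₀ + b₁ + b₂)) * (2 * (b₀ + b₁ + b₂)) ≤ 5149 := by decide +kernel

lemma total_le_one (h : ColorData N w a b F H FX HY) (ha : ∀ u, a u < 8) (hb : ∀ u, b u < 8)
    (hw : ∀ u, w u = 1 ∨ w u = 2) (hN : N.card = 1) {W : ℕ} (hW : W = 1 ∨ W = 2) :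
    compCost N a b F H + flipNum (1 + ∑ u ∈ N, b u) * FX + flipNum (1 + ∑ u ∈ N, a u) * HY
      + 650 * W ≤ 1933 * ∑ u ∈ N, (min W (w u) : ℕ) := by
  obtain ⟨u, rfl⟩ := Finset.card_eq_one.1 hN
  have h1 := h.total_le_paired (Finset.mem_singleton_self u) (Finset.mem_singleton_self u)
    (by simpa using h.a_sum) (by simpa using h.b_sum)
  simp only [Finset.sum_singleton, if_true, Finset.erase_singleton, Finset.sum_empty, mul_zero,
    add_zero] at h1 ⊢
  change _ ≤ (singleCost (a u) (b u) (w u) : ℝ) at h1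
  have h2 : singleCost (a u) (b u) (w u) + 650 * W ≤ 1933 * min W (w u) := by
    have e1 := singleCost_one_le _ (ha u) _ (hb u)
    have e2 := singleCost_two_le _ (ha u) _ (hb u)
    rcases hw u with e | e <;> rcases hW with e' | e' <;> rw [e, e'] <;> norm_num <;> omega
  have h3 : ((singleCost (a u) (b u) (w u) + 650 * W : ℕ) : ℝ) ≤ (1933 * min W (w u) : ℕ) := by
    exact_mod_cast h2
  push_cast at h3 ⊢
  linarith

lemma total_le_two (h : ColorData N (fun _ => 2) a b F H FX HY) (ha : ∀ u, a u < 8)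
    (hb : ∀ u, b u < 8) (hN : N.card = 2) :
    compCost N a b F H + flipNum (1 + ∑ u ∈ N, b u) * FX + flipNum (1 + ∑ u ∈ N, a u) * HY
      ≤ 3216 := by
  obtain ⟨u, v, huv, rfl, hle⟩ : ∃ u v, u ≠ v ∧ N = {u, v} ∧ a v ≤ a u := by
    obtain ⟨u, v, huv, rfl⟩ := Finset.card_eq_two.1 hN
    rcases le_total (a v) (a u) with hle | hle
    · exact ⟨u, v, huv, rfl, hle⟩
    · exact ⟨v, u, huv.symm, Finset.pair_comm _ _, hle⟩
  have hsa := h.a_sum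
  have hsb := h.b_sum
  have eu : ({u, v} : Finset V).erase u = {v} := by
    rw [Finset.erase_insert]; simpa using huv
  have ev : ({u, v} : Finset V).erase v = {u} := by
    rw [Finset.pair_comm, Finset.erase_insert]; simpa using huv.symm
  rw [hN, Finset.sum_pair huv] at hsa hsb
  rcases le_total (b v) (b u) with hle' | hle'
  · have h1 := h.total_le_paired (i := u) (j := u) (by simp) (by simp)
      (by rw [Finset.sum_pair huv]; omega) (by rw [Finset.sum_pair huv]; omega)
    simp only [Finset.sum_pair huv, if_true, eu, huv.symm, if_false, Nat.sub_zero,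
      Finset.sum_singleton] at h1 ⊢
    have h2 : (doubleCost (a u) (a v) (b u) (b v) : ℝ) ≤ 3216 := by
      exact_mod_cast doubleCost_le _ (ha u) _ (by omega) _ (hb u) _ (by omega)
    unfold doubleCost at h2
    push_cast at h2
    linarith
  · have h1 := h.total_le_paired (i := u) (j := v) (by simp) (by simp)
      (by rw [Finset.sum_pair huv]; omega) (by rw [Finset.sum_pair huv]; omega)
    simp only [Finset.sum_pair huv, if_true, eu, ev, huv.symm, huv, if_false, Nat.sub_zero,
      Finset.sum_singleton] at h1 ⊢
    have h2 : (crossCost (a u) (a v) (b u) (b v) : ℝ) ≤ 3216 := by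
      exact_mod_cast crossCost_le _ (ha u) _ (by omega) _ (hb v) _ (by omega)
    unfold crossCost at h2
    push_cast at h2
    linarith

lemma total_le_three (h : ColorData N (fun _ => 2) a b F H FX HY) (ha : ∀ u, a u < 8)
    (hb : ∀ u, b u < 8) (hN : N.card = 3) :
    compCost N a b F H + flipNum (1 + ∑ u ∈ N, b u) * FX + flipNum (1 + ∑ u ∈ N, a u) * HY
      ≤ 5149 := by
  refine (h.total_le_crude (Finset.card_pos.1 (by omega)) (fun _ => Or.inr rfl)).trans ?_
  have hXa := flipNum_mul_sum_le (N := N) (a := a) (w := fun _ => 2)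
    flipNum_mul_le_of_three (by have := h.a_sum; omega)
  have hXb := flipNum_mul_sum_le (N := N) (a := b) (w := fun _ => 2)
    flipNum_mul_le_of_three (by have := h.b_sum; omega)
  have hq : ∑ u ∈ N, (ownCost (a u) (b u) 2 : ℝ) ≤ 4824 := by
    have : ∑ u ∈ N, ownCost (a u) (b u) 2 ≤ N.card • 1608 :=
      Finset.sum_le_card_nsmul _ _ _ fun u _ => ownCost_two_le _ (ha u) _ (hb u)
    rw [hN] at this
    exact_mod_cast this
  rcases le_or_gt (∑ u ∈ N, a u) 5 with hsa | hsa
  · rcases le_or_gt (∑ u ∈ N, b u) 5 with hsb | hsb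
    · have h1 := h.a_sum hsa
      have h2 := h.b_sum hsb
      obtain ⟨x, y, z, hxy, hxz, hyz, rfl⟩ := Finset.card_eq_three.1 hN
      have es : ∀ g : V → ℕ, ∑ u ∈ ({x, y, z} : Finset V), g u = g x + g y + g z := fun g => by
        rw [Finset.sum_insert (by simp [hxy, hxz]), Finset.sum_pair hyz, add_assoc]
      rw [hN] at h1 h2
      have key := triple_le (a x) (by rw [es] at hsa; omega) (a y) (by rw [es] at hsa; omega)
        (a z) (by rw [es] at hsa; omega) (by rw [es] at h1; omega)
        (b x) (by rw [es] at hsb; omega) (b y) (by rw [es] at hsb; omega)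
        (b z) (by rw [es] at hsb; omega) (by rw [es] at h2; omega)
      have hm : ∀ s, maxWeight s 2 = 2 * s := fun s => by simp [maxWeight]
      simp only [hm]
      rw [← es a, ← es b, ← es fun u => ownCost (a u) (b u) 2] at key
      have key' : _ ≤ ((5149 : ℕ) : ℝ) := Nat.cast_le.2 key
      push_cast [← Finset.mul_sum] at key' ⊢
      linarith
    · rw [flipNum_eq_zero (s := 1 + ∑ u ∈ N, b u) (by omega)]
      push_cast at hXa ⊢
      linarith
  · rw [flipNum_eq_zero (s := 1 + ∑ u ∈ N, a u) (by omega)]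
    push_cast at hXb ⊢
    linarith

/-- The moves of one colour that occurs next to the vertex (of weight `W`) cost at most
`1933 / 650` per neighbour of the colour, in terms of the smaller of the two weights, minus `W`. -/
theorem total_le (h : ColorData N w a b F H FX HY) (hw : ∀ u, w u = 1 ∨ w u = 2)
    (hN : N.Nonempty) {W : ℕ} (hW : W = 1 ∨ W = 2) :
    compCost N a b F H + flipNum (1 + ∑ u ∈ N, b u) * FX + flipNum (1 + ∑ u ∈ N, a u) * HY
      + 650 * W ≤ 1933 * ∑ u ∈ N, (min W (w u) : ℕ) := by
  wlog hcap : (∀ u, a u < 8) ∧ ∀ u, b u < 8 generalizing a b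
  · have h1 := this h.cap ⟨fun u => by omega, fun u => by omega⟩
    have ec : ∀ s, flipNum (min s 7) = flipNum s := fun s => by
      rcases le_total s 7 with hs | hs
      · rw [min_eq_left hs]
      · rw [min_eq_right hs, flipNum_eq_zero hs, flipNum_eq_zero le_rfl]
    have es : ∀ g : V → ℕ, flipNum (1 + ∑ u ∈ N, min (g u) 7) = flipNum (1 + ∑ u ∈ N, g u) := by
      intro g
      rcases le_or_gt (∑ u ∈ N, min (g u) 7) 5 with hs | hs
      · rw [Finset.sum_congr rfl (min_seven_eq hs)]
      · have hle : ∑ u ∈ N, min (g u) 7 ≤ ∑ u ∈ N, g u :=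
          Finset.sum_le_sum fun _ _ => min_le_left _ _
        rw [flipNum_eq_zero (by omega), flipNum_eq_zero (by omega)]
    simpa only [compCost, ec, es] using h1
  obtain ⟨ha, hb⟩ := hcap
  obtain hN1 | hN1 : N.card = 1 ∨ 2 ≤ N.card := by have := hN.card_pos; omega
  · exact h.total_le_one ha hb hw hN1 hW
  rcases hW with rfl | rfl
  · have h' := h.weight_two hw
    have em : ∑ u ∈ N, (min 1 (w u) : ℕ) = N.card := by
      rw [Finset.card_eq_sum_ones]
      exact Finset.sum_congr rfl fun u _ => by rcases hw u with e | e <;> simp [e]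
    rw [em]
    obtain hN2 | hN2 | hN2 : N.card = 2 ∨ N.card = 3 ∨ 4 ≤ N.card := by omega
    · have := h'.total_le_two ha hb hN2
      rw [hN2]; push_cast; linarith
    · have := h'.total_le_three ha hb hN2
      rw [hN2]; push_cast; linarith
    · have h1 := h'.total_le_crude hN (fun _ => Or.inr rfl)
      have hXa := flipNum_mul_sum_le (N := N) (a := a) (w := fun _ => 2)
        flipNum_mul_le_of_four (by have := h.a_sum; omega)
      have hXb := flipNum_mul_sum_le (N := N) (a := b) (w := fun _ => 2)
        flipNum_mul_le_of_four (by have := h.b_sum; omega)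
      have hq : ∑ u ∈ N, (ownCost (a u) (b u) 2 : ℝ) ≤ N.card * 1608 := by
        have : ∑ u ∈ N, ownCost (a u) (b u) 2 ≤ N.card • 1608 :=
          Finset.sum_le_card_nsmul _ _ _ fun u _ => ownCost_two_le _ (ha u) _ (hb u)
        rw [smul_eq_mul] at this
        exact_mod_cast this
      have h4 : (4 : ℝ) ≤ N.card := by exact_mod_cast hN2
      push_cast at hXa hXb ⊢
      linarith
  · have h1 := h.total_le_crude hN hw
    have hXa := flipNum_mul_sum_le (N := N) (a := a) (w := w)
      flipNum_mul_le (by have := h.a_sum; omega)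
    have hXb := flipNum_mul_sum_le (N := N) (a := b) (w := w)
      flipNum_mul_le (by have := h.b_sum; omega)
    have hq : ∑ u ∈ N, ownCost (a u) (b u) (w u) + N.card • 975 ≤
        ∑ u ∈ N, 1933 * min 2 (w u) := by
      rw [← Finset.sum_const, ← Finset.sum_add_distrib]
      refine Finset.sum_le_sum fun u _ => ?_
      have e1 := ownCost_one_le _ (ha u) _ (hb u)
      have e2 := ownCost_two_le _ (ha u) _ (hb u)
      rcases hw u with e | e <;> rw [e] <;> norm_num <;> omega
    rw [smul_eq_mul, ← Finset.mul_sum] at hq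
    have hq' : ∑ u ∈ N, (ownCost (a u) (b u) (w u) : ℝ) + N.card * 975 ≤
        1933 * (∑ u ∈ N, min 2 (w u) : ℕ) := by exact_mod_cast hq
    have h2 : (2 : ℝ) ≤ N.card := by exact_mod_cast hN1
    push_cast at hXa hXb hq' ⊢
    linarith

/-- The bound without the moves of the clusters of the vertex, for a colour that is not in the
list of the vertex. -/
theorem compCost_le_budget (h : ColorData N w a b F H FX HY) (hw : ∀ u, w u = 1 ∨ w u = 2)
    {W : ℕ} (hW : W = 1 ∨ W = 2) :
    compCost N a b F H ≤ 1933 * ∑ u ∈ N, (min W (w u) : ℕ) := by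
  have ec : ∀ s, flipNum (min s 7) = flipNum s := fun s => by
    rcases le_total s 7 with hs | hs
    · rw [min_eq_left hs]
    · rw [min_eq_right hs, flipNum_eq_zero hs, flipNum_eq_zero le_rfl]
  have h1 : compCost N a b F H
      ≤ ∑ u ∈ N, (ownCost (min (a u) 7) (min (b u) 7) (w u) : ℝ) := by
    simpa only [compCost, ec] using h.cap.compCost_le
  refine h1.trans ?_
  have : ∑ u ∈ N, ownCost (min (a u) 7) (min (b u) 7) (w u) ≤ 1933 * ∑ u ∈ N, min W (w u) := by
    rw [Finset.mul_sum]
    refine Finset.sum_le_sum fun u _ => ?_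
    have e1 := ownCost_one_le (min (a u) 7) (by omega) (min (b u) 7) (by omega)
    have e2 := ownCost_two_le (min (a u) 7) (by omega) (min (b u) 7) (by omega)
    rcases hw u with e | e <;> rcases hW with e' | e' <;> rw [e, e'] <;> norm_num <;> omega
  exact_mod_cast this

end ColorData

/-! ### Components of the alternating graphs -/

/-- The edges of `G` whose endpoints carry the two different colours of the pair `e`. -/
def altPairGraph {V : Type*} (G : SimpleGraph V) (σ : V → ℕ) (e : Sym2 ℕ) : SimpleGraph V where
  Adj u w := G.Adj u w ∧ σ u ≠ σ w ∧ s(σ u, σ w) = e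
  symm := ⟨fun _ _ h => ⟨h.1.symm, h.2.1.symm, by rw [Sym2.eq_swap]; exact h.2.2⟩⟩
  loopless := ⟨fun _ h => h.2.1 rfl⟩

lemma alternatingGraph_eq_altPairGraph {V : Type*} (G : SimpleGraph V) (σ : V → ℕ) (a c : ℕ) :
    alternatingGraph G σ a c = altPairGraph G σ s(a, c) := by
  ext u w
  simp only [alternatingGraph, altPairGraph, Sym2.eq_iff]
  constructor
  · rintro ⟨h, hac, ⟨rfl, rfl⟩ | ⟨rfl, rfl⟩⟩
    · exact ⟨h, hac, Or.inl ⟨rfl, rfl⟩⟩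
    · exact ⟨h, hac.symm, Or.inr ⟨rfl, rfl⟩⟩
  · rintro ⟨h, hne, ⟨rfl, rfl⟩ | ⟨rfl, rfl⟩⟩
    · exact ⟨h, hne, Or.inl ⟨rfl, rfl⟩⟩
    · exact ⟨h, hne.symm, Or.inr ⟨rfl, rfl⟩⟩

lemma altPairGraph_deleteIncidenceSet_congr {V : Type*} {G : SimpleGraph V} {σ τ : V → ℕ}
    {e : Sym2 ℕ} {v : V} (h : ∀ w, w ≠ v → σ w = τ w) :
    altPairGraph (G.deleteIncidenceSet v) σ e = altPairGraph (G.deleteIncidenceSet v) τ e := by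
  ext x y
  simp only [altPairGraph, SimpleGraph.deleteIncidenceSet_adj]
  constructor
  · rintro ⟨⟨h1, hx, hy⟩, h2⟩
    rw [h x hx, h y hy] at h2
    exact ⟨⟨h1, hx, hy⟩, h2⟩
  · rintro ⟨⟨h1, hx, hy⟩, h2⟩
    rw [← h x hx, ← h y hy] at h2
    exact ⟨⟨h1, hx, hy⟩, h2⟩

lemma altPairGraph_mono {V : Type*} {G : SimpleGraph V} {σ : V → ℕ} {e : Sym2 ℕ} (v : V) :
    altPairGraph (G.deleteIncidenceSet v) σ e ≤ altPairGraph G σ e :=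
  fun _ _ h => ⟨(SimpleGraph.deleteIncidenceSet_adj.1 h.1).1, h.2⟩

lemma altPairGraph_adj_color {V : Type*} {G : SimpleGraph V} {σ : V → ℕ} {v : V} {a c : ℕ}
    (hv : σ v = a) (hac : a ≠ c) (u : V) :
    (altPairGraph G σ s(a, c)).Adj v u ↔ G.Adj v u ∧ σ u = c := by
  subst hv
  simp only [altPairGraph, Sym2.eq_iff, true_and]
  constructor
  · rintro ⟨h1, h2, h | h⟩
    · exact ⟨h1, h⟩
    · exact absurd h.2.symm h2
  · rintro ⟨h1, rfl⟩
    exact ⟨h1, hac, Or.inl rfl⟩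

open Classical in
/-- The neighbours of `v` of colour `c`. -/
noncomputable def colorNbrs {V : Type*} [Fintype V] (G : SimpleGraph V) (σ : V → ℕ)
    (v : V) (c : ℕ) : Finset V :=
  {u | G.Adj v u ∧ σ u = c}

lemma mem_colorNbrs {V : Type*} [Fintype V] {G : SimpleGraph V} {σ : V → ℕ} {v u : V}
    {c : ℕ} : u ∈ colorNbrs G σ v c ↔ G.Adj v u ∧ σ u = c := by
  simp [colorNbrs]

lemma colorNbrs_congr {V : Type*} [Fintype V] {G : SimpleGraph V} {σ τ : V → ℕ} {v : V} {c : ℕ}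
    (h : ∀ w, w ≠ v → σ w = τ w) :
    colorNbrs G σ v c = colorNbrs G τ v c := by
  ext u
  simp only [mem_colorNbrs]
  exact and_congr_right fun hu => by rw [h u hu.ne']

section Components

variable {V : Type*} [Fintype V] [DecidableEq V]

open Classical in
/-- The component of `w` in the alternating graph of the pair `e`. -/
noncomputable def component (G : SimpleGraph V) (σ : V → ℕ) (e : Sym2 ℕ) (w : V) : Finset V :=
  {u | (altPairGraph G σ e).Reachable w u}

open Classical in
/-- The components of the alternating graph of the pair `e` that carry colours of `e`. -/
noncomputable def components (G : SimpleGraph V) (σ : V → ℕ) (e : Sym2 ℕ) : Finset (Finset V) :=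
  Finset.image (component G σ e) {w | σ w ∈ e}

open Classical in
/-- The components, with colours of `e`, of the alternating graph after the vertex `v` has been
removed. -/
noncomputable def restComponents (G : SimpleGraph V) (σ : V → ℕ) (v : V) (e : Sym2 ℕ) :
    Finset (Finset V) :=
  Finset.image (component (G.deleteIncidenceSet v) σ e) {w | w ≠ v ∧ σ w ∈ e}

/-- The components, after the removal of `v`, that contain a neighbour of `v` of colour `c`. -/
noncomputable def touching (G : SimpleGraph V) (σ : V → ℕ) (v : V) (e : Sym2 ℕ) (c : ℕ) :
    Finset (Finset V) :=
  {K ∈ restComponents G σ v e | (K ∩ colorNbrs G σ v c).Nonempty}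

variable {G : SimpleGraph V} {σ τ : V → ℕ} {e : Sym2 ℕ} {u v w : V} {a c : ℕ} {K K' : Finset V}

lemma mem_component : u ∈ component G σ e w ↔ (altPairGraph G σ e).Reachable w u := by
  simp [component]

lemma self_mem_component : w ∈ component G σ e w := mem_component.2 (SimpleGraph.Reachable.refl _)

lemma component_eq_of_mem (h : u ∈ component G σ e w) :
    component G σ e u = component G σ e w := by
  rw [mem_component] at h
  ext z
  rw [mem_component, mem_component]
  exact ⟨h.trans, h.symm.trans⟩

lemma component_subset_of_closed {S : Finset V} (hw : w ∈ S)
    (hS : ∀ x ∈ S, ∀ y, (altPairGraph G σ e).Adj x y → y ∈ S) : component G σ e w ⊆ S := by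
  intro u hu
  obtain ⟨p⟩ := mem_component.1 hu
  clear hu
  induction p with
  | nil => exact hw
  | cons h _ ih => exact ih (hS _ hw _ h)

lemma color_mem_of_mem_component (hw : σ w ∈ e) (hu : u ∈ component G σ e w) : σ u ∈ e := by
  have := component_subset_of_closed (G := G) (σ := σ) (e := e)
    (S := {x : V | σ x ∈ e}.toFinset) (by simpa using hw) (fun x _ y h => by
      have : σ y ∈ s(σ x, σ y) := Sym2.mem_mk_right _ _
      rw [h.2.2] at this
      simpa using this) hu
  simpa using this

lemma mem_components : K ∈ components G σ e ↔ ∃ w, σ w ∈ e ∧ component G σ e w = K := by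
  simp [components]

lemma mem_restComponents : K ∈ restComponents G σ v e ↔
    ∃ w, (w ≠ v ∧ σ w ∈ e) ∧ component (G.deleteIncidenceSet v) σ e w = K := by
  simp [restComponents]

lemma notMem_of_mem_restComponents (h : K ∈ restComponents G σ v e) : v ∉ K := by
  obtain ⟨w, ⟨hw, -⟩, rfl⟩ := mem_restComponents.1 h
  have := component_subset_of_closed (G := G.deleteIncidenceSet v) (σ := σ) (e := e) (w := w)
    (S := Finset.univ.erase v) (by simpa using hw) (fun x _ y h => by
      simpa using (SimpleGraph.deleteIncidenceSet_adj.1 h.1).2.2)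
  exact fun hv => by simpa using this hv

lemma eq_of_mem_restComponents (h : K ∈ restComponents G σ v e)
    (h' : K' ∈ restComponents G σ v e) (hu : u ∈ K) (hu' : u ∈ K') : K = K' := by
  obtain ⟨w, -, rfl⟩ := mem_restComponents.1 h
  obtain ⟨w', -, rfl⟩ := mem_restComponents.1 h'
  rw [← component_eq_of_mem hu, ← component_eq_of_mem hu']

lemma exists_mem_restComponents (hu : u ≠ v) (hc : σ u ∈ e) :
    ∃ K ∈ restComponents G σ v e, u ∈ K :=
  ⟨_, mem_restComponents.2 ⟨u, ⟨hu, hc⟩, rfl⟩, self_mem_component⟩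

lemma restComponents_congr (h : ∀ w, w ≠ v → σ w = τ w) :
    restComponents G σ v e = restComponents G τ v e := by
  unfold restComponents component
  rw [altPairGraph_deleteIncidenceSet_congr h]
  congr 1
  ext w
  simp only [Finset.mem_filter, Finset.mem_univ, true_and]
  exact and_congr_right fun hw => by rw [h w hw]

lemma touching_congr (h : ∀ w, w ≠ v → σ w = τ w) :
    touching G σ v e c = touching G τ v e c := by
  unfold touching
  rw [restComponents_congr h, colorNbrs_congr h]

/-- If the colour of `v` is not in the pair, the removal of `v` changes nothing. -/
lemma components_eq_restComponents (h : σ v ∉ e) :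
    components G σ e = restComponents G σ v e := by
  have hG : altPairGraph G σ e = altPairGraph (G.deleteIncidenceSet v) σ e := by
    ext x y
    simp only [altPairGraph, SimpleGraph.deleteIncidenceSet_adj]
    refine ⟨fun ⟨h1, h2, h3⟩ => ⟨⟨h1, ?_, ?_⟩, h2, h3⟩, fun ⟨⟨h1, _⟩, h2⟩ => ⟨h1, h2⟩⟩
    · rintro rfl
      exact h (h3 ▸ Sym2.mem_mk_left _ _)
    · rintro rfl
      exact h (h3 ▸ Sym2.mem_mk_right _ _)
  unfold components restComponents component
  rw [hG]
  congr 1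
  ext w
  simp only [Finset.mem_filter, Finset.mem_univ, true_and]
  exact ⟨fun hw => ⟨fun e => h (e ▸ hw), hw⟩, fun hw => hw.2⟩

/-- The union of the components that contain a neighbour of `v` of colour `c`: for the pair
`e = {σ v, c}` of two colours this is the cluster of `v` without `v` itself. -/
noncomputable def joined (G : SimpleGraph V) (σ : V → ℕ) (v : V) (e : Sym2 ℕ) (c : ℕ) :
    Finset V :=
  (touching G σ v e c).biUnion id

lemma mem_touching : K ∈ touching G σ v e c ↔
    K ∈ restComponents G σ v e ∧ ∃ u ∈ K, G.Adj v u ∧ σ u = c := by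
  unfold touching
  rw [Finset.mem_filter]
  simp [Finset.Nonempty, mem_colorNbrs]

lemma mem_joined : u ∈ joined G σ v e c ↔ ∃ K ∈ touching G σ v e c, u ∈ K := by
  simp [joined]

lemma notMem_joined : v ∉ joined G σ v e c := by
  intro h
  obtain ⟨K, hK, hv⟩ := mem_joined.1 h
  exact notMem_of_mem_restComponents (mem_touching.1 hK).1 hv

/-- The component of `v`. -/
lemma component_self (hv : σ v = a) (hac : a ≠ c) :
    component G σ s(a, c) v = insert v (joined G σ v s(a, c) c) := by
  apply Finset.Subset.antisymm
  · refine component_subset_of_closed (Finset.mem_insert_self _ _) fun x hx y hxy => ?_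
    by_cases hyv : y = v
    · exact hyv ▸ Finset.mem_insert_self _ _
    refine Finset.mem_insert_of_mem (mem_joined.2 ?_)
    rcases Finset.mem_insert.1 hx with rfl | hx
    · have h := (altPairGraph_adj_color hv hac y).1 hxy
      obtain ⟨K, hK, hyK⟩ := exists_mem_restComponents (G := G) (e := s(a, c)) hyv
        (σ := σ)
        (by rw [h.2]; exact Sym2.mem_mk_right _ _)
      exact ⟨K, mem_touching.2 ⟨hK, y, hyK, h⟩, hyK⟩
    · obtain ⟨K, hK, hxK⟩ := mem_joined.1 hx
      refine ⟨K, hK, ?_⟩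
      have hxv : x ≠ v := fun e => notMem_joined (e ▸ hx)
      obtain ⟨w, -, rfl⟩ := mem_restComponents.1 (mem_touching.1 hK).1
      exact mem_component.2 ((mem_component.1 hxK).trans (SimpleGraph.Adj.reachable
        ⟨SimpleGraph.deleteIncidenceSet_adj.2 ⟨hxy.1, hxv, hyv⟩, hxy.2⟩))
  · refine Finset.insert_subset self_mem_component fun x hx => ?_
    obtain ⟨K, hK, hxK⟩ := mem_joined.1 hx
    obtain ⟨hK, u, huK, hu⟩ := mem_touching.1 hK
    obtain ⟨w, -, rfl⟩ := mem_restComponents.1 hK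
    have h1 := ((mem_component.1 huK).symm.trans (mem_component.1 hxK)).mono (altPairGraph_mono v)
    exact mem_component.2 (((altPairGraph_adj_color hv hac u).2 hu).reachable.trans h1)

/-- If the colour of `v` is in the pair, `v` joins the components that contain one of its
neighbours of the other colour, and the other components remain. -/
lemma components_eq_insert (hv : σ v = a) (hac : a ≠ c) :
    components G σ s(a, c) = insert (insert v (joined G σ v s(a, c) c))
      (restComponents G σ v s(a, c) \ touching G σ v s(a, c) c) := by
  have hrest : ∀ w, w ≠ v → σ w ∈ s(a, c) →
      (component (G.deleteIncidenceSet v) σ s(a, c) w ∉ touching G σ v s(a, c) c →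
        component G σ s(a, c) w = component (G.deleteIncidenceSet v) σ s(a, c) w) ∧
      (component (G.deleteIncidenceSet v) σ s(a, c) w ∈ touching G σ v s(a, c) c →
        component G σ s(a, c) w = insert v (joined G σ v s(a, c) c)) := by
    intro w hwv hwc
    have hKr := mem_restComponents (G := G).2 ⟨w, ⟨hwv, hwc⟩, rfl⟩
    refine ⟨fun hK => ?_, fun hK => ?_⟩
    · refine Finset.Subset.antisymm ?_ fun x hx =>
        mem_component.2 ((mem_component.1 hx).mono (altPairGraph_mono v))
      refine component_subset_of_closed self_mem_component fun x hx y hxy => ?_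
      have hxv : x ≠ v := fun e => notMem_of_mem_restComponents hKr (e ▸ hx)
      have hyv : y ≠ v := by
        rintro rfl
        exact hK (mem_touching.2 ⟨hKr, x, hx, (altPairGraph_adj_color hv hac x).1 hxy.symm⟩)
      exact mem_component.2 ((mem_component.1 hx).trans (SimpleGraph.Adj.reachable
        ⟨SimpleGraph.deleteIncidenceSet_adj.2 ⟨hxy.1, hxv, hyv⟩, hxy.2⟩))
    · rw [← component_self hv hac]
      refine component_eq_of_mem ?_
      rw [component_self hv hac]
      exact Finset.mem_insert_of_mem (mem_joined.2 ⟨_, hK, self_mem_component⟩)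
  ext K
  rw [mem_components, Finset.mem_insert, Finset.mem_sdiff]
  constructor
  · rintro ⟨w, hw, rfl⟩
    by_cases hwv : w = v
    · subst hwv
      exact Or.inl (component_self hv hac)
    · obtain ⟨h1, h2⟩ := hrest w hwv hw
      by_cases hK : component (G.deleteIncidenceSet v) σ s(a, c) w ∈ touching G σ v s(a, c) c
      · exact Or.inl (h2 hK)
      · rw [h1 hK]
        exact Or.inr ⟨mem_restComponents.2 ⟨w, ⟨hwv, hw⟩, rfl⟩, hK⟩
  · rintro (rfl | ⟨hK, hKt⟩)
    · exact ⟨v, by rw [hv]; exact Sym2.mem_mk_left _ _, component_self hv hac⟩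
    · obtain ⟨w, ⟨hwv, hw⟩, rfl⟩ := mem_restComponents.1 hK
      exact ⟨w, hw, (hrest w hwv hw).1 hKt⟩

lemma insert_notMem_restComponents (S : Finset V) (T : Finset (Finset V)) :
    insert v S ∉ restComponents G σ v e \ T := fun h =>
  notMem_of_mem_restComponents (Finset.mem_sdiff.1 h).1 (Finset.mem_insert_self _ _)

/-- There are no alternating edges for a pair of equal colours. -/
lemma component_diag (w : V) : component G σ s(a, a) w = {w} := by
  refine Finset.Subset.antisymm ?_ (by simpa using self_mem_component)
  refine component_subset_of_closed (Finset.mem_singleton_self w) fun x _ y h => ?_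
  have := h.2.2
  rw [Sym2.eq_iff] at this
  exact absurd (by aesop) h.2.1

lemma components_diag (hv : σ v = a) :
    components G σ s(a, a) = insert {v} (restComponents G σ v s(a, a)) := by
  ext K
  simp only [mem_components, Finset.mem_insert, mem_restComponents, component_diag]
  constructor
  · rintro ⟨w, hw, rfl⟩
    by_cases h : w = v
    · exact Or.inl (by rw [h])
    · exact Or.inr ⟨w, ⟨h, hw⟩, rfl⟩
  · rintro (rfl | ⟨w, ⟨-, hw⟩, rfl⟩)
    · exact ⟨v, by simp [hv], rfl⟩
    · exact ⟨w, hw, rfl⟩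

end Components

/-! ### The moves of the flip dynamics, listed by components -/

section Moves

variable {V : Type*} [Fintype V] [DecidableEq V]

/-- The transposition of the two colours of a pair. -/
def swapPair : Sym2 ℕ → Equiv.Perm ℕ :=
  Sym2.lift ⟨fun x y => Equiv.swap x y, Equiv.swap_comm⟩

/-- Interchange the colours of the pair `e` on the set `S`. On a component of the alternating graph
of `e` this is the flip. -/
def flipOn (σ : V → ℕ) (S : Finset V) (e : Sym2 ℕ) : V → ℕ :=
  fun w => if w ∈ S then swapPair e (σ w) else σ w

open Classical in
/-- The rate at which the component `S` is flipped: `P s` for a flippable component of size `s`. -/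
noncomputable def flipRate (L : V → Finset ℕ) (S : Finset V) (e : Sym2 ℕ) : ℝ :=
  if ∀ w ∈ S, ∀ x ∈ e, x ∈ L w then flipProb S.card else 0

lemma flipProb_nonneg (s : ℕ) : 0 ≤ flipProb s := by
  rw [flipProb_eq]; positivity

lemma flipProb_le_one (s : ℕ) : flipProb s ≤ 1 := by
  rw [flipProb_eq, div_le_one (by norm_num)]
  exact_mod_cast flipNum_le s

lemma flipRate_nonneg (L : V → Finset ℕ) (S : Finset V) (e : Sym2 ℕ) : 0 ≤ flipRate L S e := by
  unfold flipRate
  split_ifs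
  · exact flipProb_nonneg _
  · exact le_rfl

lemma flipRate_le_one (L : V → Finset ℕ) (S : Finset V) (e : Sym2 ℕ) : flipRate L S e ≤ 1 := by
  unfold flipRate
  split_ifs
  · exact flipProb_le_one _
  · exact zero_le_one

/-- A sum over all choices of a vertex and a colour of its list, in which the cluster `S` has the
weight `flipRate S / |S|`, is the sum over all components with the weight `flipRate S`. -/
lemma sum_slots_eq (G : SimpleGraph V) (L : V → Finset ℕ) (σ : V → ℕ) (E : Finset (Sym2 ℕ))
    (hE : ∀ w, ∀ c ∈ L w, s(σ w, c) ∈ E) (ψ : Finset V → Sym2 ℕ → ℝ) :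
    ∑ w, ∑ c ∈ L w, flipRate L (component G σ s(σ w, c) w) s(σ w, c)
        / (component G σ s(σ w, c) w).card * ψ (component G σ s(σ w, c) w) s(σ w, c)
      = ∑ e ∈ E, ∑ S ∈ components G σ e, flipRate L S e * ψ S e := by
  classical
  set g : V → Sym2 ℕ → ℝ := fun w e => flipRate L (component G σ e w) e
        / (component G σ e w).card * ψ (component G σ e w) e with hg
  have hR : ∀ e ∈ E, ∑ S ∈ components G σ e, flipRate L S e * ψ S e
      = ∑ w, if σ w ∈ e then g w e else 0 := by
    intro e _
    rw [← Finset.sum_filter, hg]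
    simp only
    rw [Finset.sum_comp (s := ({w | σ w ∈ e} : Finset V))
      (fun S : Finset V => flipRate L S e / S.card * ψ S e) (component G σ e)]
    refine Finset.sum_congr (by unfold components; congr) fun S hS => ?_
    obtain ⟨w, hw, rfl⟩ := mem_components.1 hS
    have : ({x ∈ ({w | σ w ∈ e} : Finset V) | component G σ e x = component G σ e w})
        = component G σ e w := by
      ext x
      simp only [Finset.mem_filter, Finset.mem_univ, true_and]
      exact ⟨fun h => h.2 ▸ self_mem_component,
        fun h => ⟨color_mem_of_mem_component hw h, component_eq_of_mem h⟩⟩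
    rw [this, nsmul_eq_mul]
    have h0 : ((component G σ e w).card : ℝ) ≠ 0 := by
      exact_mod_cast (Finset.card_pos.2 ⟨w, self_mem_component⟩).ne'
    field_simp
  rw [Finset.sum_congr rfl hR, Finset.sum_comm]
  refine Finset.sum_congr rfl fun w _ => ?_
  change ∑ c ∈ L w, g w s(σ w, c) = _
  rw [← Finset.sum_filter, ← Finset.sum_image (s := L w) (g := fun c => s(σ w, c))
    (f := fun e => g w e) (fun x _ y _ h => Sym2.congr_right.1 h)]
  refine Finset.sum_subset (fun e he => ?_) fun e he hne => ?_
  · obtain ⟨c, hc, rfl⟩ := Finset.mem_image.1 he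
    exact Finset.mem_filter.2 ⟨hE w c hc, Sym2.mem_mk_left _ _⟩
  · obtain ⟨c, rfl⟩ := (Finset.mem_filter.1 he).2
    have : c ∉ L w := fun hc => hne (Finset.mem_image_of_mem _ hc)
    have h0 : flipRate L (component G σ s(σ w, c) w) s(σ w, c) = 0 :=
      if_neg fun h => this (h w self_mem_component c (Sym2.mem_mk_right _ _))
    simp only [hg, h0, zero_div, zero_mul]

end Moves

/-! ### The cost of the moves from two colourings that differ at one vertex -/

/-- The weighted Hamming distance. -/
noncomputable def weightedDist {V : Type*} [Fintype V] (wt : V → ℕ) (x y : V → ℕ) : ℝ :=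
  ∑ w with x w ≠ y w, (wt w : ℝ)

/-- The total weight of a set of vertices. -/
def setWeight {V : Type*} (wt : V → ℕ) (S : Finset V) : ℝ :=
  ∑ w ∈ S, (wt w : ℝ)

lemma setWeight_mono {V : Type*} (wt : V → ℕ) {S T : Finset V} (h : S ⊆ T) :
    setWeight wt S ≤ setWeight wt T :=
  Finset.sum_le_sum_of_subset_of_nonneg h fun _ _ _ => Nat.cast_nonneg _

lemma setWeight_nonneg {V : Type*} (wt : V → ℕ) (S : Finset V) : 0 ≤ setWeight wt S :=
  Finset.sum_nonneg fun _ _ => Nat.cast_nonneg _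

lemma setWeight_insert {V : Type*} [DecidableEq V] (wt : V → ℕ) {S : Finset V} {v : V}
    (h : v ∉ S) : setWeight wt (insert v S) = wt v + setWeight wt S :=
  Finset.sum_insert h

lemma setWeight_sdiff {V : Type*} [DecidableEq V] (wt : V → ℕ) {S T : Finset V} (h : T ⊆ S) :
    setWeight wt (S \ T) = setWeight wt S - setWeight wt T :=
  eq_sub_of_add_eq (Finset.sum_sdiff h)

/-- Two `L`-colourings `σ` and `τ` that differ at the vertex `v` only, vertex weights `1` and `2`,
and a function `f` on colourings that is `1`-Lipschitz for the weighted Hamming distance. -/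
structure NeighborPair {V : Type*} [Fintype V] (L : V → Finset ℕ) (wt : V → ℕ)
    (f : (V → ℕ) → ℝ) (σ τ : V → ℕ) (v : V) : Prop where
  agree : ∀ w, w ≠ v → σ w = τ w
  ne : σ v ≠ τ v
  left_mem : ∀ w, σ w ∈ L w
  right_mem : ∀ w, τ w ∈ L w
  weight : ∀ w, wt w = 1 ∨ wt w = 2
  lip : ∀ x y, f x - f y ≤ weightedDist wt x y

lemma flipOn_of_notMem {V : Type*} [DecidableEq V] {σ : V → ℕ} {S : Finset V} {e : Sym2 ℕ} {w : V}
    (h : w ∉ S) :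
    flipOn σ S e w = σ w := if_neg h

lemma flipOn_of_mem {V : Type*} [DecidableEq V] {σ : V → ℕ} {S : Finset V} {e : Sym2 ℕ} {w : V}
    (h : w ∈ S) :
    flipOn σ S e w = swapPair e (σ w) := if_pos h

section Cost

variable {V : Type*} [Fintype V] [DecidableEq V]

/-- The cost of flipping `S` in the colouring `σ`, compared with the distance `wt v` of `σ` and
`τ`. -/
def leftCost (wt : V → ℕ) (f : (V → ℕ) → ℝ) (σ τ : V → ℕ) (v : V) (S : Finset V) (e : Sym2 ℕ) :
    ℝ :=
  f (flipOn σ S e) - wt v - f τ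

/-- The cost of flipping `S` in the colouring `τ`. -/
def rightCost (f : (V → ℕ) → ℝ) (τ : V → ℕ) (S : Finset V) (e : Sym2 ℕ) : ℝ :=
  f τ - f (flipOn τ S e)

lemma swapPair_left (x y : ℕ) : swapPair s(x, y) x = y := Equiv.swap_apply_left x y

lemma swapPair_right (x y : ℕ) : swapPair s(x, y) y = x := Equiv.swap_apply_right x y

namespace NeighborPair

variable {L : V → Finset ℕ} {wt : V → ℕ} {f : (V → ℕ) → ℝ} {σ τ : V → ℕ} {v : V}
  {K K' U : Finset V} {e e' : Sym2 ℕ}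

lemma le_setWeight (h : NeighborPair L wt f σ τ v) {x y : V → ℕ} (D : Finset V)
    (hD : ∀ w, w ∉ D → x w = y w) : f x - f y ≤ setWeight wt D := by
  refine (h.lip x y).trans (Finset.sum_le_sum_of_subset_of_nonneg (fun w hw => ?_)
    fun _ _ _ => Nat.cast_nonneg _)
  by_contra hw'
  exact (Finset.mem_filter.1 hw).2 (hD w hw')

lemma pair_le (h : NeighborPair L wt f σ τ v) (D : Finset V)
    (hD : ∀ w, w ∉ D → flipOn σ K e w = flipOn τ K' e' w) :
    leftCost wt f σ τ v K e + rightCost f τ K' e' ≤ setWeight wt D - wt v := by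
  have := h.le_setWeight D hD
  unfold leftCost rightCost
  linarith

lemma left_le (h : NeighborPair L wt f σ τ v) (hv : v ∉ K) :
    leftCost wt f σ τ v K e ≤ setWeight wt K := by
  have := h.le_setWeight (x := flipOn σ K e) (y := τ) (insert v K) fun w hw => by
    rw [Finset.mem_insert, not_or] at hw
    rw [flipOn_of_notMem hw.2, h.agree w hw.1]
  rw [setWeight_insert wt hv] at this
  unfold leftCost
  linarith

lemma right_le (h : NeighborPair L wt f σ τ v) : rightCost f τ K e ≤ setWeight wt K :=
  h.le_setWeight K fun w hw => by rw [flipOn_of_notMem hw]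

/-- The same move in both colourings. -/
lemma common_le (h : NeighborPair L wt f σ τ v) :
    leftCost wt f σ τ v K e + rightCost f τ K e ≤ 0 := by
  have := h.pair_le (K := K) (K' := K) (e := e) (e' := e) {v} fun w hw => by
    rw [Finset.mem_singleton] at hw
    unfold flipOn
    rw [h.agree w hw]
  simpa [setWeight] using this

lemma union_le (h : NeighborPair L wt f σ τ v) (hv : v ∉ K) (hv' : v ∉ K') :
    leftCost wt f σ τ v K e + rightCost f τ K' e' ≤ setWeight wt (K ∪ K') := by
  have := h.pair_le (K := K) (K' := K') (e := e) (e' := e') (insert v (K ∪ K')) fun w hw => by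
    simp only [Finset.mem_insert, Finset.mem_union, not_or] at hw
    rw [flipOn_of_notMem hw.2.1, flipOn_of_notMem hw.2.2, h.agree w hw.1]
  rw [setWeight_insert wt (by simp [hv, hv'])] at this
  linarith

lemma left_insert_le (h : NeighborPair L wt f σ τ v) (hv : v ∉ U) :
    leftCost wt f σ τ v (insert v U) e ≤ setWeight wt U := by
  have := h.le_setWeight (x := flipOn σ (insert v U) e) (y := τ) (insert v U) fun w hw => by
    rw [flipOn_of_notMem hw, h.agree w fun e => hw (e ▸ Finset.mem_insert_self _ _)]
  rw [setWeight_insert wt hv] at this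
  unfold leftCost
  linarith

/-- A component in `τ` is flipped together with a cluster of `v` in `σ` that contains it. -/
lemma left_insert_add_right_le (h : NeighborPair L wt f σ τ v) (hv : v ∉ U) (hK : K ⊆ U) :
    leftCost wt f σ τ v (insert v U) e + rightCost f τ K e
      ≤ setWeight wt U - setWeight wt K := by
  have := h.pair_le (K := insert v U) (K' := K) (e := e) (e' := e) (insert v (U \ K))
    fun w hw => by
      simp only [Finset.mem_insert, Finset.mem_sdiff, not_or, not_and, not_not] at hw
      by_cases hU : w ∈ U
      · rw [flipOn_of_mem (Finset.mem_insert_of_mem hU), flipOn_of_mem (hw.2 hU), h.agree w hw.1]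
      · rw [flipOn_of_notMem (by simp [hU, hw.1]), flipOn_of_notMem fun h => hU (hK h),
          h.agree w hw.1]
  rw [setWeight_insert wt (by simp [hv]), setWeight_sdiff wt hK] at this
  linarith

/-- A component in `σ` is flipped together with a cluster of `v` in `τ` that contains it. -/
lemma left_add_right_insert_le (h : NeighborPair L wt f σ τ v) (hv : v ∉ U) (hK : K ⊆ U) :
    leftCost wt f σ τ v K e + rightCost f τ (insert v U) e
      ≤ setWeight wt U - setWeight wt K := by
  have := h.pair_le (K := K) (K' := insert v U) (e := e) (e' := e) (insert v (U \ K))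
    fun w hw => by
      simp only [Finset.mem_insert, Finset.mem_sdiff, not_or, not_and, not_not] at hw
      by_cases hU : w ∈ U
      · rw [flipOn_of_mem (Finset.mem_insert_of_mem hU), flipOn_of_mem (hw.2 hU), h.agree w hw.1]
      · rw [flipOn_of_notMem (S := insert v U) (by simp [hU, hw.1]),
          flipOn_of_notMem fun h => hU (hK h), h.agree w hw.1]
  rw [setWeight_insert wt (by simp [hv]), setWeight_sdiff wt hK] at this
  linarith

/-- In both colourings `v` gets the colour `c` and nothing else changes. -/
lemma singleton_le (h : NeighborPair L wt f σ τ v) (c : ℕ) :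
    leftCost wt f σ τ v {v} s(σ v, c) + rightCost f τ {v} s(τ v, c) ≤ -wt v := by
  have := h.pair_le (K := {v}) (K' := {v}) (e := s(σ v, c)) (e' := s(τ v, c)) ∅ fun w _ => by
    by_cases hw : w = v
    · subst hw
      rw [flipOn_of_mem (by simp), flipOn_of_mem (by simp), swapPair_left, swapPair_left]
    · rw [flipOn_of_notMem (by simpa using hw), flipOn_of_notMem (by simpa using hw), h.agree w hw]
  simpa [setWeight] using this

lemma left_insert_own_le (h : NeighborPair L wt f σ τ v) :
    leftCost wt f σ τ v (insert v U) s(σ v, τ v) ≤ setWeight wt U - wt v := by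
  have := h.le_setWeight (x := flipOn σ (insert v U) s(σ v, τ v)) (y := τ) U fun w hw => by
    by_cases hwv : w = v
    · subst hwv
      rw [flipOn_of_mem (Finset.mem_insert_self _ _), swapPair_left]
    · rw [flipOn_of_notMem (by simp [hw, hwv]), h.agree w hwv]
  unfold leftCost
  linarith

lemma left_insert_own_add_right_le (h : NeighborPair L wt f σ τ v) (hv : v ∉ U) (hK : K ⊆ U) :
    leftCost wt f σ τ v (insert v U) s(σ v, τ v) + rightCost f τ K s(σ v, τ v)
      ≤ setWeight wt U - setWeight wt K - wt v := by
  rw [← setWeight_sdiff wt hK]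
  refine h.pair_le (U \ K) fun w hw => ?_
  rw [Finset.mem_sdiff, not_and, not_not] at hw
  by_cases hwv : w = v
  · subst hwv
    rw [flipOn_of_mem (Finset.mem_insert_self _ _), swapPair_left,
      flipOn_of_notMem fun h => hv (hK h)]
  by_cases hU : w ∈ U
  · rw [flipOn_of_mem (Finset.mem_insert_of_mem hU), flipOn_of_mem (hw hU), h.agree w hwv]
  · rw [flipOn_of_notMem (by simp [hU, hwv]), flipOn_of_notMem fun h => hU (hK h), h.agree w hwv]

lemma left_add_right_insert_own_le (h : NeighborPair L wt f σ τ v) (hv : v ∉ U) (hK : K ⊆ U) :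
    leftCost wt f σ τ v K s(σ v, τ v) + rightCost f τ (insert v U) s(σ v, τ v)
      ≤ setWeight wt U - setWeight wt K - wt v := by
  rw [← setWeight_sdiff wt hK]
  refine h.pair_le (U \ K) fun w hw => ?_
  rw [Finset.mem_sdiff, not_and, not_not] at hw
  by_cases hwv : w = v
  · subst hwv
    rw [flipOn_of_mem (S := insert w U) (Finset.mem_insert_self _ _), swapPair_right,
      flipOn_of_notMem fun h => hv (hK h)]
  by_cases hU : w ∈ U
  · rw [flipOn_of_mem (S := insert v U) (Finset.mem_insert_of_mem hU), flipOn_of_mem (hw hU),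
      h.agree w hwv]
  · rw [flipOn_of_notMem (S := insert v U) (by simp [hU, hwv]),
      flipOn_of_notMem fun h => hU (hK h), h.agree w hwv]

lemma left_null {V : Type*} [DecidableEq V] (wt : V → ℕ) (f : (V → ℕ) → ℝ) (σ τ : V → ℕ) (v : V) :
    leftCost wt f σ τ v {v} s(σ v, σ v) = f σ - wt v - f τ := by
  have : flipOn σ {v} s(σ v, σ v) = σ := by
    ext w
    by_cases hw : w = v
    · subst hw; rw [flipOn_of_mem (by simp), swapPair_left]
    · rw [flipOn_of_notMem (by simpa using hw)]
  rw [leftCost, this]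

lemma right_null {V : Type*} [DecidableEq V] (f : (V → ℕ) → ℝ) (τ : V → ℕ) (v : V) :
    rightCost f τ {v} s(τ v, τ v) = 0 := by
  have : flipOn τ {v} s(τ v, τ v) = τ := by
    ext w
    by_cases hw : w = v
    · subst hw; rw [flipOn_of_mem (by simp), swapPair_left]
    · rw [flipOn_of_notMem (by simpa using hw)]
  rw [rightCost, this, sub_self]

lemma left_null_le (h : NeighborPair L wt f σ τ v) :
    leftCost wt f σ τ v {v} s(σ v, σ v) ≤ 0 := by
  have := h.le_setWeight (x := σ) (y := τ) {v} fun w hw => h.agree w (by simpa using hw)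
  rw [left_null]
  simp only [setWeight, Finset.sum_singleton] at this
  linarith

/-- The colouring `σ` does not move and the cluster of `v` in `τ` is flipped. -/
lemma left_null_add_right_insert_le (h : NeighborPair L wt f σ τ v) :
    leftCost wt f σ τ v {v} s(σ v, σ v) + rightCost f τ (insert v U) s(σ v, τ v)
      ≤ setWeight wt U - wt v := by
  have := h.le_setWeight (x := σ) (y := flipOn τ (insert v U) s(σ v, τ v)) U fun w hw => by
    by_cases hwv : w = v
    · subst hwv
      rw [flipOn_of_mem (Finset.mem_insert_self _ _), swapPair_right]
    · rw [flipOn_of_notMem (by simp [hw, hwv]), h.agree w hwv]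
  rw [left_null]
  unfold rightCost
  linarith

end NeighborPair

/-- The total cost of the moves of the components of the colour pair `e`. -/
noncomputable def pairTotal (G : SimpleGraph V) (L : V → Finset ℕ) (wt : V → ℕ)
    (f : (V → ℕ) → ℝ) (σ τ : V → ℕ) (v : V) (e : Sym2 ℕ) : ℝ :=
  ∑ S ∈ components G σ e, flipRate L S e * leftCost wt f σ τ v S e
    + ∑ S ∈ components G τ e, flipRate L S e * rightCost f τ S e

namespace NeighborPair

variable {L : V → Finset ℕ} {wt : V → ℕ} {f : (V → ℕ) → ℝ} {σ τ : V → ℕ} {v : V}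
  {e : Sym2 ℕ} {G : SimpleGraph V} {c : ℕ}

/-- Components that are flipped in both colourings cost nothing. -/
lemma sum_common_le (h : NeighborPair L wt f σ τ v) (T : Finset (Finset V)) :
    ∑ S ∈ T, flipRate L S e * leftCost wt f σ τ v S e
      + ∑ S ∈ T, flipRate L S e * rightCost f τ S e ≤ 0 := by
  rw [← Finset.sum_add_distrib]
  refine Finset.sum_nonpos fun S _ => ?_
  rw [← mul_add]
  exact mul_nonpos_of_nonneg_of_nonpos (flipRate_nonneg _ _ _)
    h.common_le

lemma pairTotal_le_of_notMem (h : NeighborPair L wt f σ τ v) (hσ : σ v ∉ e) (hτ : τ v ∉ e) :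
    pairTotal G L wt f σ τ v e ≤ 0 := by
  unfold pairTotal
  rw [components_eq_restComponents hσ, components_eq_restComponents hτ,
    ← restComponents_congr h.agree]
  exact h.sum_common_le _

lemma flipRate_singleton {x : ℕ} (hx : x ∈ L v) : flipRate L {v} s(x, x) = 1 := by
  rw [flipRate, if_pos (by simpa using hx)]
  simp [flipProb]

lemma pairTotal_left_diag_le (h : NeighborPair L wt f σ τ v) :
    pairTotal G L wt f σ τ v s(σ v, σ v) ≤ leftCost wt f σ τ v {v} s(σ v, σ v) := by
  unfold pairTotal
  rw [components_diag rfl, components_eq_restComponents (σ := τ) (by simpa using h.ne.symm),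
    ← restComponents_congr h.agree,
    Finset.sum_insert fun hm => notMem_of_mem_restComponents hm (by simp),
    flipRate_singleton (h.left_mem v), one_mul]
  linarith [h.sum_common_le (e := s(σ v, σ v)) (restComponents G σ v s(σ v, σ v))]

lemma pairTotal_right_diag_le (h : NeighborPair L wt f σ τ v) :
    pairTotal G L wt f σ τ v s(τ v, τ v) ≤ 0 := by
  unfold pairTotal
  rw [components_diag (σ := τ) rfl, components_eq_restComponents (σ := σ) (by simpa using h.ne),
    ← restComponents_congr h.agree,
    Finset.sum_insert fun hm => notMem_of_mem_restComponents hm (by simp), right_null, mul_zero,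
    zero_add]
  exact h.sum_common_le (e := s(τ v, τ v)) _

lemma touching_subset : touching G σ v e c ⊆ restComponents G σ v e := Finset.filter_subset _ _

lemma pairTotal_left_le (h : NeighborPair L wt f σ τ v) (hc : σ v ≠ c) (hc' : τ v ≠ c) :
    pairTotal G L wt f σ τ v s(σ v, c) ≤
      flipRate L (insert v (joined G σ v s(σ v, c) c)) s(σ v, c)
        * leftCost wt f σ τ v (insert v (joined G σ v s(σ v, c) c)) s(σ v, c)
      + ∑ S ∈ touching G σ v s(σ v, c) c, flipRate L S s(σ v, c) * rightCost f τ S s(σ v, c) := by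
  unfold pairTotal
  rw [components_eq_insert rfl hc, components_eq_restComponents (σ := τ)
    (by simpa using ⟨h.ne.symm, hc'⟩), ← restComponents_congr h.agree,
    Finset.sum_insert (insert_notMem_restComponents _ _), ← Finset.sum_sdiff touching_subset]
  have := h.sum_common_le (e := s(σ v, c)) (restComponents G σ v s(σ v, c) \
    touching G σ v s(σ v, c) c)
  linarith

lemma pairTotal_right_le (h : NeighborPair L wt f σ τ v) (hc : σ v ≠ c) (hc' : τ v ≠ c) :
    pairTotal G L wt f σ τ v s(τ v, c) ≤
      flipRate L (insert v (joined G σ v s(τ v, c) c)) s(τ v, c)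
        * rightCost f τ (insert v (joined G σ v s(τ v, c) c)) s(τ v, c)
      + ∑ S ∈ touching G σ v s(τ v, c) c,
        flipRate L S s(τ v, c) * leftCost wt f σ τ v S s(τ v, c) := by
  have hj : joined G τ v s(τ v, c) c = joined G σ v s(τ v, c) c := by
    unfold joined; rw [touching_congr h.agree]
  unfold pairTotal
  rw [components_eq_insert rfl hc', hj, components_eq_restComponents (σ := σ)
    (by simpa using ⟨h.ne, hc⟩), ← restComponents_congr h.agree, ← touching_congr h.agree,
    Finset.sum_insert (insert_notMem_restComponents _ _), ← Finset.sum_sdiff touching_subset]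
  have := h.sum_common_le (e := s(τ v, c)) (restComponents G σ v s(τ v, c) \
    touching G σ v s(τ v, c) c)
  linarith

/-- For the pair of the two colours of `v`, the cluster of `v` in `σ` absorbs the components next
to neighbours of colour `τ v`, and that in `τ` those next to neighbours of colour `σ v`. -/
lemma pairTotal_own_le (h : NeighborPair L wt f σ τ v) :
    pairTotal G L wt f σ τ v s(σ v, τ v) ≤
      flipRate L (insert v (joined G σ v s(σ v, τ v) (τ v))) s(σ v, τ v)
        * leftCost wt f σ τ v (insert v (joined G σ v s(σ v, τ v) (τ v))) s(σ v, τ v)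
      + ∑ S ∈ touching G σ v s(σ v, τ v) (τ v) \ touching G σ v s(σ v, τ v) (σ v),
        flipRate L S s(σ v, τ v) * rightCost f τ S s(σ v, τ v)
      + (flipRate L (insert v (joined G σ v s(σ v, τ v) (σ v))) s(σ v, τ v)
        * rightCost f τ (insert v (joined G σ v s(σ v, τ v) (σ v))) s(σ v, τ v)
      + ∑ S ∈ touching G σ v s(σ v, τ v) (σ v) \ touching G σ v s(σ v, τ v) (τ v),
        flipRate L S s(σ v, τ v) * leftCost wt f σ τ v S s(σ v, τ v)) := by
  have hj : joined G τ v s(σ v, τ v) (σ v) = joined G σ v s(σ v, τ v) (σ v) := by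
    unfold joined; rw [touching_congr h.agree]
  have hcτ : components G τ s(σ v, τ v) = insert (insert v (joined G σ v s(σ v, τ v) (σ v)))
      (restComponents G σ v s(σ v, τ v) \ touching G σ v s(σ v, τ v) (σ v)) := by
    have := components_eq_insert (G := G) (σ := τ) (v := v) rfl h.ne.symm
    rwa [Sym2.eq_swap, hj, ← restComponents_congr h.agree, ← touching_congr h.agree] at this
  unfold pairTotal
  rw [components_eq_insert rfl h.ne, hcτ, Finset.sum_insert (insert_notMem_restComponents _ _),
    Finset.sum_insert (insert_notMem_restComponents _ _)]
  set R := restComponents G σ v s(σ v, τ v)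
  set A := touching G σ v s(σ v, τ v) (σ v)
  set B := touching G σ v s(σ v, τ v) (τ v)
  have hA : A ⊆ R := touching_subset
  have hB : B ⊆ R := touching_subset
  have split : ∀ (P Q : Finset (Finset V)) (g : Finset V → ℝ), P ⊆ R →
      ∑ S ∈ R \ Q, g S = ∑ S ∈ R \ (P ∪ Q), g S + ∑ S ∈ P \ Q, g S := by
    intro P Q g hP
    rw [← Finset.sum_union]
    · congr 1
      ext S
      simp only [Finset.mem_sdiff, Finset.mem_union]
      have := @hP S
      tauto
    · rw [Finset.disjoint_left]
      intro S h1 h2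
      simp only [Finset.mem_sdiff, Finset.mem_union] at h1 h2
      tauto
  rw [split A B _ hA, split B A _ hB, Finset.union_comm B A]
  have := h.sum_common_le (e := s(σ v, τ v)) (R \ (A ∪ B))
  linarith

end NeighborPair

end Cost

/-! ### The contribution of a single colour -/

section ColorBound

variable {V : Type*} [Fintype V] [DecidableEq V]

/-- A family of disjoint sets that cover `N` and all meet `N` can be listed by representatives
in `N`. -/
lemma exists_representatives {V : Type*} [DecidableEq V] [Nonempty V]
    {𝒦 : Finset (Finset V)} {N : Finset V}
    (hdisj : ∀ K ∈ 𝒦, ∀ K' ∈ 𝒦, ∀ u ∈ K, u ∈ K' → K = K')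
    (hN : ∀ u ∈ N, ∃ K ∈ 𝒦, u ∈ K) (hK : ∀ K ∈ 𝒦, ∃ u ∈ K, u ∈ N) :
    ∃ (comp : V → Finset V) (I : Finset V), I ⊆ N ∧ (∀ u ∈ N, comp u ∈ 𝒦 ∧ u ∈ comp u) ∧
      ∀ φ : Finset V → ℝ, ∑ K ∈ 𝒦, φ K = ∑ u ∈ I, φ (comp u) := by
  classical
  choose! comp hcomp using hN
  choose! rep hrep using hK
  refine ⟨comp, {u ∈ N | rep (comp u) = u}, Finset.filter_subset _ _, hcomp, fun φ => ?_⟩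
  have hcr : ∀ K ∈ 𝒦, comp (rep K) = K := fun K hK =>
    hdisj _ (hcomp _ (hrep K hK).2).1 _ hK (rep K) (hcomp _ (hrep K hK).2).2 (hrep K hK).1
  refine Finset.sum_nbij' rep comp (fun K hK => ?_) (fun u hu => ?_) hcr (fun u hu => ?_)
    fun K hK => by rw [hcr K hK]
  · exact Finset.mem_filter.2 ⟨(hrep K hK).2, by rw [hcr K hK]⟩
  · exact (hcomp u (Finset.mem_filter.1 hu).1).1
  · exact (Finset.mem_filter.1 hu).2

lemma setWeight_biUnion_le {V : Type*} [DecidableEq V] (wt : V → ℕ) (𝒦 : Finset (Finset V)) :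
    setWeight wt (𝒦.biUnion id) ≤ ∑ K ∈ 𝒦, setWeight wt K := by
  classical
  induction 𝒦 using Finset.induction_on with
  | empty => simp [setWeight]
  | insert K 𝒦 hK ih =>
    rw [Finset.biUnion_insert, Finset.sum_insert hK]
    have h : setWeight wt (id K ∪ 𝒦.biUnion id) + setWeight wt (id K ∩ 𝒦.biUnion id)
      = setWeight wt K + setWeight wt (𝒦.biUnion id) := Finset.sum_union_inter
    linarith [setWeight_nonneg wt (id K ∩ 𝒦.biUnion id)]

lemma setWeight_le_maxWeight {V : Type*} [DecidableEq V] {wt : V → ℕ}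
    (hwt : ∀ w, wt w = 1 ∨ wt w = 2) {K : Finset V} {u : V} (hu : u ∈ K) :
    setWeight wt K ≤ maxWeight K.card (wt u) := by
  have h1 : ∑ w ∈ K, wt w ≤ maxWeight K.card (wt u) := by
    rw [← Finset.add_sum_erase _ _ hu]
    have : ∑ w ∈ K.erase u, wt w ≤ (K.erase u).card • 2 :=
      Finset.sum_le_card_nsmul _ _ _ fun w _ => by rcases hwt w with e | e <;> omega
    have hc := Finset.card_erase_add_one hu
    unfold maxWeight
    rw [smul_eq_mul] at this
    rcases hwt u with e | e <;> omega
  unfold setWeight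
  exact_mod_cast h1

open Classical in
/-- The size of a component, increased by `7` if it is not flippable: then the flip probability
of this size is the rate in both cases. -/
noncomputable def effectiveSize (L : V → Finset ℕ) (e : Sym2 ℕ) (K : Finset V) : ℕ :=
  if ∀ w ∈ K, ∀ x ∈ e, x ∈ L w then K.card else K.card + 7

lemma flipRate_eq (L : V → Finset ℕ) (e : Sym2 ℕ) (K : Finset V) :
    flipRate L K e = flipNum (effectiveSize L e K) / 650 := by
  unfold flipRate effectiveSize
  split_ifs
  · exact flipProb_eq _
  · rw [flipNum_eq_zero (by omega)]; simp

lemma card_le_effectiveSize (L : V → Finset ℕ) (e : Sym2 ℕ) (K : Finset V) :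
    K.card ≤ effectiveSize L e K := by
  unfold effectiveSize
  split_ifs <;> omega

lemma effectiveSize_eq_card {L : V → Finset ℕ} {e : Sym2 ℕ} {K : Finset V}
    (h : effectiveSize L e K ≤ 6) :
    (∀ w ∈ K, ∀ x ∈ e, x ∈ L w) ∧ effectiveSize L e K = K.card := by
  unfold effectiveSize at h ⊢
  split_ifs at h ⊢ with hK
  · exact ⟨hK, rfl⟩
  · omega

/-- A list of the components of the family `𝒦` by representatives in `N`, where `a u` is the
effective size of the component of a representative `u` and `0` for other `u ∈ N`. -/
structure SizeList (L : V → Finset ℕ) (wt : V → ℕ) (e : Sym2 ℕ) (𝒦 : Finset (Finset V))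
    (N : Finset V) (comp : V → Finset V) (a : V → ℕ) : Prop where
  sum_eq : ∀ φ : Finset V → ℝ,
    ∑ K ∈ 𝒦, flipRate L K e * φ K = (∑ u ∈ N, flipNum (a u) * φ (comp u)) / 650
  card_le : N.card ≤ ∑ u ∈ N, a u
  mem : ∀ u ∈ N, comp u ∈ 𝒦 ∧ u ∈ comp u
  weight_le : ∀ u ∈ N, 1 ≤ a u → a u ≤ 6 → setWeight wt (comp u) ≤ maxWeight (a u) (wt u)
  joined_le : ∑ u ∈ N, a u ≤ 5 →
    setWeight wt (𝒦.biUnion id) ≤ ∑ u ∈ N, (maxWeight (a u) (wt u) : ℝ)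
  joined_sub_le : ∑ u ∈ N, a u ≤ 5 → ∀ j ∈ N, 1 ≤ a j →
    setWeight wt (𝒦.biUnion id) - setWeight wt (comp j)
      ≤ ∑ u ∈ N.erase j, (maxWeight (a u) (wt u) : ℝ)
  rate_eq : ∀ v, v ∉ 𝒦.biUnion id → (∀ x ∈ e, x ∈ L v) →
    flipRate L (insert v (𝒦.biUnion id)) e = flipNum (1 + ∑ u ∈ N, a u) / 650

variable {L : V → Finset ℕ} {wt : V → ℕ} {e : Sym2 ℕ} {𝒦 : Finset (Finset V)} {N : Finset V}

lemma flipRate_insert {U : Finset V} {v : V} (hv : v ∉ U) (he : ∀ x ∈ e, x ∈ L v) :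
    flipRate L (insert v U) e = flipNum (1 + effectiveSize L e U) / 650 := by
  classical
  have h1 : (∀ w ∈ insert v U, ∀ x ∈ e, x ∈ L w) ↔ ∀ w ∈ U, ∀ x ∈ e, x ∈ L w := by
    rw [Finset.forall_mem_insert]
    exact and_iff_right he
  unfold flipRate effectiveSize
  simp only [h1]
  split_ifs
  · rw [flipProb_eq, Finset.card_insert_of_notMem hv, add_comm]
  · rw [flipNum_eq_zero (by omega)]; simp

lemma exists_sizeList [Nonempty V] (hwt : ∀ w, wt w = 1 ∨ wt w = 2)
    (hdisj : ∀ K ∈ 𝒦, ∀ K' ∈ 𝒦, ∀ u ∈ K, u ∈ K' → K = K')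
    (hN : ∀ u ∈ N, ∃ K ∈ 𝒦, u ∈ K) (hK : ∀ K ∈ 𝒦, ∃ u ∈ K, u ∈ N) :
    ∃ comp a, SizeList L wt e 𝒦 N comp a := by
  classical
  obtain ⟨comp, I, hI, hmem, hsum⟩ := exists_representatives hdisj hN hK
  set a : V → ℕ := fun u => if u ∈ I then effectiveSize L e (comp u) else 0 with ha
  have ext : ∀ φ : V → ℝ, (∀ u ∈ N, u ∉ I → φ u = 0) → ∑ u ∈ I, φ u = ∑ u ∈ N, φ u :=
    fun φ h => Finset.sum_subset hI h
  have haI : ∀ u ∈ I, a u = effectiveSize L e (comp u) := fun u hu => if_pos hu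
  have haN : ∀ u, u ∉ I → a u = 0 := fun u hu => if_neg hu
  have hmI : ∀ u, 1 ≤ a u → u ∈ I := fun u hu => by
    by_contra h
    rw [haN u h] at hu
    omega
  have hwle : ∀ u ∈ N, 1 ≤ a u → a u ≤ 6 →
      setWeight wt (comp u) ≤ maxWeight (a u) (wt u) := by
    intro u hu h1 h6
    rw [haI u (hmI u h1)] at h6 ⊢
    rw [(effectiveSize_eq_card h6).2]
    exact setWeight_le_maxWeight hwt (hmem u hu).2
  have hbound : ∑ u ∈ N, a u ≤ 5 → ∀ J ⊆ I,
      ∑ u ∈ J, setWeight wt (comp u) ≤ ∑ u ∈ J, (maxWeight (a u) (wt u) : ℝ) := by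
    intro hs J hJ
    refine Finset.sum_le_sum fun u hu => ?_
    have huN := hI (hJ hu)
    refine hwle u huN ?_ ((Finset.single_le_sum (fun _ _ => Nat.zero_le _) huN).trans (by omega))
    rw [haI u (hJ hu)]
    exact (Finset.card_pos.2 ⟨u, (hmem u huN).2⟩).trans_le (card_le_effectiveSize _ _ _)
  have hmax : ∀ u, u ∉ I → (maxWeight (a u) (wt u) : ℝ) = 0 := fun u hu => by
    rw [haN u hu]; simp [maxWeight]
  have hcardsum : ((𝒦.sum fun K => (K.card : ℝ)) = ∑ u ∈ I, ((comp u).card : ℝ)) :=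
    hsum fun K => (K.card : ℝ)
  refine ⟨comp, a, fun φ => ?_, ?_, hmem, hwle, fun hs => ?_, fun hs j hj hj1 => ?_,
    fun v hv he => ?_⟩
  · rw [hsum, Finset.sum_div, ← ext (fun u => flipNum (a u) * φ (comp u) / 650)]
    · refine Finset.sum_congr rfl fun u hu => ?_
      rw [flipRate_eq, haI u hu]
      ring
    · intro u _ hu
      rw [haN u hu]
      simp [flipNum]
  · have h1 : (N.card : ℝ) ≤ ∑ u ∈ N, (a u : ℝ) := by
      have hsub : N ⊆ 𝒦.biUnion id := fun u hu => by
        simpa using ⟨comp u, (hmem u hu).1, (hmem u hu).2⟩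
      have h2 : N.card ≤ ∑ K ∈ 𝒦, K.card :=
        (Finset.card_le_card hsub).trans Finset.card_biUnion_le
      have h3 : (N.card : ℝ) ≤ ∑ K ∈ 𝒦, (K.card : ℝ) := by exact_mod_cast h2
      rw [hcardsum] at h3
      refine h3.trans ?_
      rw [← ext (fun u => (a u : ℝ)) fun u _ hu => by simp [haN u hu]]
      refine Finset.sum_le_sum fun u hu => ?_
      rw [haI u hu]
      exact_mod_cast card_le_effectiveSize _ _ _
    exact_mod_cast h1
  · rw [← ext _ fun u _ hu => hmax u hu]
    refine (setWeight_biUnion_le _ _).trans ?_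
    rw [hsum]
    exact hbound hs I subset_rfl
  · have hjI := hmI j hj1
    have h1 : ∑ u ∈ N.erase j, (maxWeight (a u) (wt u) : ℝ)
        = ∑ u ∈ I.erase j, (maxWeight (a u) (wt u) : ℝ) := by
      refine (Finset.sum_subset (Finset.erase_subset_erase _ hI) fun u hu hu' => ?_).symm
      exact hmax u fun h => hu' (Finset.mem_erase.2 ⟨Finset.ne_of_mem_erase hu, h⟩)
    rw [h1]
    refine le_trans ?_ (hbound hs _ (Finset.erase_subset j I))
    have h2 := setWeight_biUnion_le wt 𝒦
    rw [hsum, ← Finset.add_sum_erase _ _ hjI] at h2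
    linarith
  · rw [flipRate_insert hv he]
    by_cases hfl : ∀ w ∈ 𝒦.biUnion id, ∀ x ∈ e, x ∈ L w
    · have hcard : (𝒦.biUnion id).card = ∑ u ∈ N, a u := by
        have h1 : ((𝒦.biUnion id).card : ℝ) = ∑ u ∈ N, (a u : ℝ) := by
          rw [Finset.card_biUnion (t := id) fun K hK K' hK' hne => Finset.disjoint_left.2
            fun u hu hu' => hne (hdisj K hK K' hK' u hu hu')]
          push_cast
          simp only [id]
          rw [hcardsum, ← ext (fun u => (a u : ℝ)) fun u _ hu => by simp [haN u hu]]
          refine Finset.sum_congr rfl fun u hu => ?_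
          rw [haI u hu, effectiveSize, if_pos]
          intro w hw
          exact hfl w (by simpa using ⟨comp u, (hmem u (hI hu)).1, hw⟩)
        exact_mod_cast h1
      rw [← hcard, effectiveSize, if_pos hfl]
    · rw [effectiveSize, if_neg hfl, flipNum_eq_zero (by omega), flipNum_eq_zero]
      push Not at hfl
      obtain ⟨w, hw, x, hx, hxL⟩ := hfl
      obtain ⟨K, hK𝒦, hwK⟩ : ∃ K ∈ 𝒦, w ∈ K := by simpa using hw
      have hK' : 7 ≤ ∑ K ∈ 𝒦, (effectiveSize L e K : ℝ) := by
        have h7 : 7 ≤ effectiveSize L e K := by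
          rw [effectiveSize, if_neg fun h => hxL (h w hwK x hx)]
          omega
        have := Finset.single_le_sum (f := fun K => (effectiveSize L e K : ℝ))
          (fun _ _ => Nat.cast_nonneg _) hK𝒦
        have h7' : (7 : ℝ) ≤ effectiveSize L e K := by exact_mod_cast h7
        exact h7'.trans this
      rw [hsum] at hK'
      have h8 : ∑ u ∈ I, (effectiveSize L e (comp u) : ℝ) = ∑ u ∈ N, (a u : ℝ) := by
        rw [← ext (fun u => (a u : ℝ)) fun u _ hu => by simp [haN u hu]]
        exact Finset.sum_congr rfl fun u hu => by rw [haI u hu]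
      rw [h8] at hK'
      have : 7 ≤ ∑ u ∈ N, a u := by exact_mod_cast hK'
      omega

variable {f : (V → ℕ) → ℝ} {σ τ : V → ℕ} {v : V} {G : SimpleGraph V} {c : ℕ}

lemma exists_sizeList_touching (hwt : ∀ w, wt w = 1 ∨ wt w = 2) (hc : c ∈ e) :
    ∃ comp a, SizeList L wt e (touching G σ v e c) (colorNbrs G σ v c) comp a := by
  have : Nonempty V := ⟨v⟩
  refine exists_sizeList hwt (fun K hK K' hK' u hu hu' =>
    eq_of_mem_restComponents (mem_touching.1 hK).1 (mem_touching.1 hK').1 hu hu')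
    (fun u hu => ?_) fun K hK => ?_
  · have hu' := mem_colorNbrs.1 hu
    obtain ⟨K, hK, huK⟩ := exists_mem_restComponents (G := G) (σ := σ) (e := e) hu'.1.ne'
      (by rw [hu'.2]; exact hc)
    exact ⟨K, mem_touching.2 ⟨hK, u, huK, hu'⟩, huK⟩
  · obtain ⟨-, u, hu, hu'⟩ := mem_touching.1 hK
    exact ⟨u, hu, mem_colorNbrs.2 hu'⟩

/-- The contribution of a colour `c` other than the two colours of `v`: it is at most
`κ = 1933 / 650` per neighbour of colour `c`, in terms of the smaller of the two weights, and the
weight of `v` is gained if `c` is in the list of `v`. -/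
theorem NeighborPair.pairTotal_add_le (h : NeighborPair L wt f σ τ v) (hc : σ v ≠ c)
    (hc' : τ v ≠ c) :
    pairTotal G L wt f σ τ v s(σ v, c) + pairTotal G L wt f σ τ v s(τ v, c) ≤
      1933 / 650 * ∑ u ∈ colorNbrs G σ v c, (min (wt v) (wt u) : ℕ)
        - if c ∈ L v then (wt v : ℝ) else 0 := by
  obtain ⟨compB, b, hB⟩ := exists_sizeList_touching (L := L) (wt := wt) (e := s(σ v, c)) (G := G)
    (σ := σ) (v := v) h.weight (Sym2.mem_mk_right (σ v) c)
  obtain ⟨compA, a, hA⟩ := exists_sizeList_touching (L := L) (wt := wt) (e := s(τ v, c)) (G := G)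
    (σ := σ) (v := v) h.weight (Sym2.mem_mk_right (τ v) c)
  have h1 := h.pairTotal_left_le (G := G) hc hc'
  have h2 := h.pairTotal_right_le (G := G) hc hc'
  set N := colorNbrs G σ v c with hNdef
  set X := insert v (joined G σ v s(σ v, c) c)
  set Y := insert v (joined G σ v s(τ v, c) c)
  rw [hB.sum_eq] at h1
  rw [hA.sum_eq] at h2
  have hsub : ∀ {e : Sym2 ℕ} {K}, K ∈ touching G σ v e c → K ⊆ joined G σ v e c :=
    fun hK u hu => mem_joined.2 ⟨_, hK, hu⟩
  have hvB : ∀ u ∈ N, v ∉ compB u := fun u hu =>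
    notMem_of_mem_restComponents (touching_subset (hB.mem u hu).1)
  have hvA : ∀ u ∈ N, v ∉ compA u := fun u hu =>
    notMem_of_mem_restComponents (touching_subset (hA.mem u hu).1)
  have hdata : ColorData N wt a b (fun u => leftCost wt f σ τ v (compA u) s(τ v, c))
      (fun u => rightCost f τ (compB u) s(σ v, c)) (leftCost wt f σ τ v X s(σ v, c))
      (rightCost f τ Y s(τ v, c)) := by
    refine ⟨fun _ => hA.card_le, fun _ => hB.card_le, fun u hu ha1 ha6 => ?_,
      fun u hu hb1 hb6 => ?_, fun u hu ha1 ha6 hb1 hb6 => ?_, fun hs => ?_,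
      fun hs j hj hj1 => ?_, fun hs i hi hi1 => ?_⟩
    · exact (h.left_le (hvA u hu)).trans (hA.weight_le u hu ha1 ha6)
    · exact h.right_le.trans (hB.weight_le u hu hb1 hb6)
    · have e1 := h.union_le (e := s(τ v, c)) (e' := s(σ v, c)) (hvA u hu) (hvB u hu)
      have e2 : setWeight wt (compA u ∪ compB u) + setWeight wt (compA u ∩ compB u)
          = setWeight wt (compA u) + setWeight wt (compB u) := Finset.sum_union_inter
      have e3 : setWeight wt {u} ≤ setWeight wt (compA u ∩ compB u) :=
        setWeight_mono wt (by
          simpa using ⟨(hA.mem u hu).2, (hB.mem u hu).2⟩)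
      rw [setWeight, Finset.sum_singleton] at e3
      have e4 := hA.weight_le u hu ha1 ha6
      have e5 := hB.weight_le u hu hb1 hb6
      linarith
    · exact (h.left_insert_le notMem_joined).trans (hB.joined_le hs)
    · exact (h.left_insert_add_right_le notMem_joined (hsub (hB.mem j hj).1)).trans
        (hB.joined_sub_le hs j hj hj1)
    · have e1 := h.left_add_right_insert_le (e := s(τ v, c)) notMem_joined (hsub (hA.mem i hi).1)
      have e2 := hA.joined_sub_le hs i hi hi1
      unfold joined at e1
      change _ + rightCost f τ Y _ ≤ _ at e1
      linarith
  have hcomp : (∑ u ∈ N, flipNum (b u) * rightCost f τ (compB u) s(σ v, c)) / 650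
      + (∑ u ∈ N, flipNum (a u) * leftCost wt f σ τ v (compA u) s(τ v, c)) / 650
      = ColorData.compCost N a b (fun u => leftCost wt f σ τ v (compA u) s(τ v, c))
        (fun u => rightCost f τ (compB u) s(σ v, c)) / 650 := by
    rw [ColorData.compCost, Finset.sum_add_distrib]
    ring
  by_cases hcL : c ∈ L v
  · rw [if_pos hcL]
    have hX : flipRate L X s(σ v, c) = flipNum (1 + ∑ u ∈ N, b u) / 650 :=
      hB.rate_eq v notMem_joined (by
        intro x hx
        rcases Sym2.mem_iff.1 hx with rfl | rfl
        exacts [h.left_mem v, hcL])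
    have hY : flipRate L Y s(τ v, c) = flipNum (1 + ∑ u ∈ N, a u) / 650 :=
      hA.rate_eq v notMem_joined (by
        intro x hx
        rcases Sym2.mem_iff.1 hx with rfl | rfl
        exacts [h.right_mem v, hcL])
    rw [hX] at h1
    rw [hY] at h2
    rcases N.eq_empty_or_nonempty with hN | hN
    · have hj : ∀ e, joined G σ v e c = ∅ := by
        intro e
        refine Finset.eq_empty_of_forall_notMem fun u hu => ?_
        obtain ⟨K, hK, -⟩ := mem_joined.1 hu
        obtain ⟨-, u', -, hu'⟩ := mem_touching.1 hK
        have := mem_colorNbrs.2 hu'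
        rw [← hNdef, hN] at this
        simp at this
      have h3 := h.singleton_le c
      have hXv : X = {v} := by simp only [X, hj]; rfl
      have hYv : Y = {v} := by simp only [Y, hj]; rfl
      rw [hXv, hN] at h1
      rw [hYv, hN] at h2
      rw [hN]
      norm_num [flipNum] at h1 h2 ⊢
      linarith
    · have h3 := hdata.total_le h.weight hN (h.weight v)
      push_cast at h3 ⊢
      linarith
  · rw [if_neg hcL]
    have hX : flipRate L X s(σ v, c) = 0 :=
      if_neg fun hf => hcL (hf v (Finset.mem_insert_self _ _) c (Sym2.mem_mk_right _ _))
    have hY : flipRate L Y s(τ v, c) = 0 :=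
      if_neg fun hf => hcL (hf v (Finset.mem_insert_self _ _) c (Sym2.mem_mk_right _ _))
    rw [hX] at h1
    rw [hY] at h2
    have h3 := hdata.compCost_le_budget h.weight (h.weight v)
    push_cast at h3 ⊢
    linarith

lemma flipNum_mul_maxWeight_le : ∀ s < 7, ∀ w < 3, 1 ≤ w →
    flipNum s * maxWeight s w ≤ 650 * w := by decide

lemma flipNum_sub_mul_maxWeight_le : ∀ s < 7, 1 ≤ s → ∀ w < 3, 1 ≤ w →
    (flipNum s - flipNum (1 + s)) * maxWeight s w ≤ 513 * w := by decide

lemma flipNum_succ_mul_le : ∀ s < 6, flipNum (1 + s) * (2 * s) ≤ 308 := by decide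

lemma setWeight_le_two_mul {V : Type*} {wt : V → ℕ} (hwt : ∀ w, wt w = 1 ∨ wt w = 2)
    (S : Finset V) : setWeight wt S ≤ 2 * S.card := by
  have : ∑ w ∈ S, wt w ≤ S.card • 2 :=
    Finset.sum_le_card_nsmul _ _ _ fun w _ => by rcases hwt w with e | e <;> omega
  rw [smul_eq_mul, mul_comm] at this
  unfold setWeight
  exact_mod_cast this

lemma card_le_setWeight {V : Type*} {wt : V → ℕ} (hwt : ∀ w, wt w = 1 ∨ wt w = 2)
    (S : Finset V) : (S.card : ℝ) ≤ setWeight wt S := by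
  have : S.card • 1 ≤ ∑ w ∈ S, wt w :=
    Finset.card_nsmul_le_sum _ _ _ fun w _ => by rcases hwt w with e | e <;> omega
  rw [smul_eq_mul, mul_one] at this
  unfold setWeight
  exact_mod_cast this

/-- A component that contains a neighbour of the colour costs at most the weights of these
neighbours. -/
lemma flipRate_mul_setWeight_le (hwt : ∀ w, wt w = 1 ∨ wt w = 2) {K : Finset V} {u : V}
    (hu : u ∈ K) (huN : u ∈ N) :
    flipRate L K e * setWeight wt K ≤ setWeight wt (K ∩ N) := by
  have h1 : (wt u : ℝ) ≤ setWeight wt (K ∩ N) := by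
    have := setWeight_mono wt (S := {u}) (T := K ∩ N) (by simp [hu, huN])
    simpa [setWeight] using this
  rcases le_or_gt (effectiveSize L e K) 6 with hs | hs
  · rw [flipRate_eq, (effectiveSize_eq_card hs).2]
    have h2 := setWeight_le_maxWeight hwt hu
    have h3 : (flipNum K.card * maxWeight K.card (wt u) : ℝ) ≤ 650 * wt u := by
      exact_mod_cast flipNum_mul_maxWeight_le K.card
        (by rw [← (effectiveSize_eq_card hs).2]; omega) (wt u)
        (by rcases hwt u with e | e <;> omega) (by rcases hwt u with e | e <;> omega)
    have h4 := mul_le_mul_of_nonneg_left h2 (Nat.cast_nonneg (α := ℝ) (flipNum K.card))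
    linarith
  · rw [flipRate_eq, flipNum_eq_zero hs]
    simpa using setWeight_nonneg wt _

/-- One half of the contribution of the two colours of `v`: the cost of the cluster of `v` in one
of the two colourings (`g`), of the components that are flipped on their own in the other one, and
of a null move (`z`). -/
lemma own_color_le (hwt : ∀ w, wt w = 1 ∨ wt w = 2) {E : Finset V → ℝ} {g z : ℝ}
    {𝒦' : Finset (Finset V)} (h𝒦 : 𝒦' ⊆ touching G σ v e c)
    (he : ∀ x ∈ e, x ∈ L v) (hz : z ≤ 0)
    (hzg : z + g ≤ setWeight wt (joined G σ v e c) - wt v)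
    (hE : ∀ K ∈ 𝒦', E K ≤ setWeight wt K)
    (hEg : ∀ K ∈ 𝒦', E K + g ≤ setWeight wt (joined G σ v e c) - setWeight wt K - wt v) :
    flipRate L (insert v (joined G σ v e c)) e * g + ∑ K ∈ 𝒦', flipRate L K e * E K + z ≤
      1933 / 650 * ∑ u ∈ colorNbrs G σ v c, (min (wt v) (wt u) : ℕ) - wt v := by
  set N := colorNbrs G σ v c with hNdef
  have hmeet : ∀ K ∈ touching G σ v e c, ∃ u ∈ K, u ∈ N := fun K hK => by
    obtain ⟨-, u, hu, hu'⟩ := mem_touching.1 hK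
    exact ⟨u, hu, mem_colorNbrs.2 hu'⟩
  rcases N.eq_empty_or_nonempty with hN | hN
  · have ht : touching G σ v e c = ∅ := by
      refine Finset.eq_empty_of_forall_notMem fun K hK => ?_
      obtain ⟨u, -, hu⟩ := hmeet K hK
      simp [hN] at hu
    have hj : joined G σ v e c = ∅ := by unfold joined; rw [ht]; rfl
    have hr : flipRate L (insert v (joined G σ v e c)) e = 1 := by
      rw [flipRate_insert notMem_joined he, hj]
      norm_num [effectiveSize, flipNum]
    rw [hr]
    rw [ht, Finset.subset_empty] at h𝒦
    rw [hj] at hzg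
    simp only [h𝒦, hN, Finset.sum_empty, setWeight] at hzg ⊢
    push_cast
    linarith
  set U := joined G σ v e c with hU
  -- The cluster of `v` costs at most `308 / 650` even if it is not paired with a component.
  have hcluster : flipRate L (insert v U) e * g + z ≤ 308 / 650 := by
    rw [flipRate_insert (U := U) notMem_joined he]
    rcases le_or_gt (effectiveSize L e U) 5 with hs | hs
    · have hcard := (effectiveSize_eq_card (Nat.le_succ_of_le hs)).2
      rw [hcard] at hs ⊢
      have h1 : ((flipNum (1 + U.card) * (2 * U.card) : ℕ) : ℝ) ≤ (308 : ℕ) :=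
        Nat.cast_le.2 (flipNum_succ_mul_le U.card (by omega))
      have h2 := setWeight_le_two_mul hwt U
      have h3 : (flipNum (1 + U.card) : ℝ) ≤ 650 := by exact_mod_cast flipNum_le _
      have h4 : (0 : ℝ) ≤ flipNum (1 + U.card) := Nat.cast_nonneg _
      have h5 : (0 : ℝ) ≤ wt v := Nat.cast_nonneg _
      push_cast at h1
      have h6 : (flipNum (1 + U.card) : ℝ) * (z + g) ≤ flipNum (1 + U.card) * (2 * U.card) :=
        mul_le_mul_of_nonneg_left (by linarith) h4
      nlinarith [mul_nonneg (sub_nonneg.2 h3) (neg_nonneg.2 hz)]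
    · rw [flipNum_eq_zero (by omega)]
      push_cast
      linarith
  have hcomps : ∑ K ∈ 𝒦', flipRate L K e * E K ≤ setWeight wt N := by
    calc ∑ K ∈ 𝒦', flipRate L K e * E K ≤ ∑ K ∈ 𝒦', setWeight wt (K ∩ N) := by
          refine Finset.sum_le_sum fun K hK => ?_
          obtain ⟨u, hu, huN⟩ := hmeet K (h𝒦 hK)
          exact (mul_le_mul_of_nonneg_left (hE K hK) (flipRate_nonneg _ _ _)).trans
            (flipRate_mul_setWeight_le hwt hu huN)
      _ = setWeight wt (𝒦'.biUnion fun K => K ∩ N) := by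
          refine (Finset.sum_biUnion fun K hK K' hK' hne => ?_).symm
          refine Finset.disjoint_left.2 fun u hu hu' => hne ?_
          exact eq_of_mem_restComponents (mem_touching.1 (h𝒦 hK)).1 (mem_touching.1 (h𝒦 hK')).1
            (Finset.mem_inter.1 hu).1 (Finset.mem_inter.1 hu').1
      _ ≤ setWeight wt N :=
          setWeight_mono wt (Finset.biUnion_subset.2 fun K _ => Finset.inter_subset_right)
  have hM1 : wt v = 1 → ((∑ u ∈ N, min (wt v) (wt u) : ℕ) : ℝ) = N.card := fun h1 => by
    rw [h1, Finset.card_eq_sum_ones]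
    exact congrArg _ (Finset.sum_congr rfl fun u _ => by rcases hwt u with e | e <;> simp [e])
  have hM2 : wt v = 2 → ((∑ u ∈ N, min (wt v) (wt u) : ℕ) : ℝ) = setWeight wt N := fun h2 => by
    rw [h2, setWeight, Nat.cast_sum]
    exact Finset.sum_congr rfl fun u _ => by rcases hwt u with e | e <;> simp [e]
  have hcs := card_le_setWeight hwt N
  have hsc := setWeight_le_two_mul hwt N
  have hN1 : (1 : ℝ) ≤ N.card := by exact_mod_cast hN.card_pos
  rcases 𝒦'.eq_empty_or_nonempty with hK | ⟨K, hK⟩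
  · rw [hK, Finset.sum_empty]
    rcases hwt v with hv | hv
    · rw [hM1 hv, hv]; push_cast; linarith
    · rw [hM2 hv, hv]; push_cast; linarith
  obtain hN2 | hN2 : N.card = 1 ∨ 2 ≤ N.card := by have := hN.card_pos; omega
  · obtain ⟨u, hu⟩ := Finset.card_eq_one.1 hN2
    have huK : ∀ K' ∈ touching G σ v e c, u ∈ K' := fun K' hK' => by
      obtain ⟨u', hu', hu''⟩ := hmeet K' hK'
      rw [hu, Finset.mem_singleton] at hu''
      exact hu'' ▸ hu'
    have hone : ∀ K' ∈ touching G σ v e c, K' = K := fun K' hK' =>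
      eq_of_mem_restComponents (mem_touching.1 hK').1 (mem_touching.1 (h𝒦 hK)).1 (huK K' hK')
        (huK K (h𝒦 hK))
    have h𝒦K : 𝒦' = {K} := Finset.eq_singleton_iff_unique_mem.2
      ⟨hK, fun K' hK' => hone K' (h𝒦 hK')⟩
    have hUK : U = K := by
      rw [hU, joined, Finset.eq_singleton_iff_unique_mem.2 ⟨h𝒦 hK, hone⟩]
      simp
    have h1 := hEg K hK
    have h2 := hE K hK
    have hvK : v ∉ K := notMem_of_mem_restComponents (mem_touching.1 (h𝒦 hK)).1
    rw [hUK, sub_self] at h1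
    rw [h𝒦K, Finset.sum_singleton, hUK, flipRate_insert hvK he, flipRate_eq]
    -- The cluster of `v` is paired with the only component.
    have h3 : flipNum (1 + effectiveSize L e K) / 650 * g
        + flipNum (effectiveSize L e K) / 650 * E K
        ≤ 513 / 650 * (wt u : ℝ) := by
      rcases le_or_gt (effectiveSize L e K) 6 with hs | hs
      · have hcard := (effectiveSize_eq_card hs).2
        rw [hcard] at hs ⊢
        have hpos : 1 ≤ K.card := Finset.card_pos.2 ⟨u, huK K (h𝒦 hK)⟩
        have h4 : (((flipNum K.card - flipNum (1 + K.card)) * maxWeight K.card (wt u) : ℕ) : ℝ)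
            ≤ (513 * wt u : ℕ) :=
          Nat.cast_le.2 (flipNum_sub_mul_maxWeight_le K.card (by omega) hpos (wt u)
            (by rcases hwt u with e | e <;> omega) (by rcases hwt u with e | e <;> omega))
        have hle : flipNum (1 + K.card) ≤ flipNum K.card := flipNum_anti hpos (by omega)
        push_cast [Nat.cast_sub hle] at h4
        have hle' : (flipNum (1 + K.card) : ℝ) ≤ flipNum K.card := by exact_mod_cast hle
        have h5 := setWeight_le_maxWeight hwt (huK K (h𝒦 hK))
        have h6 := mul_le_mul_of_nonneg_left (h2.trans h5) (sub_nonneg.2 hle')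
        have h7 : (flipNum (1 + K.card) : ℝ) * (E K + g) ≤ 0 :=
          mul_nonpos_of_nonneg_of_nonpos (Nat.cast_nonneg _) (by
            have : (0 : ℝ) ≤ wt v := Nat.cast_nonneg _
            linarith)
        nlinarith
      · rw [flipNum_eq_zero hs, flipNum_eq_zero (by omega)]
        simp only [Nat.cast_zero, zero_div, zero_mul, add_zero]
        positivity
    rw [hu, Finset.sum_singleton]
    rcases hwt u with e | e <;> rcases hwt v with e' | e' <;> rw [e] at h3 ⊢ <;> rw [e'] <;>
      norm_num at h3 ⊢ <;> linarith
  · have hN2' : (2 : ℝ) ≤ N.card := by exact_mod_cast hN2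
    rcases hwt v with hv | hv
    · rw [hM1 hv, hv]; push_cast; linarith
    · rw [hM2 hv, hv]; push_cast; linarith

/-- The contribution of the two colours of `v`, including the null move of `v` in `σ`. -/
theorem NeighborPair.pairTotal_own_add_le (h : NeighborPair L wt f σ τ v) :
    pairTotal G L wt f σ τ v s(σ v, τ v) + leftCost wt f σ τ v {v} s(σ v, σ v) ≤
      (1933 / 650 * ∑ u ∈ colorNbrs G σ v (σ v), (min (wt v) (wt u) : ℕ) - wt v)
      + (1933 / 650 * ∑ u ∈ colorNbrs G σ v (τ v), (min (wt v) (wt u) : ℕ) - wt v) := by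
  have he : ∀ x ∈ s(σ v, τ v), x ∈ L v := by
    intro x hx
    rcases Sym2.mem_iff.1 hx with rfl | rfl
    exacts [h.left_mem v, h.right_mem v]
  have hsub : ∀ {c : ℕ} {K}, K ∈ touching G σ v s(σ v, τ v) c →
      K ⊆ joined G σ v s(σ v, τ v) c := fun hK u hu => mem_joined.2 ⟨_, hK, hu⟩
  have hvK : ∀ {c : ℕ} {K}, K ∈ touching G σ v s(σ v, τ v) c → v ∉ K := fun hK =>
    notMem_of_mem_restComponents (touching_subset hK)
  have h1 := h.pairTotal_own_le (G := G)
  have h2 := own_color_le (G := G) (σ := σ) (v := v) (c := σ v)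
    (z := leftCost wt f σ τ v {v} s(σ v, σ v))
    (g := rightCost f τ (insert v (joined G σ v s(σ v, τ v) (σ v))) s(σ v, τ v))
    (E := fun S => leftCost wt f σ τ v S s(σ v, τ v))
    (𝒦' := touching G σ v s(σ v, τ v) (σ v) \ touching G σ v s(σ v, τ v) (τ v))
    h.weight Finset.sdiff_subset he h.left_null_le
    h.left_null_add_right_insert_le
    (fun K hK => h.left_le (hvK (Finset.mem_sdiff.1 hK).1))
    (fun K hK => h.left_add_right_insert_own_le notMem_joined (hsub (Finset.mem_sdiff.1 hK).1))
  have h3 := own_color_le (G := G) (σ := σ) (v := v) (c := τ v) (z := 0)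
    (g := leftCost wt f σ τ v (insert v (joined G σ v s(σ v, τ v) (τ v))) s(σ v, τ v))
    (E := fun S => rightCost f τ S s(σ v, τ v))
    (𝒦' := touching G σ v s(σ v, τ v) (τ v) \ touching G σ v s(σ v, τ v) (σ v))
    h.weight Finset.sdiff_subset he le_rfl
    (by rw [zero_add]; exact h.left_insert_own_le)
    (fun K _ => h.right_le)
    (fun K hK => by
      rw [add_comm]
      exact h.left_insert_own_add_right_le notMem_joined (hsub (Finset.mem_sdiff.1 hK).1))
  linarith

/-- The cost of all moves: the sum over the colours. -/
theorem NeighborPair.sum_pairTotal_le [DecidableRel G.Adj] (h : NeighborPair L wt f σ τ v)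
    (Λ : Finset ℕ) (hΛ : ∀ w, L w ⊆ Λ) :
    ∑ e ∈ Λ.sym2, pairTotal G L wt f σ τ v e ≤
      1933 / 650 * ∑ u ∈ G.neighborFinset v, (min (wt v) (wt u) : ℕ) - (L v).card * wt v := by
  set g : Sym2 ℕ → ℝ := pairTotal G L wt f σ τ v with hg
  set bd : ℕ → ℝ := fun c => 1933 / 650 * ∑ u ∈ colorNbrs G σ v c, (min (wt v) (wt u) : ℕ)
    - if c ∈ L v then (wt v : ℝ) else 0 with hbd
  have ha : σ v ∈ Λ := hΛ v (h.left_mem v)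
  have hb : τ v ∈ Λ.erase (σ v) := Finset.mem_erase.2 ⟨h.ne.symm, hΛ v (h.right_mem v)⟩
  have hsplit : ∑ e ∈ Λ.sym2, g e ≤ ∑ c ∈ Λ, g s(σ v, c) + ∑ c ∈ Λ.erase (σ v), g s(τ v, c) := by
    have hinj : ∀ x : ℕ, Set.InjOn (fun c => s(x, c)) (Set.univ : Set ℕ) :=
      fun x c _ c' _ hcc => Sym2.congr_right.1 hcc
    rw [← Finset.sum_image (f := g) (g := fun c => s(σ v, c)) ((hinj _).mono (Set.subset_univ _)),
      ← Finset.sum_image (f := g) (g := fun c => s(τ v, c)) ((hinj _).mono (Set.subset_univ _)),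
      ← Finset.sum_union]
    · have hsub : Λ.image (fun c => s(σ v, c)) ∪ (Λ.erase (σ v)).image (fun c => s(τ v, c))
          ⊆ Λ.sym2 := by
        intro e he
        rcases Finset.mem_union.1 he with he | he <;>
          obtain ⟨c, hc, rfl⟩ := Finset.mem_image.1 he
        · exact Finset.mk_mem_sym2_iff.2 ⟨ha, hc⟩
        · exact Finset.mk_mem_sym2_iff.2 ⟨Finset.mem_of_mem_erase hb, Finset.mem_of_mem_erase hc⟩
      rw [← Finset.sum_sdiff hsub]
      refine add_le_of_nonpos_left (Finset.sum_nonpos fun e he => ?_)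
      obtain ⟨he, hne⟩ := Finset.mem_sdiff.1 he
      have hσ : σ v ∉ e := by
        rintro ⟨c, rfl⟩
        exact hne (Finset.mem_union_left _
          (Finset.mem_image_of_mem _ (Finset.mk_mem_sym2_iff.1 he).2))
      refine h.pairTotal_le_of_notMem hσ ?_
      rintro ⟨c, rfl⟩
      exact hne (Finset.mem_union_right _ (Finset.mem_image_of_mem _ (Finset.mem_erase.2
        ⟨fun hc => hσ (hc ▸ Sym2.mem_mk_right _ _), (Finset.mk_mem_sym2_iff.1 he).2⟩)))
    · rw [Finset.disjoint_left]
      intro e he he'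
      obtain ⟨c, -, rfl⟩ := Finset.mem_image.1 he
      obtain ⟨c', hc', hcc⟩ := Finset.mem_image.1 he'
      have : σ v ∈ s(τ v, c') := hcc ▸ Sym2.mem_mk_left _ _
      rcases Sym2.mem_iff.1 this with h1 | h1
      · exact h.ne h1
      · exact Finset.ne_of_mem_erase hc' h1.symm
  have hown := h.pairTotal_own_add_le (G := G)
  have hA := h.pairTotal_left_diag_le (G := G)
  have hB := h.pairTotal_right_diag_le (G := G)
  have hbda : bd (σ v) =
      1933 / 650 * ∑ u ∈ colorNbrs G σ v (σ v), (min (wt v) (wt u) : ℕ) - wt v := by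
    rw [hbd]; simp only [if_pos (h.left_mem v)]
  have hbdb : bd (τ v) =
      1933 / 650 * ∑ u ∈ colorNbrs G σ v (τ v), (min (wt v) (wt u) : ℕ) - wt v := by
    rw [hbd]; simp only [if_pos (h.right_mem v)]
  have hrest : ∑ c ∈ (Λ.erase (σ v)).erase (τ v), g s(σ v, c)
      + ∑ c ∈ (Λ.erase (σ v)).erase (τ v), g s(τ v, c)
      ≤ ∑ c ∈ (Λ.erase (σ v)).erase (τ v), bd c := by
    rw [← Finset.sum_add_distrib]
    refine Finset.sum_le_sum fun c hc => ?_
    simp only [Finset.mem_erase] at hc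
    exact h.pairTotal_add_le (Ne.symm hc.2.1) (Ne.symm hc.1)
  have htot : ∑ e ∈ Λ.sym2, g e ≤ ∑ c ∈ Λ, bd c := by
    refine hsplit.trans ?_
    rw [← Finset.add_sum_erase Λ _ ha, ← Finset.add_sum_erase Λ bd ha,
      ← Finset.add_sum_erase _ _ hb, ← Finset.add_sum_erase _ bd hb,
      ← Finset.add_sum_erase _ (fun c => g s(τ v, c)) hb]
    linarith
  refine htot.trans_eq ?_
  rw [hbd, Finset.sum_sub_distrib, ← Finset.mul_sum, ← Finset.sum_filter, Finset.sum_const,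
    nsmul_eq_mul, Finset.filter_mem_eq_inter, Finset.inter_eq_right.2 (hΛ v)]
  congr 2
  rw [← Nat.cast_sum]
  congr 1
  rw [← Finset.sum_fiberwise_of_maps_to (s := G.neighborFinset v) (t := Λ) (g := σ)
    fun u _ => hΛ u (h.left_mem u)]
  refine Finset.sum_congr rfl fun c _ => Finset.sum_congr ?_ fun _ _ => rfl
  ext u
  simp [mem_colorNbrs]

end ColorBound

/-! ### The flip dynamics as an operator on functions -/

section Dynamics

variable {V : Type*} [Fintype V] [DecidableEq V] {G : SimpleGraph V} {L : V → Finset ℕ}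

/-- A list colouring as a function into `ℕ`. -/
def toFun {V : Type*} {L : V → Finset ℕ} (σ : ListColoring L) : V → ℕ := fun w => σ w

lemma toFun_injective {V : Type*} {L : V → Finset ℕ} :
    Function.Injective (toFun (L := L)) := fun σ τ h => by
  funext w
  exact Subtype.ext (congrFun h w)

lemma cluster_eq_component (G : SimpleGraph V) (σ : V → ℕ) (v : V) (c : ℕ) :
    cluster G σ v c = component G σ s(σ v, c) v := by
  ext w
  rw [cluster, Set.mem_ofPred_eq, alternatingGraph_eq_altPairGraph, Finset.mem_coe, mem_component]

lemma flipCluster_eq_flipOn (G : SimpleGraph V) (σ : V → ℕ) (v : V) (c : ℕ) :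
    flipCluster G σ v c = flipOn σ (component G σ s(σ v, c) v) s(σ v, c) := by
  funext w
  unfold flipCluster flipOn
  rw [cluster_eq_component]
  simp only [Finset.mem_coe]
  split_ifs <;> rfl

lemma isFlippable_iff (G : SimpleGraph V) (L : V → Finset ℕ) (σ : V → ℕ) (v : V) (c : ℕ) :
    IsFlippable G L σ v c ↔
      ∀ w ∈ component G σ s(σ v, c) v, ∀ x ∈ s(σ v, c), x ∈ L w := by
  unfold IsFlippable
  rw [cluster_eq_component]
  simp [Sym2.mem_iff]

lemma swapPair_mem {e : Sym2 ℕ} {x : ℕ} (hx : x ∈ e) : swapPair e x ∈ e := by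
  induction e with
  | h a b =>
    rcases Sym2.mem_iff.1 hx with rfl | rfl
    · rw [swapPair_left]; exact Sym2.mem_mk_right _ _
    · rw [swapPair_right]; exact Sym2.mem_mk_left _ _

lemma swapPair_of_notMem {e : Sym2 ℕ} {x : ℕ} (hx : x ∉ e) : swapPair e x = x := by
  induction e with
  | h a b =>
    rw [Sym2.mem_iff, not_or] at hx
    exact Equiv.swap_apply_of_ne_of_ne hx.1 hx.2

lemma swapPair_swapPair (e : Sym2 ℕ) (x : ℕ) : swapPair e (swapPair e x) = x := by
  induction e with
  | h a b => exact Equiv.swap_apply_self a b x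

lemma exists_toFun_eq_flipOn (σ : ListColoring L) (v : V) (c : ℕ)
    (h : IsFlippable G L (toFun σ) v c) :
    ∃ τ : ListColoring L,
      toFun τ = flipOn (toFun σ) (component G (toFun σ) s(toFun σ v, c) v) s(toFun σ v, c) := by
  rw [isFlippable_iff] at h
  refine ⟨fun w => ⟨flipOn (toFun σ) (component G (toFun σ) s(toFun σ v, c) v)
    s(toFun σ v, c) w, ?_⟩, rfl⟩
  by_cases hw : w ∈ component G (toFun σ) s(toFun σ v, c) v
  · rw [flipOn_of_mem hw]
    exact h w hw _ (swapPair_mem (color_mem_of_mem_component (Sym2.mem_mk_left _ _) hw))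
  · rw [flipOn_of_notMem hw]
    exact (σ w).2

/-- The expectation of a function after the move for `(v, c)`. -/
lemma sum_flipMove_mul (σ : ListColoring L) (v : V) (c : ℕ) (f : (V → ℕ) → ℝ) :
    ∑ τ, flipMove G L flipProb σ v c τ * f (toFun τ) = f (toFun σ)
      + flipRate L (component G (toFun σ) s(toFun σ v, c) v) s(toFun σ v, c)
        / (component G (toFun σ) s(toFun σ v, c) v).card
        * (f (flipOn (toFun σ) (component G (toFun σ) s(toFun σ v, c) v) s(toFun σ v, c))
          - f (toFun σ)) := by
  classical
  have hstay : ∀ p : ℝ, ∑ τ : ListColoring L, p * (if τ = σ then 1 else 0) * f (toFun τ)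
      = p * f (toFun σ) := fun p => by simp
  by_cases h : IsFlippable G L (toFun σ) v c
  · obtain ⟨τ₀, hτ₀⟩ := exists_toFun_eq_flipOn σ v c h
    have hr : flipRate L (component G (toFun σ) s(toFun σ v, c) v) s(toFun σ v, c)
        = flipProb (component G (toFun σ) s(toFun σ v, c) v).card :=
      if_pos ((isFlippable_iff _ _ _ _ _).1 h)
    have hm : ∀ τ, flipMove G L flipProb σ v c τ
        = flipProb (component G (toFun σ) s(toFun σ v, c) v).card
            / (component G (toFun σ) s(toFun σ v, c) v).card * (if τ = τ₀ then 1 else 0)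
          + (1 - flipProb (component G (toFun σ) s(toFun σ v, c) v).card
            / (component G (toFun σ) s(toFun σ v, c) v).card) * (if τ = σ then 1 else 0) := by
      intro τ
      have e1 : ((fun w => (τ w : ℕ)) = flipCluster G (fun w => (σ w : ℕ)) v c) ↔ τ = τ₀ := by
        change toFun τ = flipCluster G (toFun σ) v c ↔ _
        rw [flipCluster_eq_flipOn, ← hτ₀]
        exact toFun_injective.eq_iff
      unfold flipMove
      change (if IsFlippable G L (toFun σ) v c then _ else _) = _
      rw [if_pos h]
      simp only [e1]
      change flipProb (cluster G (toFun σ) v c).ncard / (cluster G (toFun σ) v c).ncard * _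
        + (1 - flipProb (cluster G (toFun σ) v c).ncard / (cluster G (toFun σ) v c).ncard) * _ = _
      rw [cluster_eq_component, Set.ncard_coe_finset]
      congr
    simp only [hm, add_mul, Finset.sum_add_distrib, hstay]
    rw [hr, ← hτ₀]
    simp only [mul_ite, mul_one, mul_zero, ite_mul, zero_mul, Finset.sum_ite_eq',
      Finset.mem_univ, if_true]
    ring
  · have hr : flipRate L (component G (toFun σ) s(toFun σ v, c) v) s(toFun σ v, c) = 0 :=
      if_neg fun h' => h ((isFlippable_iff _ _ _ _ _).2 h')
    have hm : ∀ τ, flipMove G L flipProb σ v c τ = 1 * if τ = σ then 1 else 0 := by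
      intro τ
      unfold flipMove
      change (if IsFlippable G L (toFun σ) v c then _ else _) = _
      rw [if_neg h, one_mul]
      congr
    simp only [hm, hstay, hr]
    ring

/-- The expectation of a function after one step. -/
lemma flipDynamics_mulVec [Nonempty V] {k : ℕ} (hk : 0 < k) (hL : ∀ w, (L w).card = k)
    (σ : ListColoring L) (f : (V → ℕ) → ℝ) :
    (Matrix.mulVec (flipDynamics G L flipProb) fun τ => f (toFun τ)) σ = f (toFun σ)
      + (Fintype.card V * k : ℝ)⁻¹ * ∑ w, ∑ c ∈ L w,
        flipRate L (component G (toFun σ) s(toFun σ w, c) w) s(toFun σ w, c)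
          / (component G (toFun σ) s(toFun σ w, c) w).card
          * (f (flipOn (toFun σ) (component G (toFun σ) s(toFun σ w, c) w) s(toFun σ w, c))
            - f (toFun σ)) := by
  have hm : (Fintype.card V : ℝ) ≠ 0 := by exact_mod_cast Fintype.card_ne_zero
  have hk' : (k : ℝ) ≠ 0 := by exact_mod_cast hk.ne'
  have h1 : (Matrix.mulVec (flipDynamics G L flipProb) fun τ => f (toFun τ)) σ
      = (Fintype.card V : ℝ)⁻¹ * ∑ w, (k : ℝ)⁻¹ * ∑ c ∈ L w,
        ∑ τ, flipMove G L flipProb σ w c τ * f (toFun τ) := by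
    unfold Matrix.mulVec dotProduct flipDynamics
    simp only [Matrix.of_apply, hL, Finset.mul_sum, Finset.sum_mul]
    rw [Finset.sum_comm]
    refine Finset.sum_congr rfl fun w _ => ?_
    rw [Finset.sum_comm]
    exact Finset.sum_congr rfl fun c _ => Finset.sum_congr rfl fun τ _ => by ring
  rw [h1]
  simp only [sum_flipMove_mul, Finset.sum_add_distrib, Finset.sum_const, hL, nsmul_eq_mul,
    mul_add, Finset.card_univ, ← Finset.mul_sum]
  field_simp

lemma flipRate_div_card_le_one (S : Finset V) (e : Sym2 ℕ) : flipRate L S e / S.card ≤ 1 := by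
  rcases S.card.eq_zero_or_pos with h | h
  · simp [h]
  · have h1 : (1 : ℝ) ≤ S.card := by exact_mod_cast h
    rw [div_le_one (by linarith)]
    exact (flipRate_le_one _ _ _).trans h1

/-- One step brings the expectations of a `1`-Lipschitz function from two colourings that differ
at one vertex closer together. -/
theorem NeighborPair.mulVec_sub_le [Nonempty V] [DecidableRel G.Adj] {k : ℕ} (hk : 0 < k)
    (hL : ∀ w, (L w).card = k) {wt : V → ℕ} {f : (V → ℕ) → ℝ} {σ τ : ListColoring L} {v : V}
    (h : NeighborPair L wt f (toFun σ) (toFun τ) v) {ε : ℝ}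
    (hε : 1933 / 650 * ∑ u ∈ G.neighborFinset v, (min (wt v) (wt u) : ℕ)
      ≤ (1 - ε) * k * wt v) :
    (Matrix.mulVec (flipDynamics G L flipProb) fun τ => f (toFun τ)) σ
      - (Matrix.mulVec (flipDynamics G L flipProb) fun τ => f (toFun τ)) τ
      ≤ (1 - ε / Fintype.card V) * wt v := by
  rw [flipDynamics_mulVec hk hL, flipDynamics_mulVec hk hL]
  set s := toFun σ
  set t := toFun τ
  have hm : (0 : ℝ) < Fintype.card V := by exact_mod_cast Fintype.card_pos
  have hk' : (0 : ℝ) < k := by exact_mod_cast hk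
  have hΛ : ∀ w, L w ⊆ Finset.univ.biUnion L := fun w =>
    Finset.subset_biUnion_of_mem L (Finset.mem_univ w)
  have hE : ∀ ρ : V → ℕ, (∀ w, ρ w ∈ L w) → ∀ w, ∀ c ∈ L w,
      s(ρ w, c) ∈ (Finset.univ.biUnion L).sym2 := fun ρ hρ w c hc =>
    Finset.mk_mem_sym2_iff.2 ⟨hΛ w (hρ w), hΛ w hc⟩
  have hT := h.sum_pairTotal_le (G := G) _ hΛ
  unfold pairTotal at hT
  rw [Finset.sum_add_distrib, ← sum_slots_eq G L s _ (hE s h.left_mem),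
    ← sum_slots_eq G L t _ (hE t h.right_mem), hL] at hT
  set q : (V → ℕ) → V → ℕ → ℝ := fun ρ w c =>
    flipRate L (component G ρ s(ρ w, c) w) s(ρ w, c) / (component G ρ s(ρ w, c) w).card with hq
  set F : (V → ℕ) → V → ℕ → ℝ := fun ρ w c =>
    f (flipOn ρ (component G ρ s(ρ w, c) w) s(ρ w, c)) with hF
  change _ ≤ _ at hT
  have hT' : ∑ w, ∑ c ∈ L w, q s w c * (F s w c - wt v - f t)
      + ∑ w, ∑ c ∈ L w, q t w c * (f t - F t w c) ≤ _ := hT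
  change f s + (Fintype.card V * k : ℝ)⁻¹ * ∑ w, ∑ c ∈ L w, q s w c * (F s w c - f s)
    - (f t + (Fintype.card V * k : ℝ)⁻¹ * ∑ w, ∑ c ∈ L w, q t w c * (F t w c - f t)) ≤ _
  -- Replacing `f s` by `f t + wt v` costs at most the total rate, hence at most `m k`, times the
  -- difference of the two.
  have e1 : ∑ w, ∑ c ∈ L w, q s w c * (F s w c - f s)
      = ∑ w, ∑ c ∈ L w, q s w c * (F s w c - wt v - f t)
        + (∑ w, ∑ c ∈ L w, q s w c) * (wt v - (f s - f t)) := by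
    simp only [Finset.sum_mul, ← Finset.sum_add_distrib]
    exact Finset.sum_congr rfl fun w _ => Finset.sum_congr rfl fun c _ => by ring
  have e2 : ∑ w, ∑ c ∈ L w, q t w c * (F t w c - f t)
      = - ∑ w, ∑ c ∈ L w, q t w c * (f t - F t w c) := by
    simp only [← Finset.sum_neg_distrib]
    exact Finset.sum_congr rfl fun w _ => Finset.sum_congr rfl fun c _ => by ring
  have e3 : ∑ w, ∑ c ∈ L w, q s w c ≤ Fintype.card V * k := by
    calc ∑ w, ∑ c ∈ L w, q s w c ≤ ∑ w, ∑ c ∈ L w, (1 : ℝ) :=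
          Finset.sum_le_sum fun w _ => Finset.sum_le_sum fun c _ => flipRate_div_card_le_one _ _
      _ = Fintype.card V * k := by simp [hL]
  have e4 : 0 ≤ wt v - (f s - f t) := by
    have := h.le_setWeight (x := s) (y := t) {v} fun w hw => h.agree w (by simpa using hw)
    simp only [setWeight, Finset.sum_singleton] at this
    linarith
  have e5 := mul_le_mul_of_nonneg_right e3 e4
  have e6 : (Fintype.card V * k : ℝ) * (wt v - ε / Fintype.card V * wt v)
      = Fintype.card V * k * wt v - ε * k * wt v := by
    field_simp
  have e7 : (∑ w, ∑ c ∈ L w, q s w c * (F s w c - f s))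
      - (∑ w, ∑ c ∈ L w, q t w c * (F t w c - f t))
      ≤ (Fintype.card V * k : ℝ) * (wt v - ε / Fintype.card V * wt v)
        - (Fintype.card V * k : ℝ) * (f s - f t) := by
    rw [e6]
    linarith
  have hmk : (0 : ℝ) < Fintype.card V * k := mul_pos hm hk'
  have e8 := mul_le_mul_of_nonneg_left e7 (inv_nonneg.2 hmk.le)
  rw [← mul_sub, inv_mul_cancel_left₀ hmk.ne', mul_sub] at e8
  linarith

/-! ### Contraction in the weighted Hamming distance -/

lemma weightedDist_triangle {V : Type*} [Fintype V] (wt : V → ℕ) (x y z : V → ℕ) :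
    weightedDist wt x z ≤ weightedDist wt x y + weightedDist wt y z := by
  classical
  unfold weightedDist
  rw [← Finset.sum_union_inter]
  refine le_add_of_le_of_nonneg (Finset.sum_le_sum_of_subset_of_nonneg (fun w hw => ?_)
    fun _ _ _ => Nat.cast_nonneg _) (Finset.sum_nonneg fun _ _ => Nat.cast_nonneg _)
  simp only [Finset.mem_filter, Finset.mem_univ, true_and, Finset.mem_union] at hw ⊢
  by_contra! hcon
  exact hw (hcon.1.trans hcon.2)

lemma weightedDist_nonneg {V : Type*} [Fintype V] (wt : V → ℕ) (x y : V → ℕ) :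
    0 ≤ weightedDist wt x y := Finset.sum_nonneg fun _ _ => Nat.cast_nonneg _

lemma weightedDist_self {V : Type*} [Fintype V] (wt : V → ℕ) (x : V → ℕ) :
    weightedDist wt x x = 0 := by simp [weightedDist]

lemma weightedDist_comm {V : Type*} [Fintype V] (wt : V → ℕ) (x y : V → ℕ) :
    weightedDist wt x y = weightedDist wt y x := by simp only [weightedDist, ne_comm]

/-- A Lipschitz function on the `L`-colourings extends to a Lipschitz function on all maps. -/
lemma exists_lipschitz_extension {V : Type*} [Fintype V] {L : V → Finset ℕ}
    [Finite (ListColoring L)] [Nonempty (ListColoring L)] (wt : V → ℕ) (f : ListColoring L → ℝ)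
    (hf : ∀ σ τ, f σ - f τ ≤ weightedDist wt (toFun σ) (toFun τ)) :
    ∃ F : (V → ℕ) → ℝ, (∀ x y, F x - F y ≤ weightedDist wt x y) ∧ ∀ σ, F (toFun σ) = f σ := by
  have hb : ∀ x : V → ℕ,
      BddBelow (Set.range fun σ : ListColoring L => f σ + weightedDist wt (toFun σ) x) :=
    fun x => (Set.finite_range _).bddBelow
  refine ⟨fun x => ⨅ σ : ListColoring L, (f σ + weightedDist wt (toFun σ) x), fun x y => ?_,
    fun σ => le_antisymm ?_ ?_⟩
  · rw [sub_le_iff_le_add, add_comm, ← sub_le_iff_le_add]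
    refine le_ciInf fun σ => ?_
    have h1 := ciInf_le (hb x) σ
    have h2 := weightedDist_triangle wt (toFun σ) y x
    rw [weightedDist_comm wt y x] at h2
    linarith
  · have := ciInf_le (hb (toFun σ)) σ
    simpa [weightedDist_self] using this
  · refine le_ciInf fun τ => ?_
    have := hf σ τ
    rw [weightedDist_comm] at this
    linarith

/-- A bound for colourings that differ at one vertex gives a bound for all pairs: change the
vertices one after the other. -/
lemma sub_le_of_neighbors {wt : V → ℕ} {g : ListColoring L → ℝ} {r : ℝ}
    (hg : ∀ σ τ v, (∀ w, w ≠ v → σ w = τ w) → σ v ≠ τ v → g σ - g τ ≤ r * wt v)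
    (σ τ : ListColoring L) : g σ - g τ ≤ r * weightedDist wt (toFun σ) (toFun τ) := by
  have key : ∀ s : Finset V, g (s.piecewise σ τ) - g τ
      ≤ r * ∑ w ∈ s with toFun σ w ≠ toFun τ w, (wt w : ℝ) := by
    intro s
    induction s using Finset.induction_on with
    | empty => simp
    | insert j s hj ih =>
      rw [Finset.piecewise_insert, Finset.filter_insert]
      by_cases hστ : toFun σ j = toFun τ j
      · have : Function.update (s.piecewise σ τ) j (σ j) = s.piecewise σ τ := by
          rw [Function.update_eq_self_iff, Finset.piecewise_eq_of_notMem _ _ _ hj]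
          exact Subtype.ext hστ
        rw [this, if_neg (not_not.2 hστ)]
        exact ih
      · rw [if_pos hστ, Finset.sum_insert (by simp [hj]), mul_add]
        have := hg (Function.update (s.piecewise σ τ) j (σ j)) (s.piecewise σ τ) j
          (fun w hw => Function.update_of_ne hw _ _) (by
            rw [Function.update_self, Finset.piecewise_eq_of_notMem _ _ _ hj]
            exact fun h => hστ (congrArg Subtype.val h))
        linarith
  have := key Finset.univ
  rwa [Finset.piecewise_univ] at this

/-- One step contracts: the expectation of a `C`-Lipschitz function is `(1 - ε / m) C`-Lipschitz,
where `m` is the number of vertices. -/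
theorem flipDynamics_contraction [Nonempty V] [DecidableRel G.Adj] {k : ℕ} (hk : 0 < k)
    (hL : ∀ w, (L w).card = k) {wt : V → ℕ} (hwt : ∀ w, wt w = 1 ∨ wt w = 2) {ε : ℝ}
    (hε : ∀ v, 1933 / 650 * ∑ u ∈ G.neighborFinset v, (min (wt v) (wt u) : ℕ)
      ≤ (1 - ε) * k * wt v)
    {C : ℝ} (hC : 0 < C) (f : ListColoring L → ℝ)
    (hf : ∀ σ τ, f σ - f τ ≤ C * weightedDist wt (toFun σ) (toFun τ)) (σ τ : ListColoring L) :
    Matrix.mulVec (flipDynamics G L flipProb) f σ - Matrix.mulVec (flipDynamics G L flipProb) f τ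
      ≤ (1 - ε / Fintype.card V) * C * weightedDist wt (toFun σ) (toFun τ) := by
  have : Nonempty (ListColoring L) := ⟨σ⟩
  obtain ⟨F, hF, hFf⟩ := exists_lipschitz_extension wt (fun σ => C⁻¹ * f σ) fun σ τ => by
    rw [← mul_sub, inv_mul_le_iff₀ hC]
    exact hf σ τ
  refine sub_le_of_neighbors (fun σ τ v hagree hne => ?_) σ τ
  have hpair : NeighborPair L wt F (toFun σ) (toFun τ) v :=
    ⟨fun w hw => congrArg Subtype.val (hagree w hw), fun h => hne (Subtype.ext h),
      fun w => (σ w).2, fun w => (τ w).2, hwt, hF⟩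
  have h1 := hpair.mulVec_sub_le hk hL (hε v)
  have h2 : (fun τ : ListColoring L => F (toFun τ)) = C⁻¹ • f := by
    funext τ
    exact hFf τ
  rw [h2, Matrix.mulVec_smul, Pi.smul_apply, Pi.smul_apply, smul_eq_mul, smul_eq_mul, ← mul_sub,
    inv_mul_le_iff₀ hC] at h1
  linarith

end Dynamics

/-! ### Stationarity of the uniform distribution on proper colourings -/

section Stationary

variable {V : Type*} [Fintype V] [DecidableEq V] {G : SimpleGraph V} {L : V → Finset ℕ}

lemma flipOn_mem_iff {V : Type*} [DecidableEq V] {σ : V → ℕ} {S : Finset V} {e : Sym2 ℕ}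
    (w : V) :
    flipOn σ S e w ∈ e ↔ σ w ∈ e := by
  by_cases hw : w ∈ S
  · rw [flipOn_of_mem hw]
    refine ⟨fun h => ?_, swapPair_mem⟩
    have := swapPair_mem h
    rwa [swapPair_swapPair] at this
  · rw [flipOn_of_notMem hw]

lemma flipOn_flipOn {V : Type*} [DecidableEq V] {σ : V → ℕ} {e : Sym2 ℕ} (S : Finset V) :
    flipOn (flipOn σ S e) S e = σ := by
  funext w
  by_cases hw : w ∈ S
  · rw [flipOn_of_mem hw, flipOn_of_mem hw, swapPair_swapPair]
  · rw [flipOn_of_notMem hw, flipOn_of_notMem hw]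

lemma eq_mk_of_mem {e : Sym2 ℕ} {x y : ℕ} (hx : x ∈ e) (hy : y ∈ e) (hne : x ≠ y) :
    s(x, y) = e := ((Sym2.mem_and_mem_iff hne).1 ⟨hx, hy⟩).symm

variable {σ : V → ℕ} {e : Sym2 ℕ} {v : V}

/-- Adjacent vertices with colours of the pair lie in the same component, so that flipping a
component keeps a proper colouring proper. -/
lemma mem_component_iff_of_adj (hσ : ∀ u w, G.Adj u w → σ u ≠ σ w) {u w : V} (h : G.Adj u w)
    (hu : σ u ∈ e) (hw : σ w ∈ e) : u ∈ component G σ e v ↔ w ∈ component G σ e v := by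
  have hadj : (altPairGraph G σ e).Adj u w :=
    ⟨h, hσ u w h, eq_mk_of_mem hu hw (hσ u w h)⟩
  rw [mem_component, mem_component]
  exact ⟨fun h' => h'.trans hadj.reachable, fun h' => h'.trans hadj.symm.reachable⟩

lemma flipOn_proper (hσ : ∀ u w, G.Adj u w → σ u ≠ σ w) (u w : V) (h : G.Adj u w) :
    flipOn σ (component G σ e v) e u ≠ flipOn σ (component G σ e v) e w := by
  by_cases hu : σ u ∈ e
  · by_cases hw : σ w ∈ e
    · have hiff := mem_component_iff_of_adj (v := v) hσ h hu hw
      unfold flipOn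
      split_ifs with h1 h2 h2
      · exact fun h' => hσ u w h ((swapPair e).injective h')
      · exact absurd (hiff.1 h1) h2
      · exact absurd (hiff.2 h2) h1
      · exact hσ u w h
    · intro h'
      exact hw ((flipOn_mem_iff w).1 (h' ▸ (flipOn_mem_iff u).2 hu))
  · by_cases hw : σ w ∈ e
    · intro h'
      exact hu ((flipOn_mem_iff u).1 (h' ▸ (flipOn_mem_iff w).2 hw))
    · have key : ∀ x, σ x ∉ e → flipOn σ (component G σ e v) e x = σ x := fun x hx => by
        unfold flipOn
        rw [swapPair_of_notMem hx, ite_self]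
      rw [key u hu, key w hw]
      exact hσ u w h

/-- Flipping a component of a proper colouring does not change the alternating graph. -/
lemma altPairGraph_flipOn (hσ : ∀ u w, G.Adj u w → σ u ≠ σ w) :
    altPairGraph G (flipOn σ (component G σ e v) e) e = altPairGraph G σ e := by
  have hτ := fun u w h => flipOn_proper (G := G) (σ := σ) (e := e) (v := v) hσ u w h
  ext u w
  simp only [altPairGraph]
  constructor
  · rintro ⟨h, -, he⟩
    have hu := (flipOn_mem_iff (σ := σ) u).1 (he.subst (motive := fun e' =>
      flipOn σ (component G σ e v) e u ∈ e') (Sym2.mem_mk_left _ _))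
    have hw := (flipOn_mem_iff (σ := σ) w).1 (he.subst (motive := fun e' =>
      flipOn σ (component G σ e v) e w ∈ e') (Sym2.mem_mk_right _ _))
    exact ⟨h, hσ u w h, eq_mk_of_mem hu hw (hσ u w h)⟩
  · rintro ⟨h, -, he⟩
    have hu : σ u ∈ e := he ▸ Sym2.mem_mk_left _ _
    have hw : σ w ∈ e := he ▸ Sym2.mem_mk_right _ _
    exact ⟨h, hτ u w h, eq_mk_of_mem ((flipOn_mem_iff u).2 hu) ((flipOn_mem_iff w).2 hw)
      (hτ u w h)⟩

open Classical in
lemma flipMove_eq_of_ne {σ τ : ListColoring L} (hne : τ ≠ σ) (v : V) (c : ℕ) :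
    flipMove G L flipProb σ v c τ =
      if toFun τ = flipOn (toFun σ) (component G (toFun σ) s(toFun σ v, c) v) s(toFun σ v, c)
      then flipRate L (component G (toFun σ) s(toFun σ v, c) v) s(toFun σ v, c)
        / (component G (toFun σ) s(toFun σ v, c) v).card else 0 := by
  have hpt := sum_flipMove_mul (G := G) σ v c (fun x => if x = toFun τ then 1 else 0)
  have hsum : ∑ ρ, flipMove G L flipProb σ v c ρ * (if toFun ρ = toFun τ then 1 else 0)
      = flipMove G L flipProb σ v c τ := by
    simp [toFun_injective.eq_iff]
  rw [hsum, if_neg fun h => hne (toFun_injective h).symm] at hpt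
  rw [hpt]
  simp only [eq_comm (a := toFun τ)]
  split_ifs <;> ring

/-- A move to another colouring that is selected at `v` gives `v` the selected colour. -/
lemma flipMove_eq_zero {σ τ : ListColoring L} (hne : τ ≠ σ) {v : V} {c : ℕ} (hc : c ≠ toFun τ v) :
    flipMove G L flipProb σ v c τ = 0 := by
  rw [flipMove_eq_of_ne hne, if_neg]
  intro h
  have := congrFun h v
  rw [flipOn_of_mem self_mem_component, swapPair_left] at this
  exact hc this.symm

/-- The flip dynamics is reversible on the proper colourings: the reverse of the move of `v` to its
new colour is the move of `v` to its old colour. -/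
lemma flipMove_symm {σ τ : ListColoring L} (hne : τ ≠ σ)
    (hσ : IsProperListColoring G σ) (hτ : IsProperListColoring G τ) (v : V) :
    flipMove G L flipProb σ v (τ v) τ = flipMove G L flipProb τ v (σ v) σ := by
  have key : ∀ {σ τ : ListColoring L}, IsProperListColoring G σ →
      toFun τ = flipOn (toFun σ) (component G (toFun σ) s(toFun σ v, toFun τ v) v)
        s(toFun σ v, toFun τ v) →
      component G (toFun τ) s(toFun τ v, toFun σ v) v
        = component G (toFun σ) s(toFun σ v, toFun τ v) v ∧
      toFun σ = flipOn (toFun τ) (component G (toFun τ) s(toFun τ v, toFun σ v) v)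
        s(toFun τ v, toFun σ v) := by
    intro σ τ hσ h
    have hcomp : component G (toFun τ) s(toFun τ v, toFun σ v) v
        = component G (toFun σ) s(toFun σ v, toFun τ v) v := by
      unfold component
      rw [Sym2.eq_swap (a := toFun τ v)]
      have := altPairGraph_flipOn (σ := toFun σ) (v := v) (e := s(toFun σ v, toFun τ v)) hσ
      rw [← h] at this
      rw [this]
    refine ⟨hcomp, ?_⟩
    rw [hcomp, Sym2.eq_swap (a := toFun τ v)]
    have := flipOn_flipOn (σ := toFun σ) (e := s(toFun σ v, toFun τ v))
      (component G (toFun σ) s(toFun σ v, toFun τ v) v)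
    rw [← h] at this
    exact this.symm
  change flipMove G L flipProb σ v (toFun τ v) τ = flipMove G L flipProb τ v (toFun σ v) σ
  rw [flipMove_eq_of_ne hne, flipMove_eq_of_ne hne.symm]
  split_ifs with h1 h2 h2
  · rw [(key hσ h1).1, Sym2.eq_swap (a := toFun τ v)]
  · exact absurd (key hσ h1).2 h2
  · exact absurd (key hτ h2).2 h1
  · rfl

lemma flipDynamics_symm {σ τ : ListColoring L}
    (hσ : IsProperListColoring G σ) (hτ : IsProperListColoring G τ) :
    flipDynamics G L flipProb σ τ = flipDynamics G L flipProb τ σ := by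
  rcases eq_or_ne τ σ with rfl | hne
  · rfl
  have key : ∀ {σ τ : ListColoring L} (_ : τ ≠ σ) (v : V),
      ∑ c ∈ L v, flipMove G L flipProb σ v c τ = flipMove G L flipProb σ v (τ v) τ := by
    intro σ τ hne v
    exact Finset.sum_eq_single_of_mem _ (τ v).2 fun c _ hc => flipMove_eq_zero hne hc
  unfold flipDynamics
  simp only [Matrix.of_apply, key hne, key hne.symm, flipMove_symm hne hσ hτ]

/-- A proper colouring never moves to an improper one. -/
lemma flipDynamics_eq_zero {σ τ : ListColoring L}
    (hσ : IsProperListColoring G σ) (hτ : ¬ IsProperListColoring G τ) :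
    flipDynamics G L flipProb σ τ = 0 := by
  have hne : τ ≠ σ := fun h => hτ (h ▸ hσ)
  unfold flipDynamics
  rw [Matrix.of_apply]
  refine mul_eq_zero_of_right _ (Finset.sum_eq_zero fun v _ => mul_eq_zero_of_right _
    (Finset.sum_eq_zero fun c _ => ?_))
  rw [flipMove_eq_of_ne hne, if_neg]
  intro h
  refine hτ fun u w huw => ?_
  have := flipOn_proper (σ := toFun σ) (v := v) (e := s(toFun σ v, c)) hσ u w huw
  rw [← h] at this
  exact this

lemma sum_flipDynamics [Nonempty V] {k : ℕ} (hk : 0 < k) (hL : ∀ w, (L w).card = k)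
    (σ : ListColoring L) : ∑ τ, flipDynamics G L flipProb σ τ = 1 := by
  have := flipDynamics_mulVec (G := G) hk hL σ fun _ => 1
  simpa [Matrix.mulVec, dotProduct] using this

/-- The greedy algorithm: a proper colouring exists if every list is longer than the degree. -/
lemma exists_properListColoring [DecidableRel G.Adj] (h : ∀ v, G.degree v < (L v).card) :
    ∃ σ : ListColoring L, IsProperListColoring G σ := by
  have key : ∀ s : Finset V, ∃ σ : ListColoring L,
      ∀ u ∈ s, ∀ w ∈ s, G.Adj u w → (σ u : ℕ) ≠ σ w := by
    intro s
    induction s using Finset.induction_on with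
    | empty =>
      have : ∀ v, ∃ c, c ∈ L v := fun v =>
        Finset.card_pos.1 (by have := h v; omega)
      choose σ hσ using this
      exact ⟨fun v => ⟨σ v, hσ v⟩, by simp⟩
    | insert j s hj ih =>
      obtain ⟨σ, hσ⟩ := ih
      obtain ⟨c, hc, hcn⟩ : ∃ c ∈ L j, c ∉ (G.neighborFinset j).image (toFun σ) := by
        refine Finset.exists_mem_notMem_of_card_lt_card (Finset.card_image_le.trans_lt ?_)
        rw [SimpleGraph.card_neighborFinset_eq_degree]
        exact h j
      have hcn' : ∀ u, G.Adj j u → toFun σ u ≠ c := fun u hu hcu =>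
        hcn (Finset.mem_image.2 ⟨u, by simpa using hu, hcu⟩)
      refine ⟨Function.update σ j ⟨c, hc⟩, fun u hu w hw huw => ?_⟩
      by_cases huj : u = j
      · subst huj
        rw [Function.update_self, Function.update_of_ne huw.ne']
        exact (hcn' w huw).symm
      · rw [Function.update_of_ne huj]
        by_cases hwj : w = j
        · subst hwj
          rw [Function.update_self]
          exact hcn' u huw.symm
        · rw [Function.update_of_ne hwj]
          exact hσ u (Finset.mem_of_mem_insert_of_ne hu huj) w
            (Finset.mem_of_mem_insert_of_ne hw hwj) huw
  obtain ⟨σ, hσ⟩ := key Finset.univ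
  exact ⟨σ, fun u w huw => hσ u (Finset.mem_univ _) w (Finset.mem_univ _) huw⟩

theorem isStationaryDist_uniformProper [Nonempty V] {k : ℕ} (hk : 0 < k)
    (hL : ∀ w, (L w).card = k) (hex : ∃ σ : ListColoring L, IsProperListColoring G σ) :
    IsStationaryDist (flipDynamics G L flipProb) (uniformProper G L) := by
  classical
  obtain ⟨σ₀, hσ₀⟩ := hex
  have hpos : 0 < Nat.card {τ : ListColoring L // IsProperListColoring G τ} := by
    have : Nonempty {τ : ListColoring L // IsProperListColoring G τ} := ⟨⟨σ₀, hσ₀⟩⟩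
    exact Nat.card_pos
  refine ⟨fun σ => ?_, ?_, ?_⟩
  · unfold uniformProper
    split_ifs
    · positivity
    · exact le_rfl
  · unfold uniformProper
    rw [← Finset.sum_filter, Finset.sum_const, nsmul_eq_mul]
    have : (Finset.univ.filter fun σ : ListColoring L => IsProperListColoring G σ).card
        = Nat.card {τ : ListColoring L // IsProperListColoring G τ} := by
      rw [Nat.card_eq_fintype_card, Fintype.card_subtype]
    rw [this]
    exact mul_inv_cancel₀ (by exact_mod_cast hpos.ne')
  · funext τ
    unfold Matrix.vecMul dotProduct
    by_cases hτ : IsProperListColoring G τ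
    · have hterm : ∀ σ, uniformProper G L σ * flipDynamics G L flipProb σ τ
          = uniformProper G L τ * flipDynamics G L flipProb τ σ := by
        intro σ
        by_cases hσ : IsProperListColoring G σ
        · unfold uniformProper
          rw [if_pos hσ, if_pos hτ, flipDynamics_symm hσ hτ]
        · rw [flipDynamics_eq_zero hτ hσ, mul_zero]
          unfold uniformProper
          rw [if_neg hσ, zero_mul]
      rw [Finset.sum_congr rfl fun σ _ => hterm σ, ← Finset.mul_sum, sum_flipDynamics hk hL,
        mul_one]
    · have hτ0 : uniformProper G L τ = 0 := if_neg hτ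
      rw [hτ0]
      refine Finset.sum_eq_zero fun σ _ => ?_
      change uniformProper G L σ * flipDynamics G L flipProb σ τ = 0
      by_cases hσ : IsProperListColoring G σ
      · rw [flipDynamics_eq_zero hσ hτ, mul_zero]
      · unfold uniformProper
        rw [if_neg hσ, zero_mul]

end Stationary

/-! ### Mixing from contraction -/

section Mixing

variable {S : Type*} [Fintype S] [DecidableEq S]

lemma vecMul_pow_eq {P : Matrix S S ℝ} {π : S → ℝ} (h : Matrix.vecMul π P = π) (t : ℕ) :
    Matrix.vecMul π (P ^ t) = π := by
  induction t with
  | zero => simp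
  | succ t ih => rw [pow_succ, ← Matrix.vecMul_vecMul, ih, h]

/-- The total variation distance is tested by functions with values `± 1 / 2`, which are
`1`-Lipschitz for every distance that is at least `1` between distinct points. -/
lemma tvDist_pow_le {P : Matrix S S ℝ} {π : S → ℝ} (hπ : IsStationaryDist P π) {d : S → S → ℝ}
    (hd0 : ∀ x y, 0 ≤ d x y) (hd1 : ∀ x y, x ≠ y → 1 ≤ d x y) {R : ℝ} (hR : ∀ x y, d x y ≤ R)
    {r : ℝ} (hr : 0 < r)
    (hP : ∀ (C : ℝ) (f : S → ℝ), 0 < C → (∀ x y, f x - f y ≤ C * d x y) →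
      ∀ x y, Matrix.mulVec P f x - Matrix.mulVec P f y ≤ r * C * d x y)
    (t : ℕ) (x : S) : tvDist ((P ^ t) x) π ≤ r ^ t * R := by
  obtain ⟨hπ0, hπ1, hπP⟩ := hπ
  set f : S → ℝ := fun y => if π y ≤ (P ^ t) x y then 1 / 2 else -(1 / 2) with hf
  have hlip : ∀ y z, f y - f z ≤ 1 * d y z := by
    intro y z
    rw [one_mul]
    rcases eq_or_ne y z with rfl | hne
    · simpa using hd0 y y
    · refine le_trans ?_ (hd1 y z hne)
      simp only [hf]
      split_ifs <;> norm_num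
  have hiter : ∀ s : ℕ, ∀ y z,
      Matrix.mulVec (P ^ s) f y - Matrix.mulVec (P ^ s) f z ≤ r ^ s * d y z := by
    intro s
    induction s with
    | zero => simpa using hlip
    | succ s ih =>
      intro y z
      have := hP (r ^ s) (Matrix.mulVec (P ^ s) f) (pow_pos hr s) ih y z
      rwa [Matrix.mulVec_mulVec, ← pow_succ', ← pow_succ'] at this
  have h1 : tvDist ((P ^ t) x) π = ∑ y, ((P ^ t) x y - π y) * f y := by
    unfold tvDist
    rw [Finset.mul_sum]
    refine Finset.sum_congr rfl fun y _ => ?_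
    simp only [hf]
    split_ifs with h
    · rw [abs_of_nonneg (sub_nonneg.2 h)]; ring
    · rw [abs_of_neg (sub_neg.2 (not_le.1 h))]; ring
  have h2 : ∑ y, π y * f y = ∑ z, π z * Matrix.mulVec (P ^ t) f z := by
    change π ⬝ᵥ f = π ⬝ᵥ Matrix.mulVec (P ^ t) f
    rw [Matrix.dotProduct_mulVec, vecMul_pow_eq hπP]
  have h3 : ∑ y, ((P ^ t) x y - π y) * f y
      = ∑ z, π z * (Matrix.mulVec (P ^ t) f x - Matrix.mulVec (P ^ t) f z) := by
    simp only [sub_mul, mul_sub, Finset.sum_sub_distrib, h2]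
    rw [← Finset.sum_mul, hπ1, one_mul]
    rfl
  rw [h1, h3]
  calc ∑ z, π z * (Matrix.mulVec (P ^ t) f x - Matrix.mulVec (P ^ t) f z)
      ≤ ∑ z, π z * (r ^ t * R) := Finset.sum_le_sum fun z _ =>
        mul_le_mul_of_nonneg_left ((hiter t x z).trans
          (mul_le_mul_of_nonneg_left (hR x z) (pow_pos hr t).le)) (hπ0 z)
    _ = r ^ t * R := by rw [← Finset.sum_mul, hπ1, one_mul]

lemma mixingTime_le {P : Matrix S S ℝ} {π : S → ℝ} {ε : ℝ} {t : ℕ}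
    (h : ∀ x, tvDist ((P ^ t) x) π ≤ ε) : mixingTime P π ε ≤ t :=
  iSup_le fun x => iInf_le_of_le ⟨t, h x⟩ le_rfl

end Mixing

lemma weightedDist_le {V : Type*} [Fintype V] {wt : V → ℕ} (hwt : ∀ w, wt w = 1 ∨ wt w = 2)
    (x y : V → ℕ) : weightedDist wt x y ≤ 2 * Fintype.card V := by
  refine (setWeight_le_two_mul hwt _).trans ?_
  exact mul_le_mul_of_nonneg_left (by exact_mod_cast Finset.card_le_univ _) zero_le_two

lemma one_le_weightedDist {V : Type*} [Fintype V] {wt : V → ℕ}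
    (hwt : ∀ w, wt w = 1 ∨ wt w = 2) {x y : V → ℕ} (h : x ≠ y) : 1 ≤ weightedDist wt x y := by
  obtain ⟨w, hw⟩ := Function.ne_iff.1 h
  have h1 : (wt w : ℝ) ≤ weightedDist wt x y :=
    Finset.single_le_sum (f := fun w => (wt w : ℝ)) (fun _ _ => Nat.cast_nonneg _)
      (by simpa using hw)
  have h2 : (1 : ℝ) ≤ wt w := by
    exact_mod_cast (show 1 ≤ wt w by rcases hwt w with e | e <;> omega)
  exact h2.trans h1

/-- The mixing time of the flip dynamics when every step contracts. -/
theorem mixingTime_flipDynamics_le {V : Type*} [Fintype V] [DecidableEq V] [Nonempty V]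
    {G : SimpleGraph V} [DecidableRel G.Adj] {L : V → Finset ℕ} {k : ℕ} (hk : 0 < k)
    (hL : ∀ w, (L w).card = k) {wt : V → ℕ} (hwt : ∀ w, wt w = 1 ∨ wt w = 2) {ε : ℝ}
    (hε0 : 0 < ε) (hε1 : ε < 1)
    (hε : ∀ v, 1933 / 650 * ∑ u ∈ G.neighborFinset v, (min (wt v) (wt u) : ℕ)
      ≤ (1 - ε) * k * wt v)
    (hπ : IsStationaryDist (flipDynamics G L flipProb) (uniformProper G L)) :
    mixingTime (flipDynamics G L flipProb) (uniformProper G L) (1 / 4)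
      ≤ (⌈Fintype.card V / ε * Real.log (8 * Fintype.card V)⌉₊ : ℕ) := by
  set m : ℝ := (Fintype.card V : ℝ) with hm
  have hm1 : 1 ≤ m := by
    rw [hm]
    exact_mod_cast (Fintype.card_pos : 0 < Fintype.card V)
  set t := ⌈m / ε * Real.log (8 * m)⌉₊ with ht
  have hr : 0 < 1 - ε / m := by
    rw [sub_pos, div_lt_one (by linarith)]
    linarith
  refine mixingTime_le fun x => ?_
  have h1 := tvDist_pow_le hπ (d := fun σ τ => weightedDist wt (toFun σ) (toFun τ))
    (fun _ _ => weightedDist_nonneg _ _ _)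
    (fun σ τ h => one_le_weightedDist hwt (toFun_injective.ne h))
    (fun σ τ => weightedDist_le hwt _ _) hr
    (fun C f hC hf σ τ => flipDynamics_contraction hk hL hwt hε hC f hf σ τ) t x
  refine h1.trans ?_
  have h2 : (1 - ε / m) ^ t ≤ Real.exp (-(ε / m) * t) := by
    rw [mul_comm, Real.exp_nat_mul]
    exact pow_le_pow_left₀ hr.le (by linarith [Real.add_one_le_exp (-(ε / m))]) t
  have h3 : Real.log (8 * m) ≤ ε / m * t := by
    have h4 := Nat.le_ceil (m / ε * Real.log (8 * m))
    have h5 := mul_le_mul_of_nonneg_left h4 (div_pos hε0 (by linarith : 0 < m)).le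
    have h6 : ε / m * (m / ε * Real.log (8 * m)) = Real.log (8 * m) := by
      have : m ≠ 0 := by linarith
      field_simp
    rwa [h6] at h5
  have h7 : Real.exp (-(ε / m) * t) ≤ (8 * m)⁻¹ := by
    rw [← Real.exp_log (show 0 < 8 * m by linarith), ← Real.exp_neg, Real.exp_le_exp]
    linarith
  calc (1 - ε / m) ^ t * (2 * m) ≤ (8 * m)⁻¹ * (2 * m) :=
        mul_le_mul_of_nonneg_right (h2.trans h7) (by linarith)
    _ = 1 / 4 := by
        have : m ≠ 0 := by linarith
        field_simp
        norm_num

/-! ### Simultaneous edge colourings -/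

section SimEdge

variable {V : Type*} {G₁ G₂ : SimpleGraph V}

open Classical in
/-- The weight of an edge: the number of graphs that contain it. -/
noncomputable def edgeWeight (G₁ G₂ : SimpleGraph V) (e : SimEdge G₁ G₂) : ℕ :=
  (if e.1 ∈ G₁.edgeSet then 1 else 0) + if e.1 ∈ G₂.edgeSet then 1 else 0

lemma edgeWeight_eq (e : SimEdge G₁ G₂) : edgeWeight G₁ G₂ e = 1 ∨ edgeWeight G₁ G₂ e = 2 := by
  unfold edgeWeight
  have := e.2
  split_ifs <;> simp_all

/-- At most `2 Δ` edges of a graph share an endpoint with a given pair of vertices. -/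
lemma card_edges_le [Fintype V] [DecidableEq V] {H : SimpleGraph V} [DecidableRel H.Adj] {Δ : ℕ}
    (hΔ : H.maxDegree ≤ Δ) (e : SimEdge G₁ G₂) (T : Finset (SimEdge G₁ G₂))
    (hT : ∀ f ∈ T, f.1 ∈ H.edgeSet ∧ ∃ v, v ∈ e.1 ∧ v ∈ f.1) : T.card ≤ 2 * Δ := by
  obtain ⟨e, he⟩ := e
  induction e with
  | h x y =>
    have h1 : T.card ≤ (H.incidenceFinset x ∪ H.incidenceFinset y).card := by
      refine Finset.card_le_card_of_injOn Subtype.val (fun f hf => ?_)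
        (Subtype.val_injective.injOn)
      obtain ⟨hfH, v, hv, hvf⟩ := hT f hf
      simp only [Finset.coe_union, Set.mem_union, Finset.mem_coe,
        SimpleGraph.mem_incidenceFinset]
      rcases Sym2.mem_iff.1 hv with rfl | rfl
      · exact Or.inl ⟨hfH, hvf⟩
      · exact Or.inr ⟨hfH, hvf⟩
    have h2 := Finset.card_union_le (H.incidenceFinset x) (H.incidenceFinset y)
    rw [SimpleGraph.card_incidenceFinset_eq_degree, SimpleGraph.card_incidenceFinset_eq_degree]
      at h2
    have h3 := H.degree_le_maxDegree x
    have h4 := H.degree_le_maxDegree y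
    omega

lemma sum_min_edgeWeight_le [Fintype V] [DecidableEq V] [DecidableRel G₁.Adj]
    [DecidableRel G₂.Adj] [Fintype (SimEdge G₁ G₂)] [DecidableRel (simLineGraph G₁ G₂).Adj]
    {Δ : ℕ} (h₁ : G₁.maxDegree ≤ Δ) (h₂ : G₂.maxDegree ≤ Δ) (e : SimEdge G₁ G₂) :
    ∑ f ∈ (simLineGraph G₁ G₂).neighborFinset e, min (edgeWeight G₁ G₂ e) (edgeWeight G₁ G₂ f)
      ≤ 2 * Δ * edgeWeight G₁ G₂ e := by
  classical
  set N := (simLineGraph G₁ G₂).neighborFinset e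
  have hadj : ∀ f ∈ N, (simLineGraph G₁ G₂).Adj e f := fun f hf => by
    simpa [N] using hf
  have hmin : ∀ f ∈ N, min (edgeWeight G₁ G₂ e) (edgeWeight G₁ G₂ f)
      ≤ (if e.1 ∈ G₁.edgeSet then (if f.1 ∈ G₁.edgeSet then 1 else 0) else 0)
        + if e.1 ∈ G₂.edgeSet then (if f.1 ∈ G₂.edgeSet then 1 else 0) else 0 := by
    intro f hf
    have h := (hadj f hf).2.1
    unfold edgeWeight
    split_ifs <;> simp_all
  refine (Finset.sum_le_sum hmin).trans ?_
  have hc₁ : ({f ∈ N | f.1 ∈ G₁.edgeSet} : Finset _).card ≤ 2 * Δ :=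
    card_edges_le h₁ e _ fun f hf =>
      ⟨(Finset.mem_filter.1 hf).2, (hadj f (Finset.mem_filter.1 hf).1).2.2⟩
  have hc₂ : ({f ∈ N | f.1 ∈ G₂.edgeSet} : Finset _).card ≤ 2 * Δ :=
    card_edges_le h₂ e _ fun f hf =>
      ⟨(Finset.mem_filter.1 hf).2, (hadj f (Finset.mem_filter.1 hf).1).2.2⟩
  rw [Finset.sum_add_distrib]
  unfold edgeWeight
  rw [mul_add]
  refine add_le_add ?_ ?_
  · split_ifs
    · rwa [← Finset.sum_filter, ← Finset.card_eq_sum_ones, mul_one]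
    · simp
  · split_ifs
    · rwa [← Finset.sum_filter, ← Finset.card_eq_sum_ones, mul_one]
    · simp

end SimEdge

theorem mainTheorem2 :
    IsFlipSetting flipProb ∧ IsLocalSetting 6 flipProb ∧
    ∃ C : ℝ, ∀ (n Δ k : ℕ) (G₁ G₂ : SimpleGraph (Fin n))
      [DecidableRel G₁.Adj] [DecidableRel G₂.Adj],
      G₁.maxDegree ≤ Δ → G₂.maxDegree ≤ Δ → Nonempty (SimEdge G₁ G₂) →
      (5.948 : ℝ) * Δ ≤ k →
      ∀ L : SimEdge G₁ G₂ → Finset ℕ, (∀ e, (L e).card = k) →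
        IsStationaryDist (flipDynamics (simLineGraph G₁ G₂) L flipProb)
          (uniformProper (simLineGraph G₁ G₂) L) ∧
        ∃ T : ℕ,
          mixingTime (flipDynamics (simLineGraph G₁ G₂) L flipProb)
            (uniformProper (simLineGraph G₁ G₂) L) (1 / 4) = T ∧
          (T : ℝ) ≤ C * Fintype.card (SimEdge G₁ G₂) * Real.log n := by
  classical
  refine ⟨⟨rfl, fun i _ => ⟨flipProb_nonneg i, flipProb_le_one i⟩⟩, fun i hi => by
    rw [flipProb_eq, flipNum_eq_zero hi]; simp, ?_⟩
  -- The relative excess of `5.948 Δ` over `2 κ Δ`, with the cost `κ = 1933 / 650` per neighbour.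
  obtain ⟨ε, hε⟩ : ∃ ε : ℝ, 1 - ε = 1933 / 650 * 2 / 5.948 :=
    ⟨1 - 1933 / 650 * 2 / 5.948, by ring⟩
  have hε0 : 0 < ε := by norm_num at hε; linarith
  have hε1 : ε < 1 := by norm_num at hε; linarith
  refine ⟨5 / ε + 2, fun n Δ k G₁ G₂ _ _ h₁ h₂ hne hk L hL => ?_⟩
  have hn : 2 ≤ n ∧ 1 ≤ Δ := by
    obtain ⟨e, he⟩ := hne
    induction e with
    | h x y =>
      rw [SimpleGraph.mem_edgeSet, SimpleGraph.mem_edgeSet] at he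
      have hxy : x ≠ y := he.elim (fun h => h.ne) fun h => h.ne
      refine ⟨?_, ?_⟩
      · have := Fintype.one_lt_card_iff.2 ⟨x, y, hxy⟩
        rw [Fintype.card_fin] at this
        exact this
      · rcases he with h | h
        · have := (G₁.degree_pos_iff_exists_adj x).2 ⟨y, h⟩
          have := G₁.degree_le_maxDegree x
          omega
        · have := (G₂.degree_pos_iff_exists_adj x).2 ⟨y, h⟩
          have := G₂.degree_le_maxDegree x
          omega
  obtain ⟨hn2, hΔ1⟩ := hn
  have hΔ1' : (1 : ℝ) ≤ Δ := by exact_mod_cast hΔ1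
  have h4k : 4 * Δ < k := by
    have : ((4 * Δ : ℕ) : ℝ) < k := by push_cast; linarith
    exact_mod_cast this
  have hk0 : 0 < k := by omega
  have hwt := edgeWeight_eq (G₁ := G₁) (G₂ := G₂)
  have hsum := sum_min_edgeWeight_le h₁ h₂
  have hstat := isStationaryDist_uniformProper (G := simLineGraph G₁ G₂) hk0 hL
    (exists_properListColoring fun e => by
      rw [hL, ← SimpleGraph.card_neighborFinset_eq_degree, Finset.card_eq_sum_ones]
      refine lt_of_le_of_lt ((Finset.sum_le_sum fun f _ => ?_).trans (hsum e)) ?_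
      · rcases hwt e with h | h <;> rcases hwt f with h' | h' <;> rw [h, h'] <;> decide
      · have : 2 * Δ * edgeWeight G₁ G₂ e ≤ 2 * Δ * 2 :=
          Nat.mul_le_mul_left _ (by rcases hwt e with h | h <;> omega)
        omega)
  refine ⟨hstat, ?_⟩
  have hmix := mixingTime_flipDynamics_le hk0 hL hwt hε0 hε1 (fun e => by
    have h5 : ((∑ f ∈ (simLineGraph G₁ G₂).neighborFinset e,
        min (edgeWeight G₁ G₂ e) (edgeWeight G₁ G₂ f) : ℕ) : ℝ)
        ≤ (2 * Δ * edgeWeight G₁ G₂ e : ℕ) := Nat.cast_le.2 (hsum e)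
    rw [Nat.cast_sum] at h5
    push_cast at h5 ⊢
    rw [hε]
    have h6 := mul_le_mul_of_nonneg_right hk (Nat.cast_nonneg (α := ℝ) (edgeWeight G₁ G₂ e))
    norm_num at h6 ⊢
    linarith) hstat
  obtain ⟨T, hT, hTle⟩ := ENat.le_natCast_iff.1 hmix
  refine ⟨T, hT, ?_⟩
  have hm1 : (1 : ℝ) ≤ Fintype.card (SimEdge G₁ G₂) := by exact_mod_cast Fintype.card_pos
  have hmn : (Fintype.card (SimEdge G₁ G₂) : ℝ) ≤ (n : ℝ) ^ 2 := by
    have h5 : Fintype.card (SimEdge G₁ G₂) ≤ Fintype.card (Sym2 (Fin n)) :=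
      Fintype.card_subtype_le _
    have h6 : Fintype.card (Sym2 (Fin n)) ≤ Fintype.card (Fin n × Fin n) :=
      Fintype.card_le_of_surjective (fun p : Fin n × Fin n => s(p.1, p.2))
        fun e => Sym2.ind (fun x y => ⟨(x, y), rfl⟩) e
    rw [Fintype.card_prod, Fintype.card_fin] at h6
    have h7 := h5.trans h6
    rw [← sq] at h7
    exact_mod_cast h7
  set m : ℝ := (Fintype.card (SimEdge G₁ G₂) : ℝ)
  have hn' : (2 : ℝ) ≤ n := by exact_mod_cast hn2
  have hlogn : 1 / 2 ≤ Real.log n :=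
    (by linarith [Real.log_two_gt_d9] : (1 / 2 : ℝ) ≤ Real.log 2).trans
      (Real.log_le_log (by norm_num) hn')
  have hlog : Real.log (8 * m) ≤ 5 * Real.log n := by
    have h8 : 8 * m ≤ (n : ℝ) ^ 5 := by
      have : (8 : ℝ) ≤ (n : ℝ) ^ 3 := by
        calc (8 : ℝ) = 2 ^ 3 := by norm_num
          _ ≤ (n : ℝ) ^ 3 := pow_le_pow_left₀ (by norm_num) hn' 3
      calc 8 * m ≤ (n : ℝ) ^ 3 * (n : ℝ) ^ 2 := mul_le_mul this hmn (by linarith) (by positivity)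
        _ = (n : ℝ) ^ 5 := by ring
    refine (Real.log_le_log (by linarith) h8).trans_eq ?_
    rw [Real.log_pow]
    norm_num
  have hlog0 : 0 ≤ Real.log (8 * m) := Real.log_nonneg (by linarith)
  have hceil : (⌈m / ε * Real.log (8 * m)⌉₊ : ℝ) ≤ m / ε * Real.log (8 * m) + 1 :=
    (Nat.ceil_lt_add_one (by positivity)).le
  have hTle' : (T : ℝ) ≤ ⌈m / ε * Real.log (8 * m)⌉₊ := by exact_mod_cast hTle
  have h9 : m / ε * Real.log (8 * m) ≤ m / ε * (5 * Real.log n) :=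
    mul_le_mul_of_nonneg_left hlog (by positivity)
  have h10 : 1 ≤ 2 * (m * Real.log n) := by nlinarith
  calc (T : ℝ) ≤ m / ε * (5 * Real.log n) + 2 * (m * Real.log n) := by linarith
    _ = (5 / ε + 2) * m * Real.log n := by ring
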